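/- Let $p$ be a prime, $N_0,N'\ge 1$ integers prime to $p$, $N=pN_0$, and $k,k',m$ integers with $k'-k>2m+4$. Let $h=\sum a(n,h)q^n\in S_k(\Gamma_1(N))$ and $h'=\sum a(n,h')q^n\in S_{k'}(\Gamma_1(N'))$ be normalized Hecke eigenforms (for instance newforms) with nebentypus characters $\chi$ (induced from a Dirichlet character mod $N_0$, still denoted $\chi$) and $\chi'$. Let $L_p(s,h\times h')=\prod_{\alpha,\alpha'}(1-\alpha\alpha'p^{-s})^{-1}$ be the Rankin–Selberg Euler factor, where $\alpha$ runs over the roots of $X^2-a(p,h)X$ and $\alpha'$ over the roots of $X^2-a(p,h')X+\chi'(p)p^{k'-1}$. Let $\chi_p,\chi'_{1,p},\chi'_{2,p}$ be unramified characters of $\mathbb{Q}_p^\times$ with $$\chi_p(p)=p^{m}a(p,h),\qquad \chi_p(p)^2=p^{k-2+2m}\chi(p),$$ $$\chi'_{1,p}(p)+\chi'_{2,p}(p)=p^{-1/2}a(p,h'^\rho),\qquad \chi'_{1,p}(p)\chi'_{2,p}(p)=p^{k'-2}\chi'(p)^{-1},$$ where $h'^\rho$ is the form dual to $h'$, so that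 $a(p,h'^\rho)=\chi'(p)^{-1}a(p,h')=\overline{a(p,h')}$. Put $\sigma_p=\mathrm{St}\otimes\chi_p\subset I(|\cdot|^{1/2}\chi_p,|\cdot|^{-1/2}\chi_p)$ and $\sigma'_p=I(\chi'_{1,p},\chi'_{2,p})$ (normalized induction). For newforms these are the components at $p$ of $\Pi(h)|\cdot|^{-k/2+1-m}$ and $\Pi(h'^\rho)|\cdot|^{-k'/2+1}$, where $\Pi(\cdot)$ is the attached unitary automorphic representation. Let $v_p\in\sigma_p$ be the vector fixed by $\{g\in\mathrm{GL}_2(\mathbb{Z}_p): g\equiv(\begin{smallmatrix}*&*\\0&1\end{smallmatrix})\bmod p\}$ with $v_p(1)=1$ and $v_p(\begin{smallmatrix}0&-1\\1&0\end{smallmatrix})=-1/p$, and let $v'_p\in\sigma'_p$ be the $\mathrm{GL}_2(\mathbb{Z}_p)$-fixed vector with $v'_p(1)=1$. Let $P=M_PU_P\subset\mathrm{GL}_4$ be the upper triangular $(2,2)$ parabolic, and for $s\in\mathbb{C}$ let $I_P(s,\sigma\otimes\sigma')$ be the normalized parabolic induction of $\sigma|\det|^{s/2}\otimes\sigma'|\det|^{-s/2}$.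 Let $K_p\subset\mathrm{GL}_4(\mathbb{Z}_p)$ be the mirahoric subgroup of matrices with last row $\equiv(0,0,0,1)\bmod p$, and let $\xi_p^{(j)}$ be the identity matrix with an extra entry $p^j$ in position $(4,2)$. Let $\phi'_p\in I_P(-2,\sigma_p\otimes\sigma'_p)$ and $\tilde\phi'_p\in I_P(2,\sigma'_p\otimes\sigma_p)$ be the $K_p$-fixed vectors with $\phi'_p(\xi_p^{(0)})=v_p\otimes v'_p$ and $\tilde\phi'_p(\xi_p^{(1)})=v'_p\otimes v_p$. Let $$(T_{\rm st}(s,\sigma_p\otimes\sigma'_p)\phi)(g)=\int_{U_P(\mathbb{Q}_p)}\phi(w_0^{-1}ug)\,du,\qquad w_0=\begin{pmatrix}0&1_2\\1_2&0\end{pmatrix},\quad \mathrm{vol}(U_P(\mathbb{Z}_p))=1,$$ the values being carried to $\sigma'_p\otimes\sigma_p$ by the swap. Then at $s=-2$ the integral defining $T_{\rm st}\phi'_p$ converges for every $g\in\mathrm{GL}_4(\mathbb{Q}_p)$ (absolutely after pairing with any smooth linear functional on $\sigma_p\otimes\sigma'_p$), and $$T_{\rm st}(-2,\sigma_p\otimes\sigma'_p)\,\phi'_p=c'_p\,\tilde\phi'_p,\qquad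 c'_p=\frac{L_p(k'-3-m,\,h\times h')}{L_p(k'-2-m,\,h\times h')}.$$ For $m=-1$ this is $c'_p=L_p(k'-2,h\times h')/L_p(k'-1,h\times h')$. -/

import Mathlib

open scoped TensorProduct MatrixGroups ModularForm
open MeasureTheory Matrix UpperHalfPlane

noncomputable section

namespace LocalCalc

/-! ### Modular forms and their Rankin-Selberg Euler factors -/

/-- The group `Γ₁(N)` as a subgroup of `GL₂(ℝ)`. -/
abbrev Gamma1R (N : ℕ) : Subgroup (GL (Fin 2) ℝ) :=
  (CongruenceSubgroup.Gamma1 N).map (Matrix.SpecialLinearGroup.mapGL ℝ)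

/-- The `n`-th Fourier coefficient `a(n, h)`, where `h = ∑ a(n, h) qⁿ` and `q = e^{2πiz}`. -/
def fourierCoeff {N : ℕ} {k : ℤ} (h : CuspForm (Gamma1R N) k) (n : ℕ) : ℂ :=
  (UpperHalfPlane.qExpansion 1 h).coeff n

/-- `h ∈ S_k(N, χ)` is normalized, and it is an eigenform of every Hecke operator `T_ℓ`,
`ℓ` prime (`U_ℓ` when `ℓ ∣ N`). -/
structure IsNormalizedEigenform {N : ℕ} {k : ℤ} (χ : DirichletCharacter ℂ N)
    (h : CuspForm (Gamma1R N) k) : Prop where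
  nebentypus : ∀ γ ∈ CongruenceSubgroup.Gamma0 N,
    ((h : ℍ → ℂ) ∣[k] γ) = χ ((γ 1 1 : ℤ) : ZMod N) • (h : ℍ → ℂ)
  coeff_one : fourierCoeff h 1 = 1
  hecke : ∀ l : ℕ, l.Prime → ∀ n : ℕ,
    fourierCoeff h (l * n) +
        χ (l : ZMod N) * (l : ℂ) ^ (k - 1) * (if l ∣ n then fourierCoeff h (n / l) else 0) =
      fourierCoeff h l * fourierCoeff h n

/-- The multiset `{α, β}` of Satake parameters of `h` at `p`:
`α + β = a(p, h)` and `α β = χ(p) p^{k-1}`. -/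
def satakeRoots {N : ℕ} {k : ℤ} (p : ℕ) (χ : DirichletCharacter ℂ N)
    (h : CuspForm (Gamma1R N) k) : Multiset ℂ :=
  (Polynomial.X ^ 2 - Polynomial.C (fourierCoeff h p) * Polynomial.X +
    Polynomial.C (χ (p : ZMod N) * (p : ℂ) ^ (k - 1))).roots

/-- The Euler factor at `p` of the Rankin-Selberg `L`-function:
`L_p(s, h × h') = ∏_{α, α'} (1 - α α' p^{-s})⁻¹`. -/
def rankinSelbergFactor {N N' : ℕ} {k k' : ℤ} (p : ℕ)
    (χ : DirichletCharacter ℂ N) (h : CuspForm (Gamma1R N) k)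
    (χ' : DirichletCharacter ℂ N') (h' : CuspForm (Gamma1R N') k') (s : ℂ) : ℂ :=
  (((satakeRoots p χ h) ×ˢ (satakeRoots p χ' h')).map
    fun x => (1 - x.1 * x.2 * (p : ℂ) ^ (-s))⁻¹).prod

/-! ### Smooth functions, right translation -/

section Smooth

variable {G : Type*} [Group G] [TopologicalSpace G]

/-- `f` is invariant under right translation by some open subgroup. -/
def IsSmooth {E : Type*} (f : G → E) : Prop :=
  ∃ U : Subgroup G, IsOpen (U : Set G) ∧ ∀ g, ∀ u ∈ U, f (g * u) = f g

lemma IsSmooth.map₂ {E : Type*} {f f' : G → E} (hf : IsSmooth f) (hf' : IsSmooth f')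
    (F : E → E → E) : IsSmooth fun g => F (f g) (f' g) := by
  obtain ⟨U, hU, h⟩ := hf
  obtain ⟨U', hU', h'⟩ := hf'
  refine ⟨U ⊓ U', by simpa using hU.inter hU', fun g u hu => ?_⟩
  simp only [h g u hu.1, h' g u hu.2]

lemma isSmooth_const {E : Type*} (e : E) : IsSmooth fun _ : G => e :=
  ⟨⊤, by simp, fun _ _ _ => rfl⟩

lemma IsSmooth.translate [IsTopologicalGroup G] {E : Type*} {f : G → E} (hf : IsSmooth f) (x : G) :
    IsSmooth fun g => f (g * x) := by
  obtain ⟨U, hU, h⟩ := hf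
  refine ⟨U.comap (MulAut.conj x⁻¹).toMonoidHom, ?_, fun g u hu => ?_⟩
  · refine hU.preimage (f := fun u => x⁻¹ * u * x⁻¹⁻¹) ?_
    fun_prop
  · have := h (g * x) _ hu
    simpa [mul_assoc] using this

end Smooth

/-- Functions on `G` under right translation, `(ρ(g) f)(x) = f(x g)`. -/
def rightTranslation (G : Type*) [Group G] : Representation ℂ G (G → ℂ) where
  toFun g :=
    { toFun := fun f x => f (x * g)
      map_add' := fun _ _ => rfl
      map_smul' := fun _ _ => rfl }
  map_one' := by ext; simp
  map_mul' a b := by ext; simp [mul_assoc]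

@[simp] lemma rightTranslation_apply {G : Type*} [Group G] (g x : G) (f : G → ℂ) :
    rightTranslation G g f x = f (x * g) := rfl

/-! ### Characters, measure and subgroups over `ℚ_p` -/

section Padic

variable (p : ℕ) [Fact p.Prime]

instance instMeasurableSpacePadic : MeasurableSpace ℚ_[p] := borel _

instance instBorelSpacePadic : BorelSpace ℚ_[p] := ⟨rfl⟩

/-- The Haar measure on `ℚ_p` with `vol(ℤ_p) = 1`. -/
def padicHaar : Measure ℚ_[p] :=
  Measure.addHaarMeasure
    ⟨⟨Metric.closedBall 0 1, isCompact_closedBall 0 1⟩,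
      ⟨0, Metric.ball_subset_interior_closedBall (Metric.mem_ball_self one_pos)⟩⟩

/-- The element `p` of `ℚ_pˣ`. -/
def unif : ℚ_[p]ˣ :=
  Units.mk0 (p : ℚ_[p]) (Nat.cast_ne_zero.mpr (Fact.out : p.Prime).ne_zero)

variable {p}

/-- A character of `ℚ_pˣ` is unramified if it is trivial on `ℤ_pˣ`. -/
def IsUnramified (χ : ℚ_[p]ˣ →* ℂˣ) : Prop :=
  ∀ u : ℚ_[p]ˣ, ‖(u : ℚ_[p])‖ = 1 → χ u = 1

variable (p) in
/-- The character `|·|^s` of `ℚ_pˣ`. -/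
def normPow (s : ℝ) : ℚ_[p]ˣ →* ℂˣ where
  toFun x := Units.mk0 ((‖(x : ℚ_[p])‖ ^ s : ℝ) : ℂ)
    (Complex.ofReal_ne_zero.mpr
      (Real.rpow_pos_of_pos (norm_pos_iff.mpr x.ne_zero) s).ne')
  map_one' := by ext; simp
  map_mul' x y := by
    ext
    simp [Real.mul_rpow (norm_nonneg (x : ℚ_[p])) (norm_nonneg (y : ℚ_[p]))]

/-- The matrix `(a b; 0 d)`. -/
def borel2 (a d : ℚ_[p]ˣ) (b : ℚ_[p]) : GL (Fin 2) ℚ_[p] :=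
  GeneralLinearGroup.mkOfDetNeZero !![(a : ℚ_[p]), b; 0, (d : ℚ_[p])]
    (by simp [det_fin_two])

variable (p) in
/-- The matrix `𝐰 = (0 -1; 1 0)`. -/
def weyl2 : GL (Fin 2) ℚ_[p] :=
  GeneralLinearGroup.mkOfDetNeZero !![0, -1; 1, 0] (by simp [det_fin_two])

variable (p) in
/-- The mirahoric subgroup of level `pⁿ` of `GL_ι(ℤ_p)`, inside `GL_ι(ℚ_p)`: the row of index
`last` is congruent mod `pⁿ` to that of the identity. For `n = 0` it is `GL_ι(ℤ_p)`. -/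
def mirahoric {ι : Type} [Fintype ι] [DecidableEq ι] (last : ι) (n : ℕ) :
    Set (GL ι ℚ_[p]) :=
  {g | ∃ k : GL ι ℤ_[p],
    GeneralLinearGroup.map (PadicInt.Coe.ringHom (p := p)) k = g ∧
      ∀ j, (p : ℤ_[p]) ^ n ∣ (k : Matrix ι ι ℤ_[p]) last j - (1 : Matrix ι ι ℤ_[p]) last j}

/-! ### Representations of `GL₂(ℚ_p)` -/

/-- The normalized induced representation `I(μ₁, μ₂)` of `GL₂(ℚ_p)`: smooth functions with
`f((a b; 0 d) g) = |a/d|^{1/2} μ₁(a) μ₂(d) f(g)`, under right translation. -/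
def principalSeries (μ₁ μ₂ : ℚ_[p]ˣ →* ℂˣ) :
    Subrepresentation (rightTranslation (GL (Fin 2) ℚ_[p])) where
  toSubmodule :=
    { carrier := {f | IsSmooth f ∧ ∀ (a d : ℚ_[p]ˣ) (b : ℚ_[p]) (g : GL (Fin 2) ℚ_[p]),
        f (borel2 a d b * g) = normPow p (1 / 2) (a / d) * μ₁ a * μ₂ d * f g}
      zero_mem' := ⟨isSmooth_const 0, by simp⟩
      add_mem' := by
        rintro f f' ⟨hf, h⟩ ⟨hf', h'⟩
        refine ⟨hf.map₂ hf' (· + ·), fun a d b g => ?_⟩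
        simp only [Pi.add_apply, h, h']
        ring
      smul_mem' := by
        rintro c f ⟨hf, h⟩
        refine ⟨hf.map₂ hf fun x _ => c * x, fun a d b g => ?_⟩
        simp only [Pi.smul_apply, smul_eq_mul, h]
        ring }
  apply_mem_toSubmodule := by
    rintro x f ⟨hf, h⟩
    refine ⟨hf.translate x, fun a d b g => ?_⟩
    simp only [rightTranslation_apply, mul_assoc (borel2 a d b), h]

/-- The twist `St ⊗ χ` of the Steinberg representation: the subrepresentation of
`I(|·|^{1/2} χ, |·|^{-1/2} χ)` which is the kernel of the intertwining map
`f ↦ (g ↦ ∫ f(𝐰 (1 x; 0 1) g) dx)`, whose image is the one-dimensional `χ ∘ det`. (The integrals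
converge for every `f` in the induced representation.) -/
def steinberg (χ : ℚ_[p]ˣ →* ℂˣ) :
    Subrepresentation (rightTranslation (GL (Fin 2) ℚ_[p])) where
  toSubmodule :=
    { carrier := {f | f ∈ (principalSeries (normPow p (1 / 2) * χ)
          (normPow p (-(1 / 2)) * χ)).toSubmodule ∧
        ∀ g : GL (Fin 2) ℚ_[p],
          Integrable (fun x => f (weyl2 p * borel2 1 1 x * g)) (padicHaar p) ∧
          ∫ x, f (weyl2 p * borel2 1 1 x * g) ∂(padicHaar p) = 0}
      zero_mem' := ⟨Submodule.zero_mem _, by simp⟩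
      add_mem' := by
        rintro f f' ⟨hf, h⟩ ⟨hf', h'⟩
        refine ⟨Submodule.add_mem _ hf hf', fun g => ⟨(h g).1.add (h' g).1, ?_⟩⟩
        simp only [Pi.add_apply]
        rw [integral_add (h g).1 (h' g).1, (h g).2, (h' g).2, add_zero]
      smul_mem' := by
        rintro c f ⟨hf, h⟩
        refine ⟨Submodule.smul_mem _ c hf, fun g => ⟨(h g).1.smul c, ?_⟩⟩
        simp only [Pi.smul_apply]
        rw [integral_smul, (h g).2, smul_zero] }
  apply_mem_toSubmodule := by
    rintro y f ⟨hf, h⟩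
    refine ⟨Subrepresentation.apply_mem_toSubmodule _ y hf, fun g => ?_⟩
    simp only [rightTranslation_apply, mul_assoc _ g y]
    exact h (g * y)

/-- The canonical new vector of `St ⊗ χ`, `χ` unramified. -/
structure IsSteinbergNewVector {χ : ℚ_[p]ˣ →* ℂˣ} (v : (steinberg χ).toSubmodule) : Prop where
  invariant : ∀ k ∈ mirahoric p (1 : Fin 2) 1, (steinberg χ).toRepresentation k v = v
  apply_one : v.1 1 = 1
  apply_weyl : v.1 (weyl2 p) = -1 / (p : ℂ)

/-- The normalized spherical vector of `I(μ₁, μ₂)`, `μ₁` and `μ₂` unramified. -/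
structure IsSphericalVector {μ₁ μ₂ : ℚ_[p]ˣ →* ℂˣ}
    (v : (principalSeries μ₁ μ₂).toSubmodule) : Prop where
  invariant : ∀ k ∈ mirahoric p (1 : Fin 2) 0, (principalSeries μ₁ μ₂).toRepresentation k v = v
  apply_one : v.1 1 = 1

/-- `St ⊗ χp` is the component at `p` of `Π(h)|·|^{-k/2+1-m}`, where `Π(h)` is the unitary
automorphic representation attached to `h`, whose nebentypus `χ` is given by a character modulo
`N₀` prime to `p`: the local `L`-factors `(1 - χp(p) p^{-s-1/2})⁻¹` and `L_p(s+1/2+m, h)` agree,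
and so do the central characters. -/
structure IsSteinbergComponent {N N₀ : ℕ} {k : ℤ} (χ : DirichletCharacter ℂ N₀)
    (h : CuspForm (Gamma1R N) k) (m : ℤ) (χp : ℚ_[p]ˣ →* ℂˣ) : Prop where
  unramified : IsUnramified χp
  lFactor : (χp (unif p) : ℂ) = (p : ℂ) ^ m * fourierCoeff h p
  central : (χp (unif p) : ℂ) ^ 2 = (p : ℂ) ^ (k - 2 + 2 * m) * χ (p : ZMod N₀)

/-- `I(μ₁, μ₂)` is the component at `p`, prime to the level of `h'`, of
`Π(h'^ρ)|·|^{-k'/2+1}`, where `h'^ρ` is the form dual to `h'`, whose nebentypus is `χ'⁻¹` and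
whose Fourier coefficient at `p` is `χ'(p)⁻¹ a(p, h')`. -/
structure IsDualUnramifiedComponent {N' : ℕ} {k' : ℤ} (χ' : DirichletCharacter ℂ N')
    (h' : CuspForm (Gamma1R N') k') (μ₁ μ₂ : ℚ_[p]ˣ →* ℂˣ) : Prop where
  unramified₁ : IsUnramified μ₁
  unramified₂ : IsUnramified μ₂
  trace : (μ₁ (unif p) : ℂ) + μ₂ (unif p) =
    (p : ℂ) ^ (-(1 / 2) : ℂ) * ((χ' (p : ZMod N'))⁻¹ * fourierCoeff h' p)
  central : (μ₁ (unif p) : ℂ) * μ₂ (unif p) = (p : ℂ) ^ (k' - 2) * (χ' (p : ZMod N'))⁻¹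

/-! ### `GL₄(ℚ_p)`, parabolic induction and the standard intertwining operator.
Rows and columns are indexed by `Fin 2 ⊕ Fin 2`, so that matrices are written in `2 × 2` blocks. -/

variable (p) in
/-- `GL₄(ℚ_p)`. -/
abbrev GL4 : Type := GL (Fin 2 ⊕ Fin 2) ℚ_[p]

/-- The element `diag(A, D)` of the Levi subgroup `M_P`. -/
def levi (A D : GL (Fin 2) ℚ_[p]) : GL4 p where
  val := fromBlocks A 0 0 D
  inv := fromBlocks ↑A⁻¹ 0 0 ↑D⁻¹
  val_inv := by simp [fromBlocks_multiply]
  inv_val := by simp [fromBlocks_multiply]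

/-- The element `(1 X; 0 1)` of the unipotent radical `U_P`. -/
def unip (X : Matrix (Fin 2) (Fin 2) ℚ_[p]) : GL4 p where
  val := fromBlocks 1 X 0 1
  inv := fromBlocks 1 (-X) 0 1
  val_inv := by simp [fromBlocks_multiply]
  inv_val := by simp [fromBlocks_multiply]

variable (p) in
/-- The element `w₀ = (0 1; 1 0)`. -/
def weyl4 : GL4 p where
  val := fromBlocks 0 1 1 0
  inv := fromBlocks 0 1 1 0
  val_inv := by simp [fromBlocks_multiply]
  inv_val := by simp [fromBlocks_multiply]

variable (p) in
/-- The double coset representative `ξ^{(j)}`, the identity matrix with an extra entry `p^j` in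
position `(4, 2)`. -/
def xi (j : ℕ) : GL4 p where
  val := fromBlocks 1 0 !![0, 0; 0, (p : ℚ_[p]) ^ j] 1
  inv := fromBlocks 1 0 (-!![0, 0; 0, (p : ℚ_[p]) ^ j]) 1
  val_inv := by rw [fromBlocks_multiply]; simp only [mul_one, one_mul, mul_zero, zero_mul,
    add_zero, zero_add, add_neg_cancel, fromBlocks_one]
  inv_val := by rw [fromBlocks_multiply]; simp only [mul_one, one_mul, mul_zero, zero_mul,
    add_zero, zero_add, neg_add_cancel, fromBlocks_one]

variable {V W : Type*} [AddCommGroup V] [Module ℂ V] [AddCommGroup W] [Module ℂ W]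

/-- `I_P(s, σ ⊗ σ')`: the representation of `GL₄(ℚ_p)` obtained by normalized parabolic induction
from `σ|det|^{s/2} ⊗ σ'|det|^{-s/2}`; the modulus is `δ_P^{1/2}(diag(A, D)) = |det A / det D|`. -/
def parabolicInduction (σ : Representation ℂ (GL (Fin 2) ℚ_[p]) V)
    (σ' : Representation ℂ (GL (Fin 2) ℚ_[p]) W) (s : ℂ) :
    Submodule ℂ (GL4 p → V ⊗[ℂ] W) where
  carrier := {f | IsSmooth f ∧
    ∀ (A D : GL (Fin 2) ℚ_[p]) (X : Matrix (Fin 2) (Fin 2) ℚ_[p]) (g : GL4 p),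
      f (levi A D * unip X * g) =
        ((‖(A : Matrix (Fin 2) (Fin 2) ℚ_[p]).det‖ /
          ‖(D : Matrix (Fin 2) (Fin 2) ℚ_[p]).det‖ : ℝ) : ℂ) ^ (1 + s / 2) •
            TensorProduct.map (σ A) (σ' D) (f g)}
  zero_mem' := ⟨isSmooth_const 0, by simp⟩
  add_mem' := by
    rintro f f' ⟨hf, h⟩ ⟨hf', h'⟩
    refine ⟨hf.map₂ hf' (· + ·), fun A D X g => ?_⟩
    simp only [Pi.add_apply, h, h', map_add, smul_add]
  smul_mem' := by
    rintro c f ⟨hf, h⟩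
    refine ⟨hf.map₂ hf fun x _ => c • x, fun A D X g => ?_⟩
    simp only [Pi.smul_apply, h, map_smul]
    rw [smul_comm]

/-- Smooth linear functionals on `σ ⊗ σ'`. -/
def IsSmoothFunctional (σ : Representation ℂ (GL (Fin 2) ℚ_[p]) V)
    (σ' : Representation ℂ (GL (Fin 2) ℚ_[p]) W) (l : V ⊗[ℂ] W →ₗ[ℂ] ℂ) : Prop :=
  ∃ U : Subgroup (GL (Fin 2) ℚ_[p]), IsOpen (U : Set (GL (Fin 2) ℚ_[p])) ∧
    ∀ A ∈ U, ∀ D ∈ U, ∀ x, l (TensorProduct.map (σ A) (σ' D) x) = l x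

variable (p) in
/-- The product measure `dx₁ dx₂ dx₃ dx₄` on `U_P(ℚ_p) = ℚ_p⁴`, with `vol(U_P(ℤ_p)) = 1`. -/
def unipMeasure : Measure (Fin 2 × Fin 2 → ℚ_[p]) :=
  Measure.pi fun _ => padicHaar p

/-- `F = T_st(s, σ ⊗ σ') f`, that is, `F(g) = ∫_{U_P(ℚ_p)} f(w₀⁻¹ u g) du` for every `g`, the values
being carried from `σ ⊗ σ'` to `σ' ⊗ σ` by the swap. The vector-valued integral converges in the
usual sense: absolutely after pairing with any smooth functional. (Smooth functionals separate the
vectors of a smooth representation, so `f` determines `F`.) -/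
def IsStandardIntertwiningImage (σ : Representation ℂ (GL (Fin 2) ℚ_[p]) V)
    (σ' : Representation ℂ (GL (Fin 2) ℚ_[p]) W) (s : ℂ)
    (f : parabolicInduction σ σ' s) (F : parabolicInduction σ' σ (-s)) : Prop :=
  ∀ (g : GL4 p) (l : V ⊗[ℂ] W →ₗ[ℂ] ℂ), IsSmoothFunctional σ σ' l →
    Integrable (fun x : Fin 2 × Fin 2 → ℚ_[p] =>
      l (f.1 ((weyl4 p)⁻¹ * unip (Matrix.of fun i j => x (i, j)) * g))) (unipMeasure p) ∧
    ∫ x : Fin 2 × Fin 2 → ℚ_[p],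
        l (f.1 ((weyl4 p)⁻¹ * unip (Matrix.of fun i j => x (i, j)) * g)) ∂(unipMeasure p) =
      l (TensorProduct.comm ℂ W V (F.1 g))

/-- `f` is the vector of `I_P(s, σ ⊗ σ')` fixed by the mirahoric subgroup `K_p^n` of `GL₄(ℤ_p)`
and with value `x` at `ξ^{(j)}`. -/
structure IsMirahoricVector {σ : Representation ℂ (GL (Fin 2) ℚ_[p]) V}
    {σ' : Representation ℂ (GL (Fin 2) ℚ_[p]) W} {s : ℂ} (n j : ℕ) (x : V ⊗[ℂ] W)
    (f : parabolicInduction σ σ' s) : Prop where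
  invariant : ∀ k ∈ mirahoric p (Sum.inr 1 : Fin 2 ⊕ Fin 2) n, ∀ g, f.1 (g * k) = f.1 g
  apply_xi : f.1 (xi p j) = x

end Padic

end LocalCalc

end

/-!
The proof is a computation with the values of `φ = φ'_p`; nothing is used about `σ_p` and `σ'_p` except
the action of `GL₂(ℤ_p)`, of the centre, of `U_p` and of the Atkin-Lehner element on the vectors
`v_p` and `v'_p`, which is collected in `IsIwahoriEigenvector` and `IsSphericalEigenvector`, and the
fact that `St ⊗ χ_p` is smooth without nonzero vectors fixed by `GL₂(ℤ_p)`
(`steinberg_eq_zero_of_fixed`). At `s = -2` the modulus of `P` cancels the twist, so that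
`φ(diag(A, D) u g) = (σ(A) ⊗ σ'(D)) φ(g)`.

*Reduction to two values.* By the Iwasawa decomposition, `GL₄(ℚ_p)` is the union of `P K_p` and
`P ξ⁽⁰⁾ K_p`. Since `T_st φ` and `φ̃'_p` transform alike under `P` and `K_p`, it is enough to compare
them at `1` and at `ξ⁽⁰⁾` (`isStandardIntertwiningImage_of_values`). At `ξ⁽⁰⁾` both are fixed by
`GL₂(ℤ_p)` acting through `σ`, hence zero; for `T_st φ` one averages a smooth functional over
`GL₂(ℤ_p)` (`IsNewInducedVector.hasIntertwiningIntegral_xi`). For the same reason `φ` vanishes on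
`P K_p`.

*Convergence.* Write `u = u(Y)` and `Y = k₁ diag(p⁻ⁱ, p⁻ʲ) k₂ + X` with `i ≥ j ≥ 0` and `X` integral. The
value of `φ` at `w₀⁻¹ u(Y) κ` is then zero or a translate of `v ⊗ v'` by `diag(pⁱ, pʲ)` and
`diag(p⁻ⁱ, p⁻ʲ)`, up to elements of `GL₂(ℤ_p)`. The matrix coefficients are bounded by means of the
eigenvalues (`exists_bound_coefficient`), and the set of such `Y` has measure at most `4 p^{3i+j}`
(`unipMeasure_cartanCell_le`). The sum over `i` and `j` is dominated by a convergent one if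
`p |c| R < |ω|` and `p⁴ |c|² < |ω|`, where `c = χ_p(p)`, `ω` is the value at `p` of the central
character of `σ'`, and `R` bounds the roots of the Hecke polynomial of `v'`
(`IsNewInducedVector.integrable`). By the Hecke bound `R = p^{k'/2}` for the Satake parameters of `h'`
(`IsNormalizedEigenform.norm_le`), both inequalities say that `2m + 4 < k' - k`.

*The value at `1`.* The function `Y ↦ φ(w₀⁻¹ u(Y))` is invariant under `M₂(ℤ_p)` and supported where the
second column of `Y` is congruent to an integral multiple of the first
(`IsNewInducedVector.bigCell_support`). Where the first column has denominator `pⁿ`, the sum over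
these multiples gives `U_pⁿ` on `v`, and the sum over the directions of the first column is a Hecke
operator on `v'`, so that the integral is an explicit multiple of `l(v ⊗ v')`
(`IsNewInducedVector.setIntegral_columnDenom_succ`). The resulting series in `n` has the sum
`∏ᵢ (1 - (c/ω) τᵢ) / (1 - p (c/ω) τᵢ)`, where `τ₁` and `τ₂` are the roots of the Hecke polynomial
(`IsNewInducedVector.hasIntertwiningIntegral_one`). In terms of the Satake parameters this is the
quotient of Euler factors (`ratio_rankinSelbergFactor`).
-/

noncomputable section

namespace LocalCalc

/-! ### Haar measure on `ℚ_p` and on `M₂(ℚ_p)` -/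

section Haar
variable (p : ℕ) [hp : Fact p.Prime]

instance : (padicHaar p).IsAddHaarMeasure := by unfold padicHaar; infer_instance
instance : (unipMeasure p).IsAddHaarMeasure := by unfold unipMeasure; infer_instance
instance : (unipMeasure p).Regular := by unfold unipMeasure; infer_instance

lemma padicHaar_closedBall_one : padicHaar p (Metric.closedBall 0 1) = 1 :=
  Measure.addHaarMeasure_self

lemma prime_pos_real : (0 : ℝ) < p := by exact_mod_cast hp.out.pos

lemma one_lt_prime_real : (1 : ℝ) < p := by exact_mod_cast hp.out.one_lt

lemma prime_ne_zero_padic : (p : ℚ_[p]) ≠ 0 := by exact_mod_cast hp.out.ne_zero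

variable {p}

lemma padic_norm_sub_le_max (x y : ℚ_[p]) : ‖x - y‖ ≤ max ‖x‖ ‖y‖ := by
  simpa [sub_eq_add_neg] using Padic.nonarchimedean x (-y)

/-- A `p`-adic integer is congruent modulo `pⁿ` to a natural number below `pⁿ`. -/
lemma exists_natCast_sub_norm_le (n : ℕ) {x : ℚ_[p]} (hx : ‖x‖ ≤ 1) :
    ∃ a < p ^ n, ‖x - (a : ℚ_[p])‖ ≤ (p : ℝ) ^ (-(n : ℤ)) := by
  obtain ⟨x, rfl⟩ : ∃ y : ℤ_[p], (y : ℚ_[p]) = x := ⟨⟨x, hx⟩, rfl⟩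
  refine ⟨PadicInt.appr x n, PadicInt.appr_lt _ _, ?_⟩
  have := (PadicInt.norm_le_pow_iff_mem_span_pow _ n).2 (PadicInt.appr_spec n x)
  rwa [PadicInt.norm_def, PadicInt.coe_sub, PadicInt.coe_natCast] at this

lemma eq_of_natCast_sub_norm_le {n a b : ℕ} (ha : a < p ^ n) (hb : b < p ^ n)
    (h : ‖(a : ℚ_[p]) - b‖ ≤ (p : ℝ) ^ (-(n : ℤ))) : a = b := by
  have h1 : ((p ^ n : ℕ) : ℤ) ∣ (a : ℤ) - b := by
    rw [Nat.cast_pow]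
    have := (Padic.norm_int_le_pow_iff_dvd (p := p) ((a : ℤ) - b) n).1 (by simpa using h)
    simpa using this
  have h2 := (Nat.modEq_iff_dvd.2 h1)
  rw [Nat.ModEq, Nat.mod_eq_of_lt ha, Nat.mod_eq_of_lt hb] at h2
  exact h2.symm

variable (p) in
lemma padicHaar_closedBall_succ (n : ℤ) :
    padicHaar p (Metric.closedBall 0 ((p : ℝ) ^ (n + 1))) =
      p * padicHaar p (Metric.closedBall 0 ((p : ℝ) ^ n)) := by
  have hp0 := prime_pos_real p
  have hpp : ‖(p : ℚ_[p]) ^ (-(n + 1))‖ = (p : ℝ) ^ (n + 1) := by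
    rw [Padic.norm_p_zpow, neg_neg]
  have h : Metric.closedBall (0 : ℚ_[p]) ((p : ℝ) ^ (n + 1)) =
      ⋃ a ∈ Finset.range p,
        Metric.closedBall ((p : ℚ_[p]) ^ (-(n + 1)) * a) ((p : ℝ) ^ n) := by
    ext x
    simp only [Metric.mem_closedBall, Set.mem_iUnion, dist_eq_norm, sub_zero, Finset.mem_range,
      exists_prop]
    have key : ∀ a : ℚ_[p], ‖x - (p : ℚ_[p]) ^ (-(n + 1)) * a‖ =
        (p : ℝ) ^ (n + 1) * ‖(p : ℚ_[p]) ^ (n + 1) * x - a‖ := by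
      intro a
      rw [← hpp, ← norm_mul, mul_sub, ← mul_assoc, ← zpow_add₀ (prime_ne_zero_padic p)]
      simp
    constructor
    · intro hx
      obtain ⟨a, ha, hxa⟩ := exists_natCast_sub_norm_le 1 (x := (p : ℚ_[p]) ^ (n + 1) * x) (by
        rw [norm_mul, Padic.norm_p_zpow, _root_.zpow_neg]
        exact inv_mul_le_one_of_le₀ hx (by positivity))
      refine ⟨a, by simpa using ha, ?_⟩
      rw [key]
      calc _ ≤ (p : ℝ) ^ (n + 1) * (p : ℝ) ^ (-((1 : ℕ) : ℤ)) := by gcongr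
        _ = _ := by rw [← zpow_add₀ hp0.ne']; simp
    · rintro ⟨a, -, ha⟩
      have h1 : ‖(p : ℚ_[p]) ^ (-(n + 1)) * (a : ℚ_[p])‖ ≤ (p : ℝ) ^ (n + 1) := by
        rw [norm_mul, hpp]
        exact mul_le_of_le_one_right (by positivity) (by
          simpa using Padic.norm_int_le_one (p := p) (a : ℤ))
      have h2 : (p : ℝ) ^ n ≤ (p : ℝ) ^ (n + 1) :=
        zpow_le_zpow_right₀ (one_lt_prime_real p).le (by lia)
      have := Padic.nonarchimedean (x - (p : ℚ_[p]) ^ (-(n + 1)) * (a : ℚ_[p]))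
        ((p : ℚ_[p]) ^ (-(n + 1)) * (a : ℚ_[p]))
      rw [sub_add_cancel] at this
      exact this.trans (max_le (ha.trans h2) h1)
  rw [h, measure_biUnion_finset]
  · simp [Measure.addHaar_closedBall_center]
  · intro a ha b hb hab
    refine Set.disjoint_left.2 fun x hxa hxb => hab ?_
    rw [Metric.mem_closedBall, dist_eq_norm] at hxa hxb
    refine eq_of_natCast_sub_norm_le (n := 1) (by simpa using ha) (by simpa using hb) ?_
    have h3 : ‖(p : ℚ_[p]) ^ (-(n + 1)) * ((a : ℚ_[p]) - b)‖ ≤ (p : ℝ) ^ n := by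
      have := padic_norm_sub_le_max (x - (p : ℚ_[p]) ^ (-(n + 1)) * (b : ℚ_[p]))
        (x - (p : ℚ_[p]) ^ (-(n + 1)) * (a : ℚ_[p]))
      rw [sub_sub_sub_cancel_left, ← mul_sub] at this
      exact this.trans (max_le hxb hxa)
    rw [norm_mul, hpp, ← le_div_iff₀' (by positivity), ← zpow_sub₀ hp0.ne'] at h3
    simpa using h3
  · exact fun _ _ => Metric.isClosed_closedBall.measurableSet

variable (p) in
/-- The ball of radius `pⁿ` has measure `pⁿ`. -/
lemma padicHaar_closedBall (n : ℤ) (x : ℚ_[p]) :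
    padicHaar p (Metric.closedBall x ((p : ℝ) ^ n)) = (p : ENNReal) ^ n := by
  have hp0 : (p : ENNReal) ≠ 0 := by simpa using hp.out.ne_zero
  have hpt : (p : ENNReal) ≠ ⊤ := ENNReal.natCast_ne_top p
  rw [Measure.addHaar_closedBall_center]
  induction n using Int.induction_on with
  | zero => simpa using padicHaar_closedBall_one p
  | succ n ih => rw [padicHaar_closedBall_succ, ih, ENNReal.zpow_add hp0 hpt, zpow_one, mul_comm]
  | pred n ih =>
    have := padicHaar_closedBall_succ p (-(n : ℤ) - 1)
    rw [sub_add_cancel, ih] at this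
    rw [ENNReal.zpow_sub hp0 hpt, this, zpow_one, mul_comm, ← mul_assoc, ENNReal.inv_mul_cancel hp0 hpt,
      one_mul]

/-- A subset of `M₂(ℚ_p)` in which one entry lies in a ball of radius `pʲ` whose center is a
function of the other three entries, these being in `p⁻ⁱℤ_p`. -/
lemma unipMeasure_le (i j : ℕ) (b : Fin 2 × Fin 2) (c : (Fin 2 × Fin 2 → ℚ_[p]) → ℚ_[p])
    (hc : Measurable c) (hcb : ∀ x t, c (Function.update x b t) = c x) :
    unipMeasure p {x | (∀ e ≠ b, ‖x e‖ ≤ (p : ℝ) ^ i) ∧ ‖x b - c x‖ ≤ (p : ℝ) ^ j} ≤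
      (p : ENNReal) ^ (3 * i + j) := by
  set S : Set (Fin 2 × Fin 2 → ℚ_[p]) :=
    {x | (∀ e ≠ b, ‖x e‖ ≤ (p : ℝ) ^ i) ∧ ‖x b - c x‖ ≤ (p : ℝ) ^ j}
  set T : Set (Fin 2 × Fin 2 → ℚ_[p]) :=
    Set.univ.pi fun e => Metric.closedBall 0 ((p : ℝ) ^ (if e = b then (j : ℤ) else i))
  have hS : MeasurableSet S := by
    have : S = (⋂ e, ⋂ (_ : e ≠ b), {x | ‖x e‖ ≤ (p : ℝ) ^ i}) ∩ {x | ‖x b - c x‖ ≤ (p : ℝ) ^ j} := by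
      ext x; simp [S]
    rw [this]
    refine MeasurableSet.inter (MeasurableSet.iInter fun e => MeasurableSet.iInter fun _ => ?_) ?_
    · exact measurableSet_le (measurable_pi_apply e).norm measurable_const
    · exact measurableSet_le ((measurable_pi_apply b).sub hc).norm measurable_const
  have hT : MeasurableSet T :=
    MeasurableSet.univ_pi fun _ => Metric.isClosed_closedBall.measurableSet
  have h1 : unipMeasure p S ≤ unipMeasure p T := by
    rw [← lintegral_indicator_fun_one hS, ← lintegral_indicator_fun_one hT]
    refine lintegral_le_of_lmarginal_le {b} (measurable_const.indicator hS)
      (measurable_const.indicator hT) fun x => ?_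
    rw [lmarginal_singleton, lmarginal_singleton]
    by_cases hx : ∀ e ≠ b, ‖x e‖ ≤ (p : ℝ) ^ i
    · have hS' : ∀ t, S.indicator (fun _ => (1 : ENNReal)) (Function.update x b t) =
          (Metric.closedBall (c x) ((p : ℝ) ^ (j : ℤ))).indicator (fun _ => 1) t := by
        intro t
        have : Function.update x b t ∈ S ↔ t ∈ Metric.closedBall (c x) ((p : ℝ) ^ (j : ℤ)) := by
          simp only [S, Set.mem_ofPred_eq, hcb, Function.update_self, Metric.mem_closedBall,
            dist_eq_norm, zpow_natCast, and_iff_right_iff_imp]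
          intro _ e he
          rw [Function.update_of_ne he]
          exact hx e he
        by_cases h : t ∈ Metric.closedBall (c x) ((p : ℝ) ^ (j : ℤ))
        · rw [Set.indicator_of_mem (this.2 h), Set.indicator_of_mem h]
        · rw [Set.indicator_of_notMem (mt this.1 h), Set.indicator_of_notMem h]
      have hT' : ∀ t, T.indicator (fun _ => (1 : ENNReal)) (Function.update x b t) =
          (Metric.closedBall 0 ((p : ℝ) ^ (j : ℤ))).indicator (fun _ => 1) t := by
        intro t
        have : Function.update x b t ∈ T ↔ t ∈ Metric.closedBall 0 ((p : ℝ) ^ (j : ℤ)) := by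
          simp only [T, Set.mem_univ_pi]
          constructor
          · intro h
            simpa using h b
          · intro h e
            rcases eq_or_ne e b with rfl | he
            · simpa using h
            · simpa [he] using hx e he
        by_cases h : t ∈ Metric.closedBall 0 ((p : ℝ) ^ (j : ℤ))
        · rw [Set.indicator_of_mem (this.2 h), Set.indicator_of_mem h]
        · rw [Set.indicator_of_notMem (mt this.1 h), Set.indicator_of_notMem h]
      simp only [hS', hT']
      rw [lintegral_indicator_fun_one Metric.isClosed_closedBall.measurableSet,
        lintegral_indicator_fun_one Metric.isClosed_closedBall.measurableSet,
        padicHaar_closedBall, padicHaar_closedBall]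
    · have hS' : ∀ t, S.indicator (fun _ => (1 : ENNReal)) (Function.update x b t) = 0 := by
        intro t
        refine Set.indicator_of_notMem (fun h => hx fun e he => ?_) _
        have := h.1 e he
        rwa [Function.update_of_ne he] at this
      simp [hS']
  refine h1.trans (le_of_eq ?_)
  rw [unipMeasure, Measure.pi_pi]
  simp only [padicHaar_closedBall]
  rw [← Finset.mul_prod_erase _ _ (Finset.mem_univ b), if_pos rfl,
    Finset.prod_congr rfl (g := fun _ => (p : ENNReal) ^ i)]
  · simp [pow_add, ← pow_mul, mul_comm]
  · intro e he
    rw [if_neg (Finset.ne_of_mem_erase he), zpow_natCast]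

variable (p) in
/-- A set containing all matrices in `GL₂(ℤ_p) diag(p⁻ⁱ, p⁻ʲ) GL₂(ℤ_p) + M₂(ℤ_p)`, `i ≥ j ≥ 0`. -/
def cartanCell (i j : ℕ) : Set (Fin 2 × Fin 2 → ℚ_[p]) :=
  {x | (∀ a, ‖x a‖ ≤ (p : ℝ) ^ i) ∧
    ‖x (0, 0) * x (1, 1) - x (0, 1) * x (1, 0)‖ ≤ (p : ℝ) ^ (i + j) ∧
      (i = 0 ∨ ∃ a, ‖x a‖ = (p : ℝ) ^ i)}

lemma measurableSet_cartanCell (i j : ℕ) : MeasurableSet (cartanCell p i j) := by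
  have : cartanCell p i j = (⋂ a, {x | ‖x a‖ ≤ (p : ℝ) ^ i}) ∩
      ({x | ‖x (0, 0) * x (1, 1) - x (0, 1) * x (1, 0)‖ ≤ (p : ℝ) ^ (i + j)} ∩
        ({_x | i = 0} ∪ ⋃ a, {x | ‖x a‖ = (p : ℝ) ^ i})) := by
    ext x; simp [cartanCell]
  rw [this]
  refine MeasurableSet.inter (MeasurableSet.iInter fun a => ?_) (MeasurableSet.inter ?_
    (MeasurableSet.union (MeasurableSet.const _) (MeasurableSet.iUnion fun a => ?_)))
  · exact measurableSet_le (measurable_pi_apply a).norm measurable_const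
  · exact measurableSet_le (by fun_prop) measurable_const
  · exact measurableSet_eq_fun (measurable_pi_apply a).norm measurable_const

lemma unipMeasure_cartanCell_le (i j : ℕ) :
    unipMeasure p (cartanCell p i j) ≤ 4 * (p : ENNReal) ^ (3 * i + j) := by
  have hp1 := one_lt_prime_real p
  have hp0 := prime_pos_real p
  have key : ∀ (a b c d : ℚ_[p]), ‖a‖ = (p : ℝ) ^ i → ‖a * d - b * c‖ ≤ (p : ℝ) ^ (i + j) →
      ‖d - b * c / a‖ ≤ (p : ℝ) ^ j := by
    intro a b c d ha h
    have ha0 : a ≠ 0 := by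
      rintro rfl
      rw [norm_zero] at ha
      exact (pow_pos hp0 i).ne ha
    have : a * d - b * c = a * (d - b * c / a) := by field_simp
    rw [this, norm_mul, ha, pow_add] at h
    exact le_of_mul_le_mul_left h (by positivity)
  have hfour : (4 : ENNReal) * (p : ENNReal) ^ (3 * i + j) =
      ∑ _a : Fin 2 × Fin 2, (p : ENNReal) ^ (3 * i + j) := by
    simp
  have hdisj : ∀ x ∈ cartanCell p i j, i = 0 ∨ ∃ a, ‖x a‖ = (p : ℝ) ^ i := fun x hx => hx.2.2
  rcases Nat.eq_zero_or_pos i with rfl | hi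
  · calc unipMeasure p (cartanCell p 0 j) ≤ (p : ENNReal) ^ (3 * 0 + j) := by
          refine (measure_mono ?_).trans (unipMeasure_le 0 j (0, 0) (fun _ => 0) measurable_const
            fun _ _ => rfl)
          intro x hx
          refine ⟨fun e _ => hx.1 e, ?_⟩
          rw [sub_zero]
          exact (hx.1 _).trans (by simpa using one_le_pow₀ hp1.le)
      _ ≤ 4 * (p : ENNReal) ^ (3 * 0 + j) := le_mul_of_one_le_left (by positivity) (by norm_num)
  · set c : Fin 2 × Fin 2 → (Fin 2 × Fin 2 → ℚ_[p]) → ℚ_[p] := fun a x =>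
      x (a.1, a.2 + 1) * x (a.1 + 1, a.2) / x a with hcdef
    have hsub : cartanCell p i j ⊆ ⋃ a : Fin 2 × Fin 2,
        {x | (∀ e ≠ (a.1 + 1, a.2 + 1), ‖x e‖ ≤ (p : ℝ) ^ i) ∧
          ‖x (a.1 + 1, a.2 + 1) - c a x‖ ≤ (p : ℝ) ^ j} := by
      rintro x ⟨h1, h2, h3⟩
      obtain ⟨a, ha⟩ := h3.resolve_left hi.ne'
      refine Set.mem_iUnion.2 ⟨a, fun e _ => h1 e, key _ _ _ _ ha ?_⟩
      have e1 : (1 : Fin 2) + 1 = 0 := rfl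
      obtain ⟨a1, a2⟩ := a
      fin_cases a1 <;> fin_cases a2 <;> simp only [Fin.zero_eta, Fin.mk_one, zero_add, e1]
      · exact h2
      · rw [← norm_neg, neg_sub]; exact h2
      · rw [← norm_neg, neg_sub, mul_comm (x (1, 1)), mul_comm (x (1, 0))]; exact h2
      · rw [mul_comm (x (1, 1)), mul_comm (x (1, 0))]; exact h2
    refine (measure_mono hsub).trans ((measure_iUnion_fintype_le _ _).trans ?_)
    rw [hfour]
    refine Finset.sum_le_sum fun a _ => unipMeasure_le i j _ _ (by fun_prop) fun x t => ?_
    have h1 : ∀ u : Fin 2, u ≠ u + 1 := by decide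
    have h2 : (a.1, a.2 + 1) ≠ (a.1 + 1, a.2 + 1) := fun h => h1 _ (congrArg Prod.fst h)
    have h3 : (a.1 + 1, a.2) ≠ (a.1 + 1, a.2 + 1) := fun h => h1 _ (congrArg Prod.snd h)
    have h4 : a ≠ (a.1 + 1, a.2 + 1) := fun h => h1 _ (congrArg Prod.fst h)
    simp only [hcdef, Function.update_of_ne h2, Function.update_of_ne h3, Function.update_of_ne h4]

end Haar

/-! ### Integral matrices and congruence subgroups -/

section IntegralMatrices

variable {p : ℕ} [hp : Fact p.Prime] {ι κ μ : Type}

/-- The entries of `A` have norm at most `r`. -/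
def EntryLE (r : ℝ) (A : Matrix ι κ ℚ_[p]) : Prop := ∀ i j, ‖A i j‖ ≤ r

lemma EntryLE.add {r : ℝ} {A B : Matrix ι κ ℚ_[p]} (hA : EntryLE r A) (hB : EntryLE r B) :
    EntryLE r (A + B) := fun i j =>
  (Padic.nonarchimedean _ _).trans (max_le (hA i j) (hB i j))

lemma EntryLE.sub {r : ℝ} {A B : Matrix ι κ ℚ_[p]} (hA : EntryLE r A) (hB : EntryLE r B) :
    EntryLE r (A - B) := fun i j =>
  (padic_norm_sub_le_max _ _).trans (max_le (hA i j) (hB i j))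

lemma EntryLE.mul [Fintype ι] {r s : ℝ} (hr : 0 ≤ r) (hs : 0 ≤ s) {A : Matrix κ ι ℚ_[p]}
    {B : Matrix ι μ ℚ_[p]} (hA : EntryLE r A) (hB : EntryLE s B) : EntryLE (r * s) (A * B) := by
  intro i j
  rw [Matrix.mul_apply]
  refine IsUltrametricDist.norm_sum_le_of_forall_le_of_nonneg (by positivity) fun k _ => ?_
  rw [norm_mul]
  exact mul_le_mul (hA i k) (hB k j) (norm_nonneg _) hr

lemma EntryLE.mul_one [Fintype ι] {A : Matrix κ ι ℚ_[p]} {B : Matrix ι μ ℚ_[p]} (hA : EntryLE 1 A)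
    (hB : EntryLE 1 B) : EntryLE 1 (A * B) := by
  simpa using hA.mul zero_le_one zero_le_one hB

lemma norm_vecMul_lt [Fintype ι] {x : ι → ℚ_[p]} {A : Matrix ι ι ℚ_[p]} (hx : ∀ i, ‖x i‖ < 1)
    (hA : EntryLE 1 A) (j : ι) : ‖(x ᵥ* A) j‖ < 1 := by
  have : Nonempty ι := ⟨j⟩
  obtain ⟨i, -, hi⟩ := IsUltrametricDist.exists_norm_finsetSum_le_of_nonempty
    (t := Finset.univ) Finset.univ_nonempty (fun i => x i * A i j)
  refine hi.trans_lt ?_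
  rw [norm_mul]
  exact (mul_le_of_le_one_right (norm_nonneg _) (hA i j)).trans_lt (hx i)

variable [Fintype ι] [DecidableEq ι]

/-- The inclusion of `GL_ι(ℤ_p)` in `GL_ι(ℚ_p)`. -/
def intGL (p : ℕ) [Fact p.Prime] (ι : Type) [Fintype ι] [DecidableEq ι] :
    GL ι ℤ_[p] →* GL ι ℚ_[p] :=
  GeneralLinearGroup.map (PadicInt.Coe.ringHom (p := p))

/-- The maximal compact subgroup `GL_ι(ℤ_p)` of `GL_ι(ℚ_p)`. -/
def maxCompact (p : ℕ) [Fact p.Prime] (ι : Type) [Fintype ι] [DecidableEq ι] :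
    Subgroup (GL ι ℚ_[p]) := (intGL p ι).range

lemma mem_maxCompact_iff {g : GL ι ℚ_[p]} :
    g ∈ maxCompact p ι ↔ EntryLE 1 g.val ∧ EntryLE 1 g⁻¹.val := by
  constructor
  · rintro ⟨k, rfl⟩
    rw [← map_inv]
    exact ⟨fun i j => (k i j).2, fun i j => (k⁻¹ i j).2⟩
  · rintro ⟨h1, h2⟩
    have hinj : Function.Injective ((PadicInt.Coe.ringHom (p := p)).mapMatrix (m := ι)) :=
      Matrix.map_injective Subtype.coe_injective
    let A : Matrix ι ι ℤ_[p] := Matrix.of fun i j => ⟨g.val i j, h1 i j⟩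
    let B : Matrix ι ι ℤ_[p] := Matrix.of fun i j => ⟨g⁻¹.val i j, h2 i j⟩
    have hA : (PadicInt.Coe.ringHom (p := p)).mapMatrix A = g.val := rfl
    have hB : (PadicInt.Coe.ringHom (p := p)).mapMatrix B = g⁻¹.val := rfl
    refine ⟨⟨A, B, hinj ?_, hinj ?_⟩, Units.ext hA⟩
    · rw [map_mul, hA, hB, map_one, g.mul_inv]
    · rw [map_mul, hA, hB, map_one, g.inv_mul]

lemma entryLE_of_mem {g : GL ι ℚ_[p]} (h : g ∈ maxCompact p ι) : EntryLE 1 g.val :=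
  (mem_maxCompact_iff.1 h).1

lemma norm_det_le_one {A : Matrix ι ι ℚ_[p]} (hA : EntryLE 1 A) : ‖A.det‖ ≤ 1 := by
  rw [Matrix.det_apply]
  refine IsUltrametricDist.norm_sum_le_of_forall_le_of_nonneg zero_le_one fun s _ => ?_
  have : ‖∏ i, A (s i) i‖ ≤ 1 := by
    rw [norm_prod]
    exact Finset.prod_le_one (fun _ _ => norm_nonneg _) fun _ _ => hA _ _
  rcases Int.units_eq_one_or (Equiv.Perm.sign s) with h | h <;> simpa [h] using this

lemma norm_det_of_mem {g : GL ι ℚ_[p]} (h : g ∈ maxCompact p ι) : ‖g.val.det‖ = 1 := by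
  refine le_antisymm (norm_det_le_one (entryLE_of_mem h)) ?_
  have h2 := norm_det_le_one (entryLE_of_mem (inv_mem h))
  have h3 : g.val.det * g⁻¹.val.det = 1 := by
    rw [← Matrix.det_mul, g.mul_inv, Matrix.det_one]
  have h4 : ‖g.val.det‖ * ‖g⁻¹.val.det‖ = 1 := by rw [← norm_mul, h3, norm_one]
  nlinarith [norm_nonneg g.val.det]

lemma mem_maxCompact_fin_two {g : GL (Fin 2) ℚ_[p]} (h : EntryLE 1 g.val)
    (hd : ‖g.val.det‖ = 1) : g ∈ maxCompact p (Fin 2) := by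
  refine mem_maxCompact_iff.2 ⟨h, fun i j => ?_⟩
  have : g⁻¹.val = (g.val.det)⁻¹ • g.val.adjugate := by
    rw [Matrix.coe_units_inv, Matrix.inv_def, Ring.inverse_eq_inv']
  rw [this, Matrix.smul_apply, smul_eq_mul, norm_mul, norm_inv, hd, inv_one, one_mul,
    Matrix.adjugate_fin_two]
  fin_cases i <;> fin_cases j <;> simp [h _ _]

lemma mem_mirahoric_zero {last : ι} {g : GL ι ℚ_[p]} :
    g ∈ mirahoric p last 0 ↔ g ∈ maxCompact p ι := by
  simp only [mirahoric, pow_zero, isUnit_one, IsUnit.dvd, implies_true, and_true]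
  rfl

lemma mem_mirahoric_one {last : ι} {g : GL ι ℚ_[p]} :
    g ∈ mirahoric p last 1 ↔ g ∈ maxCompact p ι ∧
      ∀ j, ‖g.val last j - (1 : Matrix ι ι ℚ_[p]) last j‖ < 1 := by
  have key : ∀ (k : GL ι ℤ_[p]) j,
      ((p : ℤ_[p]) ^ 1 ∣ k.val last j - (1 : Matrix ι ι ℤ_[p]) last j) ↔
      ‖(intGL p ι k).val last j - (1 : Matrix ι ι ℚ_[p]) last j‖ < 1 := by
    intro k j
    rw [pow_one, ← PadicInt.norm_lt_one_iff_dvd, PadicInt.norm_def, PadicInt.coe_sub]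
    rw [Matrix.one_apply, Matrix.one_apply]
    split_ifs <;> rfl
  constructor
  · rintro ⟨k, rfl, h⟩
    exact ⟨⟨k, rfl⟩, fun j => (key k j).1 (h j)⟩
  · rintro ⟨⟨k, rfl⟩, h⟩
    exact ⟨k, rfl, fun j => (key k j).2 (h j)⟩

lemma maxCompact_of_mem_mirahoric {last : ι} {g : GL ι ℚ_[p]} (h : g ∈ mirahoric p last 1) :
    g ∈ maxCompact p ι := (mem_mirahoric_one.1 h).1

lemma inv_mem_mirahoric {last : ι} {g : GL ι ℚ_[p]} (h : g ∈ mirahoric p last 1) :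
    g⁻¹ ∈ mirahoric p last 1 := by
  rw [mem_mirahoric_one] at h ⊢
  refine ⟨inv_mem h.1, fun j => ?_⟩
  have h1 := norm_vecMul_lt (x := fun j => g.val last j - (1 : Matrix ι ι ℚ_[p]) last j) h.2
    (entryLE_of_mem (inv_mem h.1)) j
  have h2 : (fun j => g.val last j - (1 : Matrix ι ι ℚ_[p]) last j) ᵥ* g⁻¹.val =
      fun j => (1 : Matrix ι ι ℚ_[p]) last j - g⁻¹.val last j := by
    ext j
    have : ((g.val - 1) * g⁻¹.val) last j = (1 : Matrix ι ι ℚ_[p]) last j - g⁻¹.val last j := by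
      rw [Matrix.sub_mul, g.mul_inv, one_mul, Matrix.sub_apply]
    rw [← this]; rfl
  rw [h2] at h1
  rwa [← norm_neg, neg_sub]

/-- Reduction modulo `pⁿ`. -/
def redGL (p : ℕ) [Fact p.Prime] (n : ℕ) : GL (Fin 2) ℤ_[p] →* GL (Fin 2) (ZMod (p ^ n)) :=
  GeneralLinearGroup.map (PadicInt.toZModPow n)

lemma redGL_eq_one_iff {n : ℕ} {k : GL (Fin 2) ℤ_[p]} :
    redGL p n k = 1 ↔ ∀ i j, ‖k.val i j - (1 : Matrix (Fin 2) (Fin 2) ℤ_[p]) i j‖ ≤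
      (p : ℝ) ^ (-(n : ℤ)) := by
  have key : ∀ i j, ‖k.val i j - (1 : Matrix (Fin 2) (Fin 2) ℤ_[p]) i j‖ ≤ (p : ℝ) ^ (-(n : ℤ)) ↔
      (redGL p n k).val i j = (1 : Matrix (Fin 2) (Fin 2) (ZMod (p ^ n))) i j := by
    intro i j
    rw [PadicInt.norm_le_pow_iff_mem_span_pow, ← PadicInt.ker_toZModPow, RingHom.mem_ker, map_sub,
      sub_eq_zero]
    have h1 : PadicInt.toZModPow n ((1 : Matrix (Fin 2) (Fin 2) ℤ_[p]) i j) =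
        (1 : Matrix (Fin 2) (Fin 2) (ZMod (p ^ n))) i j := by
      rw [Matrix.one_apply, Matrix.one_apply]
      split_ifs <;> simp
    rw [h1]
    rfl
  constructor
  · intro h i j
    rw [key, h]
    rfl
  · intro h
    ext i j
    exact (key i j).1 (h i j)

/-- The principal congruence subgroups form a basis of neighbourhoods of the identity. -/
lemma exists_redGL_ker_le {U : Subgroup (GL (Fin 2) ℚ_[p])}
    (hU : IsOpen (U : Set (GL (Fin 2) ℚ_[p]))) :
    ∃ n, ∀ k : GL (Fin 2) ℤ_[p], redGL p n k = 1 → intGL p (Fin 2) k ∈ U := by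
  have h1 : (U : Set (GL (Fin 2) ℚ_[p])) ∈ nhds 1 := hU.mem_nhds (one_mem U)
  rw [Units.isEmbedding_embedProduct.isInducing.nhds_eq_comap, Filter.mem_comap] at h1
  obtain ⟨T, hT, hTU⟩ := h1
  rw [map_one, Prod.one_eq_mk, mem_nhds_prod_iff] at hT
  obtain ⟨T1, hT1, T2, hT2, hT12⟩ := hT
  have hT2' : MulOpposite.op ⁻¹' T2 ∈ nhds (1 : Matrix (Fin 2) (Fin 2) ℚ_[p]) :=
    MulOpposite.continuous_op.continuousAt.preimage_mem_nhds (by simpa using hT2)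
  have hball : ∀ T : Set (Matrix (Fin 2) (Fin 2) ℚ_[p]), T ∈ nhds 1 → ∃ ε > (0 : ℝ),
      ∀ A : Matrix (Fin 2) (Fin 2) ℚ_[p],
        (∀ i j, ‖A i j - (1 : Matrix (Fin 2) (Fin 2) ℚ_[p]) i j‖ < ε) → A ∈ T := by
    intro T hT
    have hT' : (Matrix.of ⁻¹' T : Set (Fin 2 → Fin 2 → ℚ_[p])) ∈ nhds fun i j =>
        (1 : Matrix (Fin 2) (Fin 2) ℚ_[p]) i j :=
      (show Continuous (Matrix.of : (Fin 2 → Fin 2 → ℚ_[p]) → Matrix (Fin 2) (Fin 2) ℚ_[p]) from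
        continuous_id).continuousAt.preimage_mem_nhds hT
    obtain ⟨ε, hε, h⟩ := Metric.mem_nhds_iff.1 hT'
    refine ⟨ε, hε, fun A hA => ?_⟩
    have : (fun i j => A i j) ∈ (Matrix.of ⁻¹' T : Set (Fin 2 → Fin 2 → ℚ_[p])) := by
      refine h ?_
      rw [Metric.mem_ball, dist_pi_lt_iff hε]
      intro i
      rw [dist_pi_lt_iff hε]
      intro j
      rw [dist_eq_norm]
      exact hA i j
    exact this
  obtain ⟨ε1, hε1, h1⟩ := hball T1 hT1
  obtain ⟨ε2, hε2, h2⟩ := hball _ hT2'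
  obtain ⟨n, hn⟩ := exists_pow_lt_of_lt_one (lt_min hε1 hε2)
    (inv_lt_one_of_one_lt₀ (one_lt_prime_real p))
  have key : ∀ k : GL (Fin 2) ℤ_[p], redGL p n k = 1 → ∀ i j,
      ‖(intGL p (Fin 2) k).val i j - (1 : Matrix (Fin 2) (Fin 2) ℚ_[p]) i j‖ < min ε1 ε2 := by
    intro k hk i j
    refine lt_of_le_of_lt ?_ hn
    have h3 := redGL_eq_one_iff.1 hk i j
    have h4 : ((1 : Matrix (Fin 2) (Fin 2) ℤ_[p]) i j : ℚ_[p]) =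
        (1 : Matrix (Fin 2) (Fin 2) ℚ_[p]) i j := by
      rw [Matrix.one_apply, Matrix.one_apply]
      split_ifs <;> rfl
    rw [PadicInt.norm_def, PadicInt.coe_sub, _root_.zpow_neg, zpow_natCast, h4] at h3
    rwa [inv_pow]
  refine ⟨n, fun k hk => hTU ?_⟩
  refine hT12 ⟨h1 _ fun i j => (key k hk i j).trans_le (min_le_left _ _), ?_⟩
  refine h2 _ fun i j => ?_
  rw [← map_inv]
  exact (key k⁻¹ (by rw [map_inv, hk, inv_one]) i j).trans_le (min_le_right _ _)

end IntegralMatrices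

/-! ### The Cartan decomposition of `M₂(ℚ_p)` -/

section Cartan

variable {p : ℕ} [hp : Fact p.Prime]

lemma exists_mem_maxCompact {A : Matrix (Fin 2) (Fin 2) ℚ_[p]} (h : EntryLE 1 A)
    (hd : ‖A.det‖ = 1) : ∃ g ∈ maxCompact p (Fin 2), g.val = A := by
  have h0 : A.det ≠ 0 := fun h => by simp [h] at hd
  exact ⟨GeneralLinearGroup.mkOfDetNeZero A h0, mem_maxCompact_fin_two h hd, rfl⟩

lemma entryLE_fin_two {r : ℝ} {a b c d : ℚ_[p]} (ha : ‖a‖ ≤ r) (hb : ‖b‖ ≤ r) (hc : ‖c‖ ≤ r)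
    (hd : ‖d‖ ≤ r) : EntryLE r !![a, b; c, d] := by
  intro i j
  fin_cases i <;> fin_cases j <;> simpa

/-- Cartan decomposition in `M₂(ℚ_p)`. -/
lemma exists_cartan (Y : Matrix (Fin 2) (Fin 2) ℚ_[p]) :
    ∃ k₁ ∈ maxCompact p (Fin 2), ∃ k₂ ∈ maxCompact p (Fin 2), ∃ a d : ℚ_[p], ‖d‖ ≤ ‖a‖ ∧
      Y = k₁.val * !![a, 0; 0, d] * k₂.val := by
  have step : ∀ Y : Matrix (Fin 2) (Fin 2) ℚ_[p], (∀ i j, ‖Y i j‖ ≤ ‖Y 0 0‖) →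
      ∃ k₁ ∈ maxCompact p (Fin 2), ∃ k₂ ∈ maxCompact p (Fin 2), ∃ a d : ℚ_[p], ‖d‖ ≤ ‖a‖ ∧
      Y = k₁.val * !![a, 0; 0, d] * k₂.val := by
    intro Y hY
    by_cases h0 : Y 0 0 = 0
    · refine ⟨1, one_mem _, 1, one_mem _, 0, 0, le_rfl, ?_⟩
      ext i j
      have := hY i j
      rw [h0, norm_zero] at this
      rw [norm_le_zero_iff.1 this]
      fin_cases i <;> fin_cases j <;> simp
    · have hn : 0 < ‖Y 0 0‖ := norm_pos_iff.2 h0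
      obtain ⟨k₁, hk₁, h₁⟩ := exists_mem_maxCompact
        (A := !![(1 : ℚ_[p]), 0; Y 1 0 / Y 0 0, 1])
        (entryLE_fin_two (by simp) (by simp) (by rw [norm_div]; exact div_le_one_of_le₀ (hY _ _) hn.le)
          (by simp)) (by simp [det_fin_two])
      obtain ⟨k₂, hk₂, h₂⟩ := exists_mem_maxCompact
        (A := !![(1 : ℚ_[p]), Y 0 1 / Y 0 0; 0, 1])
        (entryLE_fin_two (by simp) (by rw [norm_div]; exact div_le_one_of_le₀ (hY _ _) hn.le)
          (by simp) (by simp)) (by simp [det_fin_two])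
      refine ⟨k₁, hk₁, k₂, hk₂, Y 0 0, Y 1 1 - Y 1 0 * Y 0 1 / Y 0 0, ?_, ?_⟩
      · refine (padic_norm_sub_le_max _ _).trans (max_le (hY _ _) ?_)
        rw [norm_div, norm_mul, div_le_iff₀ hn]
        exact mul_le_mul (hY _ _) (hY _ _) (norm_nonneg _) (norm_nonneg _)
      · rw [h₁, h₂]
        ext i j
        fin_cases i <;> fin_cases j <;> simp [Matrix.mul_apply, Fin.sum_univ_two] <;> field_simp
        ring
  obtain ⟨⟨i, j⟩, hij⟩ := Finite.exists_max fun a : Fin 2 × Fin 2 => ‖Y a.1 a.2‖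
  obtain ⟨s, hs, hs'⟩ := exists_mem_maxCompact (A := !![(0 : ℚ_[p]), 1; 1, 0])
    (entryLE_fin_two (by simp) (by simp) (by simp) (by simp)) (by simp [det_fin_two])
  have hss : s * s = 1 := by
    ext a b
    rw [GeneralLinearGroup.coe_mul, hs']
    fin_cases a <;> fin_cases b <;> simp
  have hssv : s.val * s.val = 1 := by
    have := congrArg Units.val hss
    simpa using this
  -- the largest entry is moved to the upper left corner by the permutation matrix `s`
  have hl : ∀ A : Matrix (Fin 2) (Fin 2) ℚ_[p], ∀ a b, (s.val * A) a b = A (a + 1) b := by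
    intro A a b
    rw [hs']
    fin_cases a <;> simp [Matrix.mul_apply, Fin.sum_univ_two]
  have hr : ∀ A : Matrix (Fin 2) (Fin 2) ℚ_[p], ∀ a b, (A * s.val) a b = A a (b + 1) := by
    intro A a b
    rw [hs']
    fin_cases b <;> simp [Matrix.mul_apply, Fin.sum_univ_two]
  obtain ⟨t, ht, htt, hti⟩ : ∃ t ∈ maxCompact p (Fin 2), t.val * t.val = 1 ∧
      ∃ u : Fin 2, (∀ (A : Matrix (Fin 2) (Fin 2) ℚ_[p]) a b, (t.val * A) a b = A (a + u) b) ∧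
        u = i := by
    fin_cases i
    · exact ⟨1, one_mem _, by simp, 0, by simp, rfl⟩
    · exact ⟨s, hs, hssv, 1, hl, rfl⟩
  obtain ⟨t', ht', htt', htj⟩ : ∃ t ∈ maxCompact p (Fin 2), t.val * t.val = 1 ∧
      ∃ u : Fin 2, (∀ (A : Matrix (Fin 2) (Fin 2) ℚ_[p]) a b, (A * t.val) a b = A a (b + u)) ∧
        u = j := by
    fin_cases j
    · exact ⟨1, one_mem _, by simp, 0, by simp, rfl⟩
    · exact ⟨s, hs, hssv, 1, hr, rfl⟩
  obtain ⟨u, hu, rfl⟩ := hti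
  obtain ⟨u', hu', rfl⟩ := htj
  obtain ⟨k₁, hk₁, k₂, hk₂, a, d, had, h⟩ := step (t.val * Y * t'.val) fun a b => by
    rw [hu', hu, hu', hu, zero_add, zero_add]
    exact hij (_, _)
  refine ⟨t * k₁, mul_mem ht hk₁, k₂ * t', mul_mem hk₂ ht', a, d, had, ?_⟩
  calc Y = (t.val * t.val) * Y * (t'.val * t'.val) := by rw [htt, htt']; simp
    _ = t.val * (t.val * Y * t'.val) * t'.val := by simp only [mul_assoc]
    _ = _ := by rw [h]; simp only [Units.val_mul, mul_assoc]

/-- `y ∈ p⁻ⁱ ℤ_pˣ + ℤ_p`, where `pⁱ = max(1, |y|)`. -/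
lemma exists_eq_zpow_mul_add (y : ℚ_[p]) : ∃ (i : ℕ) (u r : ℚ_[p]), ‖u‖ = 1 ∧ ‖r‖ ≤ 1 ∧
    y = (p : ℚ_[p]) ^ (-(i : ℤ)) * u + r ∧ (p : ℝ) ^ i = max 1 ‖y‖ := by
  rcases le_or_gt ‖y‖ 1 with h | h
  · refine ⟨0, 1, y - 1, by simp, ?_, by simp, by simp [h]⟩
    exact (padic_norm_sub_le_max _ _).trans (by simpa using h)
  · have hy : y ≠ 0 := fun h0 => by rw [h0, norm_zero] at h; linarith
    have hv := Padic.norm_eq_zpow_neg_valuation hy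
    have hpos : 0 < -y.valuation := by
      rw [hv] at h
      exact (one_lt_zpow_iff_right₀ (one_lt_prime_real p)).1 h
    obtain ⟨i, hi⟩ := Int.eq_ofNat_of_zero_le hpos.le
    have hi' : y.valuation = -(i : ℤ) := by lia
    have hne := zpow_ne_zero (-(i : ℤ)) (prime_ne_zero_padic p)
    refine ⟨i, y / (p : ℚ_[p]) ^ (-(i : ℤ)), 0, ?_, by simp, ?_, ?_⟩
    · rw [norm_div, hv, hi', Padic.norm_p_zpow, div_self]
      exact zpow_ne_zero _ (prime_pos_real p).ne'
    · rw [add_zero, mul_div_cancel₀ _ hne]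
    · rw [max_eq_right h.le, hv, hi', neg_neg, zpow_natCast]

variable (p) in
/-- The matrix `diag(p⁻ⁱ, p⁻ʲ)`. -/
def invDiag (i j : ℕ) : Matrix (Fin 2) (Fin 2) ℚ_[p] :=
  !![(p : ℚ_[p]) ^ (-(i : ℤ)), 0; 0, (p : ℚ_[p]) ^ (-(j : ℤ))]

/-- Cartan decomposition in `M₂(ℚ_p)` modulo `M₂(ℤ_p)`. -/
lemma exists_cartan_add (Y : Matrix (Fin 2) (Fin 2) ℚ_[p]) :
    ∃ k₁ ∈ maxCompact p (Fin 2), ∃ k₂ ∈ maxCompact p (Fin 2), ∃ i j : ℕ, j ≤ i ∧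
      ∃ X : Matrix (Fin 2) (Fin 2) ℚ_[p], EntryLE 1 X ∧ Y = k₁.val * invDiag p i j * k₂.val + X := by
  obtain ⟨k₁, hk₁, k₂, hk₂, a, d, had, rfl⟩ := exists_cartan Y
  obtain ⟨i, u, r, hu, hr, rfl, hi⟩ := exists_eq_zpow_mul_add a
  obtain ⟨j, u', r', hu', hr', rfl, hj⟩ := exists_eq_zpow_mul_add d
  obtain ⟨t, ht, ht'⟩ := exists_mem_maxCompact (A := !![u, 0; 0, u'])
    (entryLE_fin_two hu.le (by simp) (by simp) hu'.le) (by simp [det_fin_two, hu, hu'])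
  refine ⟨k₁, hk₁, t * k₂, mul_mem ht hk₂, i, j, ?_, k₁.val * !![r, 0; 0, r'] * k₂.val, ?_, ?_⟩
  · have : (p : ℝ) ^ j ≤ (p : ℝ) ^ i := by
      rw [hi, hj]
      exact max_le_max le_rfl had
    exact (pow_le_pow_iff_right₀ (one_lt_prime_real p)).1 this
  · exact ((entryLE_of_mem hk₁).mul_one (entryLE_fin_two hr (by simp) (by simp) hr')).mul_one
      (entryLE_of_mem hk₂)
  · rw [Units.val_mul, ht', ← mul_assoc, mul_assoc k₁.val (invDiag p i j), ← add_mul, ← mul_add]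
    congr 2
    ext a b
    fin_cases a <;> fin_cases b <;> simp [invDiag]

lemma norm_prime_zpow_neg (i : ℕ) : ‖(p : ℚ_[p]) ^ (-(i : ℤ))‖ = (p : ℝ) ^ i := by
  rw [Padic.norm_p_zpow, neg_neg, zpow_natCast]

lemma norm_prime_pow (i : ℕ) : ‖(p : ℚ_[p]) ^ i‖ = ((p : ℝ) ^ i)⁻¹ := by
  rw [norm_pow, Padic.norm_p, inv_pow]

lemma entryLE_mono {ι κ : Type} {r s : ℝ} (h : r ≤ s) {A : Matrix ι κ ℚ_[p]} (hA : EntryLE r A) :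
    EntryLE s A := fun i j => (hA i j).trans h

lemma one_le_prime_pow (i : ℕ) : (1 : ℝ) ≤ (p : ℝ) ^ i := one_le_pow₀ (one_lt_prime_real p).le

lemma entryLE_invDiag {i j : ℕ} (hij : j ≤ i) : EntryLE ((p : ℝ) ^ i) (invDiag p i j) :=
  entryLE_fin_two (norm_prime_zpow_neg i).le (by simp) (by simp)
    ((norm_prime_zpow_neg j).le.trans (pow_le_pow_right₀ (one_lt_prime_real p).le hij))

lemma mem_cartanCell {k₁ k₂ : GL (Fin 2) ℚ_[p]} (hk₁ : k₁ ∈ maxCompact p (Fin 2))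
    (hk₂ : k₂ ∈ maxCompact p (Fin 2)) {i j : ℕ} (hij : j ≤ i) {X : Matrix (Fin 2) (Fin 2) ℚ_[p]}
    (hX : EntryLE 1 X) {x : Fin 2 × Fin 2 → ℚ_[p]}
    (hx : (Matrix.of fun a b => x (a, b)) = k₁.val * invDiag p i j * k₂.val + X) :
    x ∈ cartanCell p i j := by
  set Y : Matrix (Fin 2) (Fin 2) ℚ_[p] := Matrix.of fun a b => x (a, b) with hY
  have hp0 := prime_pos_real p
  set X' := k₁⁻¹.val * X * k₂⁻¹.val with hX'
  have hX'1 : EntryLE 1 X' :=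
    ((entryLE_of_mem (inv_mem hk₁)).mul_one hX).mul_one (entryLE_of_mem (inv_mem hk₂))
  have hYX : Y = k₁.val * (invDiag p i j + X') * k₂.val := by
    rw [hx, hX', mul_add, add_mul]
    congr 1
    simp only [← mul_assoc, Units.mul_inv, one_mul]
    simp only [mul_assoc, Units.inv_mul, mul_one]
  have hDX : invDiag p i j + X' = k₁⁻¹.val * Y * k₂⁻¹.val := by
    rw [hYX]
    simp only [← mul_assoc, Units.inv_mul, one_mul]
    simp only [mul_assoc, Units.mul_inv, mul_one]
  have h1 : EntryLE ((p : ℝ) ^ i) (invDiag p i j + X') :=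
    (entryLE_invDiag hij).add (entryLE_mono (one_le_prime_pow i) hX'1)
  have hmul : ∀ (r : ℝ) (_ : 0 ≤ r) (A : Matrix (Fin 2) (Fin 2) ℚ_[p])
      (k k' : GL (Fin 2) ℚ_[p]) (_ : k ∈ maxCompact p (Fin 2)) (_ : k' ∈ maxCompact p (Fin 2)),
      EntryLE r A → EntryLE r (k.val * A * k'.val) := by
    intro r hr A k k' hk hk' hA
    simpa using ((entryLE_of_mem hk).mul zero_le_one hr hA).mul (by simpa using hr) zero_le_one
      (entryLE_of_mem hk')
  refine ⟨fun a => ?_, ?_, ?_⟩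
  · have := hmul _ (by positivity) _ _ _ hk₁ hk₂ h1 a.1 a.2
    rwa [← hYX] at this
  · have hdet : x (0, 0) * x (1, 1) - x (0, 1) * x (1, 0) = Y.det := by rw [det_fin_two]; rfl
    rw [hdet, hYX, det_mul, det_mul, norm_mul, norm_mul, norm_det_of_mem hk₁, norm_det_of_mem hk₂,
      one_mul, mul_one, det_fin_two]
    have hpj : (p : ℝ) ^ i ≤ (p : ℝ) ^ (i + j) :=
      pow_le_pow_right₀ (one_lt_prime_real p).le (by lia)
    refine (padic_norm_sub_le_max _ _).trans (max_le ?_ ?_)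
    · rw [norm_mul, pow_add]
      refine mul_le_mul (h1 0 0) ?_ (norm_nonneg _) (by positivity)
      refine (Padic.nonarchimedean _ _).trans (max_le ?_ ((hX'1 1 1).trans (one_le_prime_pow j)))
      simp [invDiag]
    · have e1 : (invDiag p i j + X') 0 1 = X' 0 1 := by simp [invDiag]
      have e2 : (invDiag p i j + X') 1 0 = X' 1 0 := by simp [invDiag]
      rw [e1, e2, norm_mul]
      exact (mul_le_one₀ (hX'1 _ _) (norm_nonneg _) (hX'1 _ _)).trans
        (one_le_prime_pow _)
  · rcases Nat.eq_zero_or_pos i with h0 | hi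
    · exact Or.inl h0
    refine Or.inr ?_
    by_contra! hne
    have hlt : ∀ a, ‖x a‖ ≤ (p : ℝ) ^ (i - 1) := by
      intro a
      have hle : ‖x a‖ ≤ (p : ℝ) ^ i := by
        have := hmul _ (by positivity) _ _ _ hk₁ hk₂ h1 a.1 a.2
        rwa [← hYX] at this
      have hlt := lt_of_le_of_ne hle (hne a)
      rcases eq_or_ne (x a) 0 with h0 | h0
      · rw [h0, norm_zero]; positivity
      · rw [Padic.norm_eq_zpow_neg_valuation h0, ← zpow_natCast,
          zpow_lt_zpow_iff_right₀ (one_lt_prime_real p)] at hlt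
        rw [Padic.norm_eq_zpow_neg_valuation h0, ← zpow_natCast,
          zpow_le_zpow_iff_right₀ (one_lt_prime_real p)]
        lia
    have h2 : EntryLE ((p : ℝ) ^ (i - 1)) (invDiag p i j) := by
      have : invDiag p i j = k₁⁻¹.val * Y * k₂⁻¹.val - X' := by rw [← hDX, add_sub_cancel_right]
      rw [this]
      refine EntryLE.sub ?_ (entryLE_mono (one_le_prime_pow _) hX'1)
      exact hmul _ (by positivity) _ _ _ (inv_mem hk₁) (inv_mem hk₂) fun a b => hlt (a, b)
    have h3 := h2 0 0
    simp only [invDiag, of_apply, cons_val', cons_val_zero, norm_prime_zpow_neg] at h3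
    exact absurd h3 (not_le.2 (pow_lt_pow_right₀ (one_lt_prime_real p) (by lia)))

end Cartan

/-! ### The modulus of `Y ↦ A Y D` -/

section Scaling

variable {p : ℕ} [hp : Fact p.Prime]

/-- The automorphism `Y ↦ A Y D` of the additive group `M₂(ℚ_p)`. -/
def mulMulEquiv (A D : GL (Fin 2) ℚ_[p]) :
    (Fin 2 × Fin 2 → ℚ_[p]) ≃ₜ+ (Fin 2 × Fin 2 → ℚ_[p]) where
  toFun x a := (A.val * (Matrix.of fun i j => x (i, j)) * D.val) a.1 a.2
  invFun x a := (A⁻¹.val * (Matrix.of fun i j => x (i, j)) * D⁻¹.val) a.1 a.2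
  left_inv x := by
    ext a
    change (A⁻¹.val * (A.val * (Matrix.of fun i j => x (i, j)) * D.val) * D⁻¹.val) a.1 a.2 = _
    simp only [← mul_assoc, Units.inv_mul, one_mul]
    simp only [mul_assoc, Units.mul_inv, mul_one, of_apply]
  right_inv x := by
    ext a
    change (A.val * (A⁻¹.val * (Matrix.of fun i j => x (i, j)) * D⁻¹.val) * D.val) a.1 a.2 = _
    simp only [← mul_assoc, Units.mul_inv, one_mul]
    simp only [mul_assoc, Units.inv_mul, mul_one, of_apply]
  map_add' x y := by
    ext a
    simp only [Pi.add_apply, ← Matrix.add_apply, ← Matrix.add_mul, ← Matrix.mul_add]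
    rfl
  continuous_toFun := by
    simp only [Matrix.mul_apply, of_apply]
    fun_prop
  continuous_invFun := by
    simp only [Matrix.mul_apply, of_apply]
    fun_prop

lemma mulMulEquiv_apply (A D : GL (Fin 2) ℚ_[p]) (x : Fin 2 × Fin 2 → ℚ_[p]) :
    (Matrix.of fun i j => mulMulEquiv A D x (i, j)) =
      A.val * (Matrix.of fun i j => x (i, j)) * D.val := rfl

lemma mulMulEquiv_mul (A A' D D' : GL (Fin 2) ℚ_[p]) :
    mulMulEquiv (A * A') (D' * D) = (mulMulEquiv A' D').trans (mulMulEquiv A D) := by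
  ext x a
  change ((A * A').val * (Matrix.of fun i j => x (i, j)) * (D' * D).val) a.1 a.2 =
    (A.val * (A'.val * (Matrix.of fun i j => x (i, j)) * D'.val) * D.val) a.1 a.2
  simp only [Units.val_mul, mul_assoc]

/-- The factor by which `Y ↦ A Y D` scales the Haar measure. -/
def mulMulChar (A D : GL (Fin 2) ℚ_[p]) : NNReal := addEquivAddHaarChar (mulMulEquiv A D)

lemma mulMulChar_mul (A A' D D' : GL (Fin 2) ℚ_[p]) :
    mulMulChar (A * A') (D' * D) = mulMulChar A D * mulMulChar A' D' := by
  rw [mulMulChar, mulMulEquiv_mul, addEquivAddHaarChar_trans, mul_comm]; rfl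

variable (p) in
/-- `M₂(ℤ_p)` as a subset of `ℚ_p⁴`. -/
def intBox : Set (Fin 2 × Fin 2 → ℚ_[p]) := {x | ∀ a, ‖x a‖ ≤ 1}

lemma intBox_eq : intBox p = Set.univ.pi fun _ => Metric.closedBall 0 1 := by
  ext x; simp [intBox]

lemma unipMeasure_intBox : unipMeasure p (intBox p) = 1 := by
  rw [intBox_eq, unipMeasure, Measure.pi_pi]
  simp [padicHaar_closedBall_one]

lemma mulMulChar_mul_preimage (A D : GL (Fin 2) ℚ_[p]) :
    mulMulChar A D * unipMeasure p (mulMulEquiv A D ⁻¹' intBox p) = 1 := by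
  have := addEquivAddHaarChar_smul_preimage (unipMeasure p) (X := intBox p) (mulMulEquiv A D)
  rw [unipMeasure_intBox] at this
  exact this

lemma mulMulChar_of_mem {A D : GL (Fin 2) ℚ_[p]} (hA : A ∈ maxCompact p (Fin 2))
    (hD : D ∈ maxCompact p (Fin 2)) : mulMulChar A D = 1 := by
  have hle : ∀ {A D : GL (Fin 2) ℚ_[p]}, A ∈ maxCompact p (Fin 2) → D ∈ maxCompact p (Fin 2) →
      intBox p ⊆ mulMulEquiv A D ⁻¹' intBox p := by
    intro A D hA hD x hx a
    exact (((entryLE_of_mem hA).mul_one (B := Matrix.of fun i j => x (i, j))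
      fun i j => hx (i, j)).mul_one (entryLE_of_mem hD)) a.1 a.2
  have h : mulMulEquiv A D ⁻¹' intBox p = intBox p := by
    refine Set.Subset.antisymm (fun x hx => ?_) (hle hA hD)
    have := hle (inv_mem hA) (inv_mem hD) hx
    have e : mulMulEquiv A⁻¹ D⁻¹ (mulMulEquiv A D x) = x := (mulMulEquiv A D).left_inv x
    rwa [Set.mem_preimage, e] at this
  have := mulMulChar_mul_preimage A D
  rw [h, unipMeasure_intBox, mul_one] at this
  exact_mod_cast this

lemma borel2_val (a d : ℚ_[p]ˣ) (b : ℚ_[p]) : (borel2 a d b).val = !![(a : ℚ_[p]), b; 0, (d : ℚ_[p])] :=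
  rfl

lemma padicHaar_closedBall_inv_norm (a : ℚ_[p]ˣ) :
    padicHaar p (Metric.closedBall 0 (‖(a : ℚ_[p])‖⁻¹)) = ENNReal.ofReal ‖(a : ℚ_[p])‖⁻¹ := by
  have hp0 := prime_pos_real p
  rw [Padic.norm_eq_zpow_neg_valuation a.ne_zero, ← _root_.zpow_neg, padicHaar_closedBall]
  have : (p : ℝ) ^ (- -(a : ℚ_[p]).valuation) =
      (((p : NNReal) ^ (- -(a : ℚ_[p]).valuation) : NNReal) : ℝ) := by push_cast; rfl
  rw [this, ENNReal.ofReal_coe_nnreal, ENNReal.coe_zpow (by simpa using hp.out.ne_zero)]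
  rfl

lemma mulMulChar_diag (a d a' d' : ℚ_[p]ˣ) :
    mulMulChar (borel2 a d 0) (borel2 a' d' 0) =
      ‖(a * d : ℚ_[p])‖₊ ^ 2 * ‖(a' * d' : ℚ_[p])‖₊ ^ 2 := by
  let A : Fin 2 → ℚ_[p]ˣ := ![a, d]
  let D : Fin 2 → ℚ_[p]ˣ := ![a', d']
  have h : mulMulEquiv (borel2 a d 0) (borel2 a' d' 0) ⁻¹' intBox p =
      Set.univ.pi fun e => Metric.closedBall 0 (‖((A e.1 * D e.2 : ℚ_[p]ˣ) : ℚ_[p])‖⁻¹) := by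
    ext x
    have key : ∀ e : Fin 2 × Fin 2, mulMulEquiv (borel2 a d 0) (borel2 a' d' 0) x e =
        ((A e.1 * D e.2 : ℚ_[p]ˣ) : ℚ_[p]) * x e := by
      rintro ⟨i, j⟩
      change (!![(a : ℚ_[p]), 0; 0, (d : ℚ_[p])] * (Matrix.of fun i j => x (i, j)) *
        !![(a' : ℚ_[p]), 0; 0, (d' : ℚ_[p])]) i j = _
      fin_cases i <;> fin_cases j <;>
        simp only [Matrix.mul_apply, Fin.sum_univ_two, A, D, of_apply, cons_val', cons_val_zero,
          cons_val_one, Fin.zero_eta, Fin.mk_one, Units.val_mul, cons_val_fin_one] <;> ring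
    simp only [Set.mem_preimage, intBox, Set.mem_ofPred_eq, key, Set.mem_univ_pi,
      Metric.mem_closedBall, dist_zero_right, norm_mul]
    refine forall_congr' fun e => ?_
    have h0 : 0 < ‖((A e.1 * D e.2 : ℚ_[p]ˣ) : ℚ_[p])‖ := norm_pos_iff.2 (Units.ne_zero _)
    rw [mul_comm, ← le_div_iff₀ h0, one_div]
  have h2 := mulMulChar_mul_preimage (borel2 a d 0) (borel2 a' d' 0)
  rw [h, unipMeasure, Measure.pi_pi] at h2
  simp only [padicHaar_closedBall_inv_norm] at h2
  rw [← ENNReal.ofReal_prod_of_nonneg fun _ _ => by positivity, ENNReal.ofReal,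
    ← ENNReal.coe_mul, ENNReal.coe_eq_one] at h2
  have h3 := congrArg NNReal.toReal h2
  have hnz : ∀ x : ℚ_[p]ˣ, ‖(x : ℚ_[p])‖ ≠ 0 := fun x => norm_ne_zero_iff.2 x.ne_zero
  rw [NNReal.coe_mul, Real.coe_toNNReal _ (Finset.prod_nonneg fun _ _ => by positivity),
    Fintype.prod_prod_type] at h3
  simp only [Fin.prod_univ_two, A, D, Units.val_mul, norm_mul, cons_val_zero, cons_val_one,
    NNReal.coe_one] at h3
  ext
  have := hnz a; have := hnz d; have := hnz a'; have := hnz d'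
  simp only [NNReal.coe_mul, NNReal.coe_pow, coe_nnnorm, norm_mul]
  field_simp at h3
  rw [h3]
  ring

/-- The map `Y ↦ A Y D` scales the Haar measure by `|det A|² |det D|²`. -/
lemma mulMulChar_eq (A D : GL (Fin 2) ℚ_[p]) :
    mulMulChar A D = ‖A.val.det‖₊ ^ 2 * ‖D.val.det‖₊ ^ 2 := by
  have key : ∀ A : GL (Fin 2) ℚ_[p], ∃ k₁ ∈ maxCompact p (Fin 2), ∃ k₂ ∈ maxCompact p (Fin 2),
      ∃ a d : ℚ_[p]ˣ, A = k₁ * borel2 a d 0 * k₂ ∧ ‖A.val.det‖₊ = ‖(a * d : ℚ_[p])‖₊ := by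
    intro A
    obtain ⟨k₁, hk₁, k₂, hk₂, a, d, -, h⟩ := exists_cartan A.val
    have hdet : A.val.det = k₁.val.det * (a * d) * k₂.val.det := by
      rw [h, det_mul, det_mul, det_fin_two]; simp
    have h0 : A.val.det ≠ 0 := A.isUnit.map detMonoidHom |>.ne_zero
    have had : a * d ≠ 0 := fun h => h0 (by rw [hdet, h]; simp)
    refine ⟨k₁, hk₁, k₂, hk₂, Units.mk0 a (left_ne_zero_of_mul had),
      Units.mk0 d (right_ne_zero_of_mul had), Units.ext h, ?_⟩
    rw [hdet]
    ext
    simp [norm_det_of_mem hk₁, norm_det_of_mem hk₂]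
  obtain ⟨k₁, hk₁, k₂, hk₂, a, d, hA, hA'⟩ := key A
  obtain ⟨k₃, hk₃, k₄, hk₄, a', d', hD, hD'⟩ := key D
  rw [hA', hD', ← mulMulChar_diag, hA, hD, mul_assoc k₁, mulMulChar_mul, mulMulChar_mul,
    mulMulChar_of_mem hk₁ hk₄, mulMulChar_of_mem hk₂ hk₃, one_mul, mul_one]

end Scaling

/-! ### Elements of `GL₂(ℚ_p)` -/

section Elements

variable {p : ℕ} [hp : Fact p.Prime]

lemma borel2_mul (a d a' d' : ℚ_[p]ˣ) (b b' : ℚ_[p]) :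
    borel2 a d b * borel2 a' d' b' = borel2 (a * a') (d * d') (a * b' + b * d') := by
  ext i j
  rw [GeneralLinearGroup.coe_mul, borel2_val, borel2_val, borel2_val]
  fin_cases i <;> fin_cases j <;> simp

lemma borel2_one : borel2 (1 : ℚ_[p]ˣ) 1 0 = 1 := by
  ext i j
  rw [borel2_val]
  fin_cases i <;> fin_cases j <;> simp

lemma borel2_mem_maxCompact {a d : ℚ_[p]ˣ} {b : ℚ_[p]} (ha : ‖(a : ℚ_[p])‖ = 1)
    (hd : ‖(d : ℚ_[p])‖ = 1) (hb : ‖b‖ ≤ 1) : borel2 a d b ∈ maxCompact p (Fin 2) :=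
  mem_maxCompact_fin_two (by rw [borel2_val]; exact entryLE_fin_two ha.le hb (by simp) hd.le)
    (by simp [borel2_val, det_fin_two, ha, hd])

lemma unif_val : ((unif p : ℚ_[p]ˣ) : ℚ_[p]) = p := rfl

variable (p) in
/-- The element `diag(pⁿ, 1)`. -/
def diagPow (n : ℕ) : GL (Fin 2) ℚ_[p] := borel2 (unif p ^ n) 1 0

variable (p) in
/-- The permutation matrix `(0 1; 1 0)`. -/
def swap2 : GL (Fin 2) ℚ_[p] :=
  GeneralLinearGroup.mkOfDetNeZero !![0, 1; 1, 0] (by simp [det_fin_two])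

variable (p) in
/-- The Atkin-Lehner element `(0 1; p 0)`. -/
def atkinLehner : GL (Fin 2) ℚ_[p] :=
  GeneralLinearGroup.mkOfDetNeZero !![0, 1; (p : ℚ_[p]), 0]
    (by simp [det_fin_two, hp.out.ne_zero])

lemma swap2_val : (swap2 p).val = !![0, 1; 1, 0] := rfl

lemma atkinLehner_val : (atkinLehner p).val = !![0, 1; (p : ℚ_[p]), 0] := rfl

lemma swap2_mem : swap2 p ∈ maxCompact p (Fin 2) :=
  mem_maxCompact_fin_two (entryLE_fin_two (by simp) (by simp) (by simp) (by simp))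
    (by simp [swap2_val, det_fin_two])

lemma swap2_mul_atkinLehner : swap2 p * atkinLehner p = borel2 (unif p) 1 0 := by
  ext i j
  rw [GeneralLinearGroup.coe_mul, swap2_val, atkinLehner_val, borel2_val]
  fin_cases i <;> fin_cases j <;> simp [unif_val]

lemma swap2_mul_diag_mul_swap2 (a d : ℚ_[p]ˣ) :
    swap2 p * borel2 a d 0 * swap2 p = borel2 d a 0 := by
  ext i j
  simp only [GeneralLinearGroup.coe_mul, swap2_val, borel2_val]
  fin_cases i <;> fin_cases j <;> simp

lemma diagPow_mul_borel2 (n : ℕ) (x : ℚ_[p]) :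
    diagPow p n * borel2 1 1 x = borel2 1 1 ((p : ℚ_[p]) ^ n * x) * diagPow p n := by
  rw [diagPow, borel2_mul, borel2_mul]
  congr 1
  · simp
  · simp [unif_val]

lemma borel2_mul_diagPow (n : ℕ) (x : ℚ_[p]) :
    borel2 1 1 x * diagPow p n = borel2 (unif p ^ n) 1 x := by
  rw [diagPow, borel2_mul]
  congr 1
  · simp
  · simp
  · simp

lemma diagPow_mul_diagPow (m n : ℕ) : diagPow p m * diagPow p n = diagPow p (m + n) := by
  rw [diagPow, diagPow, diagPow, borel2_mul, pow_add]
  congr 1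
  · simp
  · simp

end Elements

/-! ### Hecke operators and eigenvectors -/

section Representations

variable {p : ℕ} [hp : Fact p.Prime]
variable {V : Type*} [AddCommGroup V] [Module ℂ V] (σ : Representation ℂ (GL (Fin 2) ℚ_[p]) V)
variable {W : Type*} [AddCommGroup W] [Module ℂ W] (σ' : Representation ℂ (GL (Fin 2) ℚ_[p]) W)

/-- Every vector is fixed by an open subgroup. -/
def IsSmoothRep : Prop :=
  ∀ x, ∃ U : Subgroup (GL (Fin 2) ℚ_[p]), IsOpen (U : Set (GL (Fin 2) ℚ_[p])) ∧ ∀ u ∈ U, σ u x = x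

lemma rep_mul_apply (g h : GL (Fin 2) ℚ_[p]) (x : V) : σ (g * h) x = σ g (σ h x) := by
  rw [map_mul]; rfl

/-- The operator `∑_{x mod pⁿ} σ(pⁿ x; 0 1)`. -/
def heckeU (n : ℕ) : V →ₗ[ℂ] V :=
  ∑ x ∈ Finset.range (p ^ n), σ (borel2 (unif p ^ n) 1 (x : ℚ_[p]))

lemma heckeU_apply (n : ℕ) (v : V) : heckeU σ n v =
    ∑ x ∈ Finset.range (p ^ n), σ (borel2 (unif p ^ n) 1 (x : ℚ_[p])) v := by
  simp [heckeU, LinearMap.sum_apply]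

lemma heckeU_zero (v : V) : heckeU σ 0 v = v := by
  simp [heckeU_apply, borel2_one]

lemma sum_range_pow_add {M : Type*} [AddCommMonoid M] (a b : ℕ) (f : ℕ → M) :
    ∑ z ∈ Finset.range (p ^ (a + b)), f z =
      ∑ x ∈ Finset.range (p ^ a), ∑ y ∈ Finset.range (p ^ b), f (x + p ^ a * y) := by
  have hpa : 0 < p ^ a := pow_pos hp.out.pos a
  rw [← Finset.sum_product']
  refine Finset.sum_nbij' (fun z => (z % p ^ a, z / p ^ a)) (fun z => z.1 + p ^ a * z.2) ?_ ?_ ?_ ?_ ?_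
  · intro z hz
    rw [Finset.mem_range, pow_add] at hz
    simp only [Finset.mem_product, Finset.mem_range]
    exact ⟨Nat.mod_lt _ hpa, Nat.div_lt_of_lt_mul hz⟩
  · rintro ⟨x, y⟩ h
    simp only [Finset.mem_product, Finset.mem_range] at h ⊢
    rw [pow_add]
    calc x + p ^ a * y < p ^ a * 1 + p ^ a * y := by simpa using h.1
      _ = p ^ a * (y + 1) := by ring
      _ ≤ _ := Nat.mul_le_mul_left _ h.2
  · intro z _
    exact Nat.mod_add_div z (p ^ a)
  · rintro ⟨x, y⟩ h
    simp only [Finset.mem_product, Finset.mem_range] at h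
    simp [Nat.add_mul_mod_self_left, Nat.mod_eq_of_lt h.1, Nat.add_mul_div_left _ _ hpa,
      Nat.div_eq_of_lt h.1]
  · intro z _
    simp only [Nat.mod_add_div]

lemma heckeU_add (a b : ℕ) (v : V) : heckeU σ (a + b) v = heckeU σ a (heckeU σ b v) := by
  rw [heckeU_apply, sum_range_pow_add, heckeU_apply]
  refine Finset.sum_congr rfl fun x _ => ?_
  rw [heckeU_apply, map_sum]
  refine Finset.sum_congr rfl fun y _ => ?_
  rw [← rep_mul_apply, borel2_mul]
  congr 2
  congr 1
  · rw [pow_add]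
  · simp
  · push_cast
    simp [unif_val, add_comm]

variable {σ}

/-- If `L` is invariant under the translations `(1 p^N x; 0 1)`, its value on `diag(p^{N+r}, 1) v`
is obtained by averaging from the operator `heckeU`. -/
lemma functional_diagPow_add {N : ℕ} {L : V →ₗ[ℂ] ℂ}
    (hL : ∀ (x : ℕ) y, L (σ (borel2 1 1 ((p : ℚ_[p]) ^ N * x)) y) = L y) (r : ℕ) (v : V) :
    (p : ℂ) ^ r * L (σ (diagPow p (N + r)) v) = L (σ (diagPow p N) (heckeU σ r v)) := by
  rw [heckeU_apply, map_sum, map_sum, Finset.sum_congr rfl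
    (g := fun _ => L (σ (diagPow p (N + r)) v)), Finset.sum_const, Finset.card_range, nsmul_eq_mul]
  · push_cast; rfl
  · intro x _
    rw [← rep_mul_apply, ← borel2_mul_diagPow, ← mul_assoc, diagPow_mul_borel2, mul_assoc,
      diagPow_mul_diagPow, rep_mul_apply, hL]

variable (σ) in
/-- The properties of the new vector `v` of an unramified twist of the Steinberg representation on
which the computation rests: `c` is the eigenvalue of `U_p`, whose square is the value at `p` of the
central character, and `ε` that of the Atkin-Lehner element. -/
structure IsIwahoriEigenvector (v : V) (c ε : ℂ) : Prop where
  mirahoric : ∀ k ∈ mirahoric p (1 : Fin 2) 1, σ k v = v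
  unit_scalar : ∀ u : ℚ_[p]ˣ, ‖(u : ℚ_[p])‖ = 1 → σ (borel2 u u 0) v = v
  scalar : σ (borel2 (unif p) (unif p) 0) v = c ^ 2 • v
  hecke : heckeU σ 1 v = c • v
  atkinLehner : σ (atkinLehner p) v = ε • v

variable (σ) in
/-- The properties of a spherical vector `v` with Hecke polynomial `(X - τ₁)(X - τ₂)` on which the
computation rests; `ω` is the value at `p` of the central character. -/
structure IsSphericalEigenvector (v : V) (ω τ₁ τ₂ : ℂ) : Prop where
  maxCompact : ∀ k ∈ maxCompact p (Fin 2), σ k v = v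
  scalar : σ (borel2 (unif p) (unif p) 0) v = ω • v
  hecke : heckeU σ 1 v + σ (borel2 1 (unif p) 0) v = (τ₁ + τ₂) • v
  prod_eq : τ₁ * τ₂ = p * ω

/-- The complete homogeneous symmetric polynomial of degree `n` in `τ₁` and `τ₂`. -/
def hsym (τ₁ τ₂ : ℂ) : ℕ → ℂ
  | 0 => 1
  | n + 1 => τ₁ * hsym τ₁ τ₂ n + τ₂ ^ (n + 1)

lemma hsym_add_two (τ₁ τ₂ : ℂ) (n : ℕ) :
    hsym τ₁ τ₂ (n + 2) = (τ₁ + τ₂) * hsym τ₁ τ₂ (n + 1) - τ₁ * τ₂ * hsym τ₁ τ₂ n := by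
  simp only [hsym]; ring

lemma norm_hsym_le {τ₁ τ₂ : ℂ} {R : ℝ} (h₁ : ‖τ₁‖ ≤ R) (h₂ : ‖τ₂‖ ≤ R) (n : ℕ) :
    ‖hsym τ₁ τ₂ n‖ ≤ (n + 1) * R ^ n := by
  have hR : 0 ≤ R := (norm_nonneg _).trans h₁
  induction n with
  | zero => simp [hsym]
  | succ n ih =>
    rw [hsym]
    refine (norm_add_le _ _).trans ?_
    rw [norm_mul, norm_pow]
    have h3 : ‖τ₁‖ * ‖hsym τ₁ τ₂ n‖ ≤ R * ((n + 1) * R ^ n) :=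
      mul_le_mul h₁ ih (norm_nonneg _) hR
    have h4 : ‖τ₂‖ ^ (n + 1) ≤ R ^ (n + 1) := pow_le_pow_left₀ (norm_nonneg _) h₂ _
    calc _ ≤ R * ((n + 1) * R ^ n) + R ^ (n + 1) := add_le_add h3 h4
      _ = _ := by push_cast; ring

lemma IsIwahoriEigenvector.heckeU_eq {v : V} {c ε : ℂ} (hv : IsIwahoriEigenvector σ v c ε) (n : ℕ) :
    heckeU σ n v = c ^ n • v := by
  induction n with
  | zero => simp [heckeU_zero]
  | succ n ih => rw [heckeU_add, hv.hecke, map_smul, ih, smul_smul, pow_succ']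

/-- The operator `heckeU` does not preserve the line of `v`, but it preserves the plane spanned by `v`
and `σ(diag(1, p)) v`. -/
lemma IsSphericalEigenvector.heckeU_succ {v : V} {ω τ₁ τ₂ : ℂ}
    (hv : IsSphericalEigenvector σ v ω τ₁ τ₂) (n : ℕ) :
    heckeU σ (n + 1) v =
      hsym τ₁ τ₂ (n + 1) • v - hsym τ₁ τ₂ n • σ (borel2 1 (unif p) 0) v := by
  have h1 : heckeU σ 1 v = (τ₁ + τ₂) • v - σ (borel2 1 (unif p) 0) v := by
    rw [← hv.hecke, add_sub_cancel_right]
  have h2 : heckeU σ 1 (σ (borel2 1 (unif p) 0) v) = ((p : ℂ) * ω) • v := by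
    rw [heckeU_apply, Finset.sum_congr rfl (g := fun _ => ω • v), Finset.sum_const,
      Finset.card_range, pow_one, mul_smul, ← Nat.cast_smul_eq_nsmul ℂ]
    intro x _
    have : borel2 (unif p ^ 1) 1 (x : ℚ_[p]) * borel2 1 (unif p) 0 =
        borel2 (unif p) (unif p) 0 * borel2 1 1 (x : ℚ_[p]) := by
      rw [borel2_mul, borel2_mul]
      congr 1
      · simp
      · simp
      · simp [unif_val, mul_comm]
    rw [← rep_mul_apply, this, rep_mul_apply, hv.maxCompact, hv.scalar]
    exact borel2_mem_maxCompact (by simp) (by simp)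
      (by simpa using Padic.norm_int_le_one (p := p) (x : ℤ))
  induction n with
  | zero => rw [h1]; simp [hsym]
  | succ n ih =>
    rw [add_comm, heckeU_add, ih, map_sub, map_smul, map_smul, h1, h2, add_comm 1, hsym_add_two,
      hv.prod_eq]
    module

end Representations

/-! ### Smooth functionals -/

section Congruence

variable {p : ℕ} [hp : Fact p.Prime]
variable {V : Type*} [AddCommGroup V] [Module ℂ V] {σ : Representation ℂ (GL (Fin 2) ℚ_[p]) V}
variable {W : Type*} [AddCommGroup W] [Module ℂ W] {σ' : Representation ℂ (GL (Fin 2) ℚ_[p]) W}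

instance finite_quotient_ker_redGL (n : ℕ) : Finite (GL (Fin 2) ℤ_[p] ⧸ (redGL p n).ker) :=
  have : NeZero (p ^ n) := ⟨pow_ne_zero n hp.out.ne_zero⟩
  Finite.of_injective _ (QuotientGroup.kerLift_injective (redGL p n))

lemma IsSmoothFunctional.exists_level {l : V ⊗[ℂ] W →ₗ[ℂ] ℂ} (hl : IsSmoothFunctional σ σ' l) :
    ∃ N, ∀ k ∈ (redGL p N).ker, ∀ k' ∈ (redGL p N).ker, ∀ x,
      l (TensorProduct.map (σ (intGL p _ k)) (σ' (intGL p _ k')) x) = l x := by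
  obtain ⟨U, hU, h⟩ := hl
  obtain ⟨N, hN⟩ := exists_redGL_ker_le hU
  exact ⟨N, fun k hk k' hk' x => h _ (hN k hk) _ (hN k' hk') x⟩

/-- A linear functional on a smooth representation without nonzero vectors fixed by `GL₂(ℤ_p)`
vanishes if it is invariant under `GL₂(ℤ_p)`. -/
lemma functional_eq_zero (hσ : IsSmoothRep σ)
    (h0 : ∀ x, (∀ k ∈ maxCompact p (Fin 2), σ k x = x) → x = 0) {L : V →ₗ[ℂ] ℂ}
    (hL : ∀ k ∈ maxCompact p (Fin 2), ∀ x, L (σ k x) = L x) : L = 0 := by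
  ext x
  obtain ⟨U, hU, hx⟩ := hσ x
  obtain ⟨N, hN⟩ := exists_redGL_ker_le hU
  let Q := GL (Fin 2) ℤ_[p] ⧸ (redGL p N).ker
  have : Fintype Q := Fintype.ofFinite _
  let F : Q → V := Quotient.lift (fun k => σ (intGL p _ k) x) fun a b hab => by
    have : a⁻¹ * b ∈ (redGL p N).ker := QuotientGroup.leftRel_apply.1 hab
    have h := hx _ (hN _ this)
    change σ (intGL p _ a) x = σ (intGL p _ b) x
    rw [← h, ← rep_mul_apply, ← map_mul, mul_inv_cancel_left, h]
  have hF : ∀ (k : GL (Fin 2) ℤ_[p]) (q : Q), σ (intGL p _ k) (F q) = F (k • q) := by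
    intro k q
    induction q using QuotientGroup.induction_on with
    | H a =>
      change σ (intGL p _ k) (σ (intGL p _ a) x) = σ (intGL p _ (k * a)) x
      rw [map_mul, rep_mul_apply]
  have hsum : ∑ q, F q = 0 := by
    refine h0 _ ?_
    rintro _ ⟨k, rfl⟩
    rw [map_sum]
    simp only [hF]
    exact Fintype.sum_equiv (MulAction.toPerm k) _ _ fun _ => rfl
  have hLF : ∀ q, L (F q) = L x := by
    intro q
    induction q using QuotientGroup.induction_on with
    | H a => exact hL _ ⟨a, rfl⟩ x
  have h := congrArg L hsum
  rw [map_sum, map_zero, Finset.sum_congr rfl fun q _ => hLF q, Finset.sum_const, nsmul_eq_mul,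
    mul_eq_zero] at h
  refine h.resolve_left fun h => (Fintype.card_pos (α := Q)).ne' ?_
  rw [Finset.card_univ] at h
  exact_mod_cast h

/-- The values of a smooth functional on `GL₂(ℤ_p)`-orbits are bounded. -/
lemma exists_bound_orbit {l : V ⊗[ℂ] W →ₗ[ℂ] ℂ} {N : ℕ}
    (hN : ∀ k ∈ (redGL p N).ker, ∀ k' ∈ (redGL p N).ker, ∀ x,
      l (TensorProduct.map (σ (intGL p _ k)) (σ' (intGL p _ k')) x) = l x) (x : V) (y : W) :
    ∃ C, ∀ k k' : GL (Fin 2) ℤ_[p],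
      ‖l (σ (intGL p _ k) x ⊗ₜ σ' (intGL p _ k') y)‖ ≤ C := by
  let f : GL (Fin 2) ℤ_[p] × GL (Fin 2) ℤ_[p] → ℝ := fun k =>
    ‖l (σ (intGL p _ k.1) x ⊗ₜ σ' (intGL p _ k.2) y)‖
  let r : GL (Fin 2) ℤ_[p] × GL (Fin 2) ℤ_[p] →
    GL (Fin 2) (ZMod (p ^ N)) × GL (Fin 2) (ZMod (p ^ N)) := fun k => (redGL p N k.1, redGL p N k.2)
  have hfr : f.FactorsThrough r := by
    rintro ⟨a, b⟩ ⟨a', b'⟩ h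
    have hr1 : redGL p N a = redGL p N a' := congrArg Prod.fst h
    have hr2 : redGL p N b = redGL p N b' := congrArg Prod.snd h
    have h1 : a' * a⁻¹ ∈ (redGL p N).ker := by
      rw [MonoidHom.mem_ker, map_mul, map_inv, hr1, mul_inv_cancel]
    have h2 : b' * b⁻¹ ∈ (redGL p N).ker := by
      rw [MonoidHom.mem_ker, map_mul, map_inv, hr2, mul_inv_cancel]
    have h3 := hN _ h1 _ h2 (σ (intGL p _ a) x ⊗ₜ σ' (intGL p _ b) y)
    rw [TensorProduct.map_tmul, ← rep_mul_apply, ← rep_mul_apply, ← map_mul, ← map_mul,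
      inv_mul_cancel_right, inv_mul_cancel_right] at h3
    change ‖l _‖ = ‖l _‖
    rw [h3]
  have : NeZero (p ^ N) := ⟨pow_ne_zero N hp.out.ne_zero⟩
  obtain ⟨C, hC⟩ := (Set.finite_range (Function.extend r f 0)).bddAbove
  refine ⟨C, fun k k' => ?_⟩
  have := hC ⟨r (k, k'), rfl⟩
  rwa [hfr.extend_apply] at this

end Congruence

/-! ### Bounds for matrix coefficients -/

section MatrixCoefficients

variable {p : ℕ} [hp : Fact p.Prime]
variable {V : Type*} [AddCommGroup V] [Module ℂ V] {σ : Representation ℂ (GL (Fin 2) ℚ_[p]) V}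
variable {W : Type*} [AddCommGroup W] [Module ℂ W] {σ' : Representation ℂ (GL (Fin 2) ℚ_[p]) W}

/-- The unipotent elements of level `p^N`, and their conjugates under `GL₂(ℤ_p)`, reduce to the
identity modulo `p^N`. -/
lemma exists_ker_conj (N : ℕ) (k : GL (Fin 2) ℤ_[p]) (x : ℕ) : ∃ u ∈ (redGL p N).ker,
    intGL p _ k * borel2 1 1 ((p : ℚ_[p]) ^ N * (x : ℚ_[p])) = intGL p _ u * intGL p _ k := by
  have hpz : ‖((p : ℤ_[p]) ^ N * x : ℤ_[p])‖ ≤ (p : ℝ) ^ (-(N : ℤ)) := by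
    rw [norm_mul, PadicInt.norm_p_pow]
    exact mul_le_of_le_one_right (zpow_nonneg (prime_pos_real p).le _) (PadicInt.norm_le_one _)
  let u : GL (Fin 2) ℤ_[p] :=
    ⟨!![1, (p : ℤ_[p]) ^ N * x; 0, 1], !![1, -((p : ℤ_[p]) ^ N * x); 0, 1],
      by ext i j; fin_cases i <;> fin_cases j <;> simp,
      by ext i j; fin_cases i <;> fin_cases j <;> simp⟩
  have hu : u ∈ (redGL p N).ker := by
    rw [MonoidHom.mem_ker, redGL_eq_one_iff]
    intro i j
    change ‖!![1, (p : ℤ_[p]) ^ N * x; 0, 1] i j - _‖ ≤ _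
    fin_cases i <;> fin_cases j
    · simp
    · simpa using hpz
    · simp
    · simp
  have hu' : intGL p _ u = borel2 1 1 ((p : ℚ_[p]) ^ N * (x : ℚ_[p])) := by
    ext i j
    rw [borel2_val]
    change ((!![1, (p : ℤ_[p]) ^ N * x; 0, 1] i j : ℤ_[p]) : ℚ_[p]) = _
    fin_cases i <;> fin_cases j <;> simp
  refine ⟨k * u * k⁻¹, (MonoidHom.normal_ker _).conj_mem _ hu _, ?_⟩
  rw [map_mul, map_mul, map_inv, inv_mul_cancel_right, hu']

/-- Bound for the coefficients `l(σ(k₁ diag(pⁿ, 1)) v ⊗ σ'(k₂ diag(pᵐ, 1)) v')`. If `l` has level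
`p^N`, averaging over `(1 p^N x; 0 1)` replaces `diag(p^{N+r}, 1)` by `p^{-r} diag(p^N, 1) U_pʳ`, and
the growth of `U_pʳ` on `v` and `v'` is known. -/
lemma exists_bound_diagPow {v : V} {c ε : ℂ} (hv : IsIwahoriEigenvector σ v c ε) (hc : c ≠ 0)
    {v' : W} {ω τ₁ τ₂ : ℂ} (hv' : IsSphericalEigenvector σ' v' ω τ₁ τ₂) {R : ℝ} (hR : 0 < R)
    (h₁ : ‖τ₁‖ ≤ R) (h₂ : ‖τ₂‖ ≤ R) {l : V ⊗[ℂ] W →ₗ[ℂ] ℂ} (hl : IsSmoothFunctional σ σ' l) :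
    ∃ C, 0 ≤ C ∧ ∀ n m : ℕ, ∀ k₁ ∈ maxCompact p (Fin 2), ∀ k₂ ∈ maxCompact p (Fin 2),
      ‖l (σ (k₁ * diagPow p n) v ⊗ₜ σ' (k₂ * diagPow p m) v')‖ ≤
        C * ((‖c‖ / p) ^ n * ((m + 1) * (R / p) ^ m)) := by
  obtain ⟨N, hN⟩ := hl.exists_level
  have hp0 := prime_pos_real p
  have hpc : (p : ℂ) ≠ 0 := by exact_mod_cast hp.out.ne_zero
  have hc0 : 0 < ‖c‖ := norm_pos_iff.2 hc
  -- reduction of the exponents `n` and `m` to `min n N` and `min m N`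
  have stepV : ∀ (n : ℕ) (k : GL (Fin 2) ℤ_[p]) (y : W),
      (p : ℂ) ^ (n - min n N) * l (σ (intGL p _ k * diagPow p n) v ⊗ₜ y) =
        c ^ (n - min n N) * l (σ (intGL p _ k * diagPow p (min n N)) v ⊗ₜ y) := by
    intro n k y
    rcases le_total n N with h | h
    · rw [min_eq_left h]; simp
    · rw [min_eq_right h]
      have hL := functional_diagPow_add (σ := σ) (N := N)
        (L := l ∘ₗ (TensorProduct.mk ℂ V W).flip y ∘ₗ σ (intGL p _ k)) (fun x z => by
          obtain ⟨u, hu, hku⟩ := exists_ker_conj N k x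
          simp only [LinearMap.comp_apply, LinearMap.flip_apply, TensorProduct.mk_apply]
          rw [← rep_mul_apply, hku, rep_mul_apply, ← hN u hu 1 (one_mem _)
            (σ (intGL p _ k) z ⊗ₜ y), TensorProduct.map_tmul]
          simp) (n - N) v
      rw [hv.heckeU_eq, Nat.add_sub_cancel' h] at hL
      simpa [rep_mul_apply, TensorProduct.smul_tmul', ← TensorProduct.tmul_smul] using hL
  have stepW : ∀ (m : ℕ) (k : GL (Fin 2) ℤ_[p]) (x : V),
      (p : ℂ) ^ (m - min m N) * l (x ⊗ₜ σ' (intGL p _ k * diagPow p m) v') =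
        l (x ⊗ₜ σ' (intGL p _ k * diagPow p (min m N)) (heckeU σ' (m - min m N) v')) := by
    intro m k x
    rcases le_total m N with h | h
    · rw [min_eq_left h]; simp [heckeU_zero]
    · rw [min_eq_right h]
      have hL := functional_diagPow_add (σ := σ') (N := N)
        (L := l ∘ₗ TensorProduct.mk ℂ V W x ∘ₗ σ' (intGL p _ k)) (fun y z => by
          obtain ⟨u, hu, hku⟩ := exists_ker_conj N k y
          simp only [LinearMap.comp_apply, TensorProduct.mk_apply]
          rw [← rep_mul_apply, hku, rep_mul_apply, ← hN 1 (one_mem _) u hu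
            (x ⊗ₜ σ' (intGL p _ k) z), TensorProduct.map_tmul]
          simp) (m - N) v'
      rw [Nat.add_sub_cancel' h] at hL
      simpa [rep_mul_apply] using hL
  -- a common bound for the finitely many orbits that occur
  obtain ⟨C₀, hC₀⟩ : ∃ C₀ : ℝ, ∀ n ≤ N, ∀ m ≤ N, ∀ k k' : GL (Fin 2) ℤ_[p],
      ‖l (σ (intGL p _ k * diagPow p n) v ⊗ₜ σ' (intGL p _ k' * diagPow p m) v')‖ ≤ C₀ ∧
      ‖l (σ (intGL p _ k * diagPow p n) v ⊗ₜ
        σ' (intGL p _ k' * diagPow p m) (σ' (borel2 1 (unif p) 0) v'))‖ ≤ C₀ := by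
    have h : ∀ y : W, ∃ D : ℕ → ℕ → ℝ, ∀ n m, ∀ k k' : GL (Fin 2) ℤ_[p],
        ‖l (σ (intGL p _ k * diagPow p n) v ⊗ₜ σ' (intGL p _ k' * diagPow p m) y)‖ ≤ D n m := by
      intro y
      choose D hD using fun n m => exists_bound_orbit hN (σ (diagPow p n) v) (σ' (diagPow p m) y)
      refine ⟨D, fun n m k k' => ?_⟩
      simpa only [rep_mul_apply] using hD n m k k'
    obtain ⟨D, hD⟩ := h v'
    obtain ⟨E, hE⟩ := h (σ' (borel2 1 (unif p) 0) v')
    obtain ⟨C₀, hC₀⟩ := (((Finset.range (N + 1) ×ˢ Finset.range (N + 1)).image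
      fun a => max (D a.1 a.2) (E a.1 a.2)).finite_toSet).bddAbove
    refine ⟨C₀, fun n hn m hm k k' => ?_⟩
    have : max (D n m) (E n m) ≤ C₀ := hC₀ (Finset.mem_coe.2 (Finset.mem_image.2
      ⟨(n, m), Finset.mem_product.2 ⟨Finset.mem_range_succ_iff.2 hn, Finset.mem_range_succ_iff.2 hm⟩,
        rfl⟩))
    exact ⟨(hD n m k k').trans ((le_max_left _ _).trans this),
      (hE n m k k').trans ((le_max_right _ _).trans this)⟩
  have hC₀0 : 0 ≤ C₀ := (norm_nonneg _).trans (hC₀ 0 (Nat.zero_le _) 0 (Nat.zero_le _) 1 1).1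
  have hpowsub : ∀ (a : ℝ), 0 < a → ∀ n, a ^ (n - min n N) ≤ max 1 a⁻¹ ^ N * a ^ n := by
    intro a ha n
    have h1 : a ^ n = a ^ (n - min n N) * a ^ (min n N) := by
      rw [← pow_add, Nat.sub_add_cancel (min_le_left _ _)]
    have h2 : 1 ≤ max 1 a⁻¹ ^ N * a ^ (min n N) := by
      have h3 : (a⁻¹) ^ (min n N) ≤ max 1 a⁻¹ ^ N :=
        (pow_le_pow_left₀ (by positivity) (le_max_right _ _) _).trans
          (pow_le_pow_right₀ (le_max_left _ _) (min_le_right _ _))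
      calc 1 = (a⁻¹) ^ (min n N) * a ^ (min n N) := by
            rw [← mul_pow, inv_mul_cancel₀ ha.ne', one_pow]
        _ ≤ _ := by gcongr
    rw [h1]
    calc a ^ (n - min n N) = a ^ (n - min n N) * 1 := by ring
      _ ≤ a ^ (n - min n N) * (max 1 a⁻¹ ^ N * a ^ (min n N)) := by gcongr
      _ = _ := by ring
  have hheckeW : ∀ r : ℕ, ∃ a b : ℂ, heckeU σ' r v' = a • v' - b • σ' (borel2 1 (unif p) 0) v' ∧
      ‖a‖ ≤ (r + 1) * R ^ r ∧ ‖b‖ ≤ (r + 1) * R ^ r * R⁻¹ := by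
    intro r
    cases r with
    | zero => exact ⟨1, 0, by simp [heckeU_zero], by simp, by simp [hR.le]⟩
    | succ r =>
      refine ⟨_, _, hv'.heckeU_succ r, norm_hsym_le h₁ h₂ _, (norm_hsym_le h₁ h₂ _).trans ?_⟩
      rw [pow_succ, ← mul_assoc, mul_assoc _ R, mul_inv_cancel₀ hR.ne', mul_one]
      push_cast
      gcongr
      linarith
  refine ⟨max 1 (‖c‖ / p)⁻¹ ^ N * (max 1 (R / p)⁻¹ ^ N) * ((1 + R⁻¹) * C₀), by positivity, ?_⟩
  rintro n m _ ⟨k, rfl⟩ _ ⟨k', rfl⟩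
  change ‖l (σ (intGL p _ k * diagPow p n) v ⊗ₜ σ' (intGL p _ k' * diagPow p m) v')‖ ≤ _
  obtain ⟨a, b, hab, ha, hb⟩ := hheckeW (m - min m N)
  have e1 := stepV n k (σ' (intGL p _ k' * diagPow p m) v')
  have e2 := stepW m k' (σ (intGL p _ k * diagPow p (min n N)) v)
  obtain ⟨b1, b2⟩ := hC₀ _ (min_le_right n N) _ (min_le_right m N) k k'
  rw [hab, map_sub, map_smul, map_smul, TensorProduct.tmul_sub, TensorProduct.tmul_smul,
    TensorProduct.tmul_smul, map_sub, map_smul, map_smul] at e2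
  set r := n - min n N
  set t := m - min m N
  set X := l (σ (intGL p _ k * diagPow p n) v ⊗ₜ σ' (intGL p _ k' * diagPow p m) v')
  set Z := l (σ (intGL p _ k * diagPow p (min n N)) v ⊗ₜ σ' (intGL p _ k' * diagPow p m) v')
  have hZ : (p : ℝ) ^ t * ‖Z‖ ≤ (t + 1) * R ^ t * ((1 + R⁻¹) * C₀) := by
    have := congrArg norm e2
    rw [norm_mul, norm_pow, Complex.norm_natCast] at this
    rw [this]
    refine (norm_sub_le _ _).trans ?_
    rw [norm_smul, norm_smul]
    calc _ ≤ (t + 1) * R ^ t * C₀ + (t + 1) * R ^ t * R⁻¹ * C₀ := by gcongr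
      _ = _ := by ring
  have hX : (p : ℝ) ^ r * ‖X‖ = ‖c‖ ^ r * ‖Z‖ := by
    have := congrArg norm e1
    simpa using this
  have hX' : ‖X‖ = (‖c‖ / p) ^ r * ‖Z‖ := by
    rw [div_pow]; field_simp; linarith
  have hZ' : ‖Z‖ ≤ (t + 1) * (R / p) ^ t * ((1 + R⁻¹) * C₀) := by
    rw [div_pow]
    calc ‖Z‖ = ((p : ℝ) ^ t)⁻¹ * ((p : ℝ) ^ t * ‖Z‖) := by field_simp
      _ ≤ ((p : ℝ) ^ t)⁻¹ * ((t + 1) * R ^ t * ((1 + R⁻¹) * C₀)) := by gcongr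
      _ = _ := by ring
  have ht : (t : ℝ) ≤ m := by exact_mod_cast Nat.sub_le _ _
  calc ‖X‖ ≤ (‖c‖ / p) ^ r * ((t + 1) * (R / p) ^ t * ((1 + R⁻¹) * C₀)) := by rw [hX']; gcongr
    _ ≤ (max 1 (‖c‖ / p)⁻¹ ^ N * (‖c‖ / p) ^ n) *
        ((m + 1) * (max 1 (R / p)⁻¹ ^ N * (R / p) ^ m) * ((1 + R⁻¹) * C₀)) := by
      gcongr
      · exact hpowsub _ (by positivity) n
      · exact hpowsub _ (by positivity) m
    _ = _ := by ring

lemma mem_mirahoric_fin_two {g : GL (Fin 2) ℚ_[p]} (h : g ∈ maxCompact p (Fin 2))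
    (h0 : ‖g.val 1 0‖ < 1) (h1 : ‖g.val 1 1 - 1‖ < 1) : g ∈ mirahoric p (1 : Fin 2) 1 := by
  refine mem_mirahoric_one.2 ⟨h, ?_⟩
  rw [Fin.forall_fin_two]
  exact ⟨by simpa using h0, by simpa using h1⟩

/-- By the Bruhat decomposition of `GL₂(𝔽_p)`, every `k ∈ GL₂(ℤ_p)` is a product of an upper
unipotent element, possibly the permutation matrix, a unit scalar and a mirahoric element. -/
lemma exists_bruhat {k : GL (Fin 2) ℚ_[p]} (hk : k ∈ maxCompact p (Fin 2)) :
    ∃ x : ℚ_[p], ‖x‖ ≤ 1 ∧ ∃ u : ℚ_[p]ˣ, ‖(u : ℚ_[p])‖ = 1 ∧ ∃ m ∈ mirahoric p (1 : Fin 2) 1,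
      k = borel2 1 1 x * (borel2 u u 0 * m) ∨
        k = borel2 1 1 x * (swap2 p * (borel2 u u 0 * m)) := by
  have hdet := norm_det_of_mem hk
  have hle := entryLE_of_mem hk
  rw [det_fin_two] at hdet
  set a := k.val 0 0 with ha
  set b := k.val 0 1 with hb
  set c := k.val 1 0 with hc
  set d := k.val 1 1 with hd
  have ha1 : ‖a‖ ≤ 1 := hle _ _
  have hb1 : ‖b‖ ≤ 1 := hle _ _
  have hc1 : ‖c‖ ≤ 1 := hle _ _
  have hd1 : ‖d‖ ≤ 1 := hle _ _
  have hkeq : k.val = !![a, b; c, d] := by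
    ext i j; fin_cases i <;> fin_cases j <;> simp [ha, hb, hc, hd]
  have hdet0 : a * d - b * c ≠ 0 := fun h => by simp [h] at hdet
  rcases lt_or_eq_of_le hc1 with hclt | hceq
  · have hdn : ‖d‖ = 1 := by
      refine le_antisymm hd1 (le_of_not_gt fun hlt => ?_)
      have : ‖a * d - b * c‖ < 1 := by
        refine (padic_norm_sub_le_max _ _).trans_lt (max_lt ?_ ?_)
        · rw [norm_mul]; exact (mul_le_of_le_one_left (norm_nonneg _) ha1).trans_lt hlt
        · rw [norm_mul]; exact (mul_le_of_le_one_left (norm_nonneg _) hb1).trans_lt hclt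
      exact this.ne hdet
    have hd0 : d ≠ 0 := fun h => by simp [h] at hdn
    have hle' : EntryLE 1 !![(a * d - b * c) / d ^ 2, 0; c / d, 1] :=
      entryLE_fin_two (by simp [hdet, hdn]) (by simp) (by simp [hdn, hc1]) (by simp)
    obtain ⟨m, hm, hm'⟩ := exists_mem_maxCompact hle' (by simp [det_fin_two, hdet, hdn])
    refine ⟨b / d, by simpa [hdn] using hb1, Units.mk0 d hd0, hdn, m,
      mem_mirahoric_fin_two hm (by simpa [hm', hdn] using hclt) (by simp [hm']), Or.inl ?_⟩
    refine Units.ext ?_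
    rw [Units.val_mul, Units.val_mul, borel2_val, borel2_val, hm', hkeq]
    ext i j
    fin_cases i <;> fin_cases j <;> simp <;> field_simp
    ring
  · have hc0 : c ≠ 0 := fun h => by simp [h] at hceq
    set t : ℚ_[p] := -(a * d - b * c) / c with ht
    have htn : ‖t‖ = 1 := by rw [ht, norm_div, norm_neg, hdet, hceq, div_one]
    have ht0 : t ≠ 0 := fun h => by simp [h] at htn
    have hle' : EntryLE 1 !![c / t, d / t; 0, 1] :=
      entryLE_fin_two (by simp [hceq, htn]) (by simp [hd1, htn]) (by simp) (by simp)
    obtain ⟨m, hm, hm'⟩ := exists_mem_maxCompact hle' (by simp [det_fin_two, hceq, htn])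
    refine ⟨a / c, by simpa [hceq] using ha1, Units.mk0 t ht0, htn, m,
      mem_mirahoric_fin_two hm (by simp [hm']) (by simp [hm']), Or.inr ?_⟩
    refine Units.ext ?_
    rw [Units.val_mul, Units.val_mul, Units.val_mul, borel2_val, borel2_val, hm', hkeq, swap2_val]
    have e1 : t * (c / t) = c := by field_simp
    have e2 : t * (d / t) = d := by field_simp
    have e3 : t + a / c * d = b := by rw [ht]; field_simp; ring
    ext i j
    fin_cases i <;> fin_cases j <;> simp [e1, e2, e3, hc0]

/-- The orbits of `GL₂(ℤ_p)` on the translates of an Iwahori eigenvector are represented by the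
`diag(pⁿ, 1) v`. -/
lemma IsIwahoriEigenvector.diagPow_mul {v : V} {c ε : ℂ} (hv : IsIwahoriEigenvector σ v c ε)
    (hε : ε ≠ 0) (n : ℕ) {k : GL (Fin 2) ℚ_[p]} (hk : k ∈ maxCompact p (Fin 2)) :
    ∃ k' ∈ maxCompact p (Fin 2), σ (diagPow p n * k) v = σ (k' * diagPow p n) v ∨
      σ (diagPow p n * k) v = ε⁻¹ • σ (k' * diagPow p (n + 1)) v := by
  obtain ⟨x, hx, u, hu, m, hm, h⟩ := exists_bruhat hk
  have hpx : ‖(p : ℚ_[p]) ^ n * x‖ ≤ 1 := by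
    rw [norm_mul, norm_pow]
    exact mul_le_one₀ (pow_le_one₀ (norm_nonneg _) (Padic.norm_p_lt_one).le) (norm_nonneg _) hx
  have hswap : σ (swap2 p) v = ε⁻¹ • σ (diagPow p 1) v := by
    rw [diagPow, pow_one, ← swap2_mul_atkinLehner, rep_mul_apply, hv.atkinLehner, map_smul,
      smul_smul, inv_mul_cancel₀ hε, one_smul]
  refine ⟨borel2 1 1 ((p : ℚ_[p]) ^ n * x), borel2_mem_maxCompact (by simp) (by simp) hpx, ?_⟩
  rcases h with rfl | rfl
  · left
    rw [← mul_assoc, diagPow_mul_borel2, rep_mul_apply, rep_mul_apply σ (borel2 u u 0),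
      hv.mirahoric m hm, hv.unit_scalar u hu]
  · right
    rw [← mul_assoc, diagPow_mul_borel2, rep_mul_apply, rep_mul_apply σ (swap2 p),
      rep_mul_apply σ (borel2 u u 0), hv.mirahoric m hm, hv.unit_scalar u hu, hswap, map_smul,
      ← rep_mul_apply, mul_assoc, diagPow_mul_diagPow]

lemma scalar_zpow_apply {v : V} {ω : ℂ} (h0 : ω ≠ 0)
    (h : σ (borel2 (unif p) (unif p) 0) v = ω • v) (n : ℕ) :
    σ (borel2 (unif p ^ n) (unif p ^ n) 0) v = ω ^ n • v ∧
      σ (borel2 ((unif p)⁻¹ ^ n) ((unif p)⁻¹ ^ n) 0) v = (ω ^ n)⁻¹ • v := by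
  have key : ∀ n : ℕ, σ (borel2 (unif p ^ n) (unif p ^ n) 0) v = ω ^ n • v := by
    intro n
    induction n with
    | zero => simp [borel2_one]
    | succ n ih =>
      have : borel2 (unif p ^ (n + 1)) (unif p ^ (n + 1)) 0 =
          borel2 (unif p ^ n) (unif p ^ n) 0 * borel2 (unif p) (unif p) 0 := by
        rw [borel2_mul]; simp [pow_succ]
      rw [this, rep_mul_apply, h, map_smul, ih, smul_smul, pow_succ']
  refine ⟨key n, ?_⟩
  have h1 : borel2 ((unif p)⁻¹ ^ n) ((unif p)⁻¹ ^ n) 0 * borel2 (unif p ^ n) (unif p ^ n) 0 = 1 := by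
    rw [borel2_mul, ← borel2_one]; simp
  have h2 := rep_mul_apply σ (borel2 ((unif p)⁻¹ ^ n) ((unif p)⁻¹ ^ n) 0)
    (borel2 (unif p ^ n) (unif p ^ n) 0) v
  rw [h1, key n, map_smul] at h2
  have h3 : v = ω ^ n • σ (borel2 ((unif p)⁻¹ ^ n) ((unif p)⁻¹ ^ n) 0) v := by simpa using h2
  rw [eq_inv_smul_iff₀ (pow_ne_zero n h0), ← h3]

/-- Bound for the coefficients `l(σ(k₁ diag(pⁱ, pʲ) k₂) v ⊗ σ'(k₃ diag(p⁻ⁱ, p⁻ʲ) k₄) v')`, in terms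
of `n = i - j` and `j`. -/
lemma exists_bound_coefficient {v : V} {c ε : ℂ} (hv : IsIwahoriEigenvector σ v c ε) (hc : c ≠ 0)
    (hε : ε ≠ 0) {v' : W} {ω τ₁ τ₂ : ℂ} (hv' : IsSphericalEigenvector σ' v' ω τ₁ τ₂) (hω : ω ≠ 0)
    {R : ℝ} (hR : 0 < R) (h₁ : ‖τ₁‖ ≤ R) (h₂ : ‖τ₂‖ ≤ R) {l : V ⊗[ℂ] W →ₗ[ℂ] ℂ}
    (hl : IsSmoothFunctional σ σ' l) :
    ∃ C, 0 ≤ C ∧ ∀ n j : ℕ, ∀ k₁ ∈ maxCompact p (Fin 2), ∀ k₂ ∈ maxCompact p (Fin 2),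
      ∀ k₃ ∈ maxCompact p (Fin 2), ∀ k₄ ∈ maxCompact p (Fin 2),
      ‖l (σ (k₁ * borel2 (unif p ^ (n + j)) (unif p ^ j) 0 * k₂) v ⊗ₜ
          σ' (k₃ * borel2 ((unif p)⁻¹ ^ (n + j)) ((unif p)⁻¹ ^ j) 0 * k₄) v')‖ ≤
        C * ((n + 1) * (‖c‖ * R / (p ^ 2 * ‖ω‖)) ^ n * (‖c‖ ^ 2 / ‖ω‖) ^ j) := by
  obtain ⟨C, hC, hbound⟩ := exists_bound_diagPow hv hc hv' hR h₁ h₂ hl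
  have hp0 := prime_pos_real p
  have hc0 : 0 < ‖c‖ := norm_pos_iff.2 hc
  have hω0 : 0 < ‖ω‖ := norm_pos_iff.2 hω
  refine ⟨C * max 1 (‖ε‖⁻¹ * (‖c‖ / p)), by positivity, ?_⟩
  intro n j k₁ hk₁ k₂ hk₂ k₃ hk₃ k₄ hk₄
  have e1 : σ (k₁ * borel2 (unif p ^ (n + j)) (unif p ^ j) 0 * k₂) v =
      c ^ (2 * j) • σ k₁ (σ (diagPow p n * k₂) v) := by
    have : k₁ * borel2 (unif p ^ (n + j)) (unif p ^ j) 0 * k₂ =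
        k₁ * (diagPow p n * k₂) * borel2 (unif p ^ j) (unif p ^ j) 0 := by
      have hcomm : borel2 (unif p ^ j) (unif p ^ j) 0 * k₂ =
          k₂ * borel2 (unif p ^ j) (unif p ^ j) 0 := by
        ext a b
        simp only [GeneralLinearGroup.coe_mul, borel2_val]
        fin_cases a <;> fin_cases b <;> simp [Matrix.mul_apply, Fin.sum_univ_two, mul_comm]
      have hd : borel2 (unif p ^ (n + j)) (unif p ^ j) 0 =
          diagPow p n * borel2 (unif p ^ j) (unif p ^ j) 0 := by
        rw [diagPow, borel2_mul]; simp [pow_add]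
      rw [hd]
      simp only [mul_assoc, hcomm]
    rw [this, rep_mul_apply, (scalar_zpow_apply (pow_ne_zero 2 hc) hv.scalar j).1, map_smul,
      rep_mul_apply, pow_mul]
  have e2 : σ' (k₃ * borel2 ((unif p)⁻¹ ^ (n + j)) ((unif p)⁻¹ ^ j) 0 * k₄) v' =
      (ω ^ (n + j))⁻¹ • σ' (k₃ * swap2 p * diagPow p n) v' := by
    have : borel2 ((unif p)⁻¹ ^ (n + j)) ((unif p)⁻¹ ^ j) 0 = swap2 p * diagPow p n * swap2 p *
        borel2 ((unif p)⁻¹ ^ (n + j)) ((unif p)⁻¹ ^ (n + j)) 0 := by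
      rw [diagPow, swap2_mul_diag_mul_swap2, borel2_mul]
      congr 1
      · simp
      · simp [pow_add]
      · simp
    rw [rep_mul_apply, hv'.maxCompact k₄ hk₄, this, ← mul_assoc, rep_mul_apply,
      (scalar_zpow_apply hω hv'.scalar (n + j)).2, map_smul, ← mul_assoc, rep_mul_apply σ' _ (swap2 p),
      hv'.maxCompact _ swap2_mem, ← mul_assoc]
  rw [e1, e2, TensorProduct.tmul_smul, ← TensorProduct.smul_tmul', map_smul, map_smul, norm_smul,
    norm_smul, norm_inv, norm_pow, norm_pow]
  have hk3 := mul_mem hk₃ (swap2_mem (p := p))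
  have key : ‖l (σ k₁ (σ (diagPow p n * k₂) v) ⊗ₜ σ' (k₃ * swap2 p * diagPow p n) v')‖ ≤
      C * max 1 (‖ε‖⁻¹ * (‖c‖ / p)) * ((‖c‖ / p) ^ n * ((n + 1) * (R / p) ^ n)) := by
    obtain ⟨k', hk', h | h⟩ := hv.diagPow_mul hε n hk₂
    · rw [h, ← rep_mul_apply, ← mul_assoc]
      refine (hbound n n _ (mul_mem hk₁ hk') _ hk3).trans ?_
      gcongr
      exact le_mul_of_one_le_right hC (le_max_left _ _)
    · rw [h, map_smul, ← rep_mul_apply, ← mul_assoc, ← TensorProduct.smul_tmul', map_smul, norm_smul,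
        norm_inv]
      calc _ ≤ ‖ε‖⁻¹ * (C * ((‖c‖ / p) ^ (n + 1) * ((n + 1) * (R / p) ^ n))) := by
            gcongr
            exact hbound (n + 1) n _ (mul_mem hk₁ hk') _ hk3
        _ = C * (‖ε‖⁻¹ * (‖c‖ / p)) * ((‖c‖ / p) ^ n * ((n + 1) * (R / p) ^ n)) := by ring
        _ ≤ _ := by
          gcongr
          exact le_max_right _ _
  calc _ ≤ (‖ω‖ ^ (n + j))⁻¹ * (‖c‖ ^ (2 * j) *
        (C * max 1 (‖ε‖⁻¹ * (‖c‖ / p)) * ((‖c‖ / p) ^ n * ((n + 1) * (R / p) ^ n)))) := by gcongr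
    _ = _ := by
      rw [pow_mul, pow_add, div_pow, div_pow, div_pow, div_pow, mul_pow, mul_pow]
      field_simp
      ring

end MatrixCoefficients

/-! ### Decompositions of `GL₄(ℚ_p)` and `GL₄(ℤ_p)` -/

section GLFour

variable {p : ℕ} [hp : Fact p.Prime]

lemma levi_val (A D : GL (Fin 2) ℚ_[p]) : (levi A D).val = fromBlocks A.val 0 0 D.val := rfl
lemma unip_val (X : Matrix (Fin 2) (Fin 2) ℚ_[p]) : (unip X).val = fromBlocks 1 X 0 1 := rfl
lemma weyl4_val : (weyl4 p).val = fromBlocks 0 1 1 0 := rfl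
lemma weyl4_inv : (weyl4 p)⁻¹ = weyl4 p := rfl
lemma xi_val (j : ℕ) : (xi p j).val = fromBlocks 1 0 !![0, 0; 0, (p : ℚ_[p]) ^ j] 1 := rfl

/-- The element `(1 0; Z 1)` of the opposite unipotent radical. -/
def unipOpp (Z : Matrix (Fin 2) (Fin 2) ℚ_[p]) : GL4 p where
  val := fromBlocks 1 0 Z 1
  inv := fromBlocks 1 0 (-Z) 1
  val_inv := by simp [fromBlocks_multiply]
  inv_val := by simp [fromBlocks_multiply]

lemma unipOpp_val (Z : Matrix (Fin 2) (Fin 2) ℚ_[p]) : (unipOpp Z).val = fromBlocks 1 0 Z 1 := rfl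

lemma unip_mul_unip (X Y : Matrix (Fin 2) (Fin 2) ℚ_[p]) : unip X * unip Y = unip (X + Y) := by
  refine Units.ext ?_
  simp [unip_val, fromBlocks_multiply, add_comm]

lemma unip_zero : unip (0 : Matrix (Fin 2) (Fin 2) ℚ_[p]) = 1 := by
  refine Units.ext ?_
  simp [unip_val]

lemma levi_mul_levi (A D A' D' : GL (Fin 2) ℚ_[p]) :
    levi A D * levi A' D' = levi (A * A') (D * D') := by
  refine Units.ext ?_
  simp [levi_val, fromBlocks_multiply]

lemma levi_one : levi (1 : GL (Fin 2) ℚ_[p]) 1 = 1 := by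
  refine Units.ext ?_
  simp [levi_val]

lemma unip_mul_levi (Y : Matrix (Fin 2) (Fin 2) ℚ_[p]) (A D : GL (Fin 2) ℚ_[p]) :
    unip Y * levi A D = levi A D * unip (A⁻¹.val * Y * D.val) := by
  refine Units.ext ?_
  simp only [Units.val_mul, levi_val, unip_val, fromBlocks_multiply, ← mul_assoc]
  simp

lemma weyl4_mul_levi (A D : GL (Fin 2) ℚ_[p]) :
    (weyl4 p)⁻¹ * levi A D = levi D A * (weyl4 p)⁻¹ := by
  refine Units.ext ?_
  simp [weyl4_inv, weyl4_val, levi_val, fromBlocks_multiply]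

lemma weyl4_mul_unip (y : GL (Fin 2) ℚ_[p]) :
    (weyl4 p)⁻¹ * unip y.val = levi (-y⁻¹) y * unip (-y.val) * unipOpp (y⁻¹).val := by
  refine Units.ext ?_
  simp only [Units.val_mul, levi_val, unip_val, unipOpp_val, weyl4_inv, weyl4_val,
    fromBlocks_multiply, Units.val_neg, neg_mul_neg, Units.inv_mul]
  simp

lemma entryLE_fromBlocks {r : ℝ} {A B C D : Matrix (Fin 2) (Fin 2) ℚ_[p]} (hA : EntryLE r A)
    (hB : EntryLE r B) (hC : EntryLE r C) (hD : EntryLE r D) : EntryLE r (fromBlocks A B C D) := by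
  rintro (i | i) (j | j)
  exacts [hA i j, hB i j, hC i j, hD i j]

lemma entryLE_zero {ι κ : Type} : EntryLE 1 (0 : Matrix ι κ ℚ_[p]) := fun i j => by simp

lemma entryLE_one {ι : Type} [DecidableEq ι] : EntryLE 1 (1 : Matrix ι ι ℚ_[p]) := fun i j => by
  rw [Matrix.one_apply]; split_ifs <;> simp

lemma EntryLE.neg {ι κ : Type} {r : ℝ} {A : Matrix ι κ ℚ_[p]} (hA : EntryLE r A) :
    EntryLE r (-A) := fun i j => by
  rw [Matrix.neg_apply, norm_neg]; exact hA i j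

lemma unip_mem {X : Matrix (Fin 2) (Fin 2) ℚ_[p]} (hX : EntryLE 1 X) :
    unip X ∈ maxCompact p (Fin 2 ⊕ Fin 2) :=
  mem_maxCompact_iff.2 ⟨entryLE_fromBlocks entryLE_one hX entryLE_zero entryLE_one,
    entryLE_fromBlocks entryLE_one hX.neg entryLE_zero entryLE_one⟩

lemma unipOpp_mem {X : Matrix (Fin 2) (Fin 2) ℚ_[p]} (hX : EntryLE 1 X) :
    unipOpp X ∈ maxCompact p (Fin 2 ⊕ Fin 2) :=
  mem_maxCompact_iff.2 ⟨entryLE_fromBlocks entryLE_one entryLE_zero hX entryLE_one,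
    entryLE_fromBlocks entryLE_one entryLE_zero hX.neg entryLE_one⟩

lemma levi_mem {A D : GL (Fin 2) ℚ_[p]} (hA : A ∈ maxCompact p (Fin 2))
    (hD : D ∈ maxCompact p (Fin 2)) : levi A D ∈ maxCompact p (Fin 2 ⊕ Fin 2) :=
  mem_maxCompact_iff.2
    ⟨entryLE_fromBlocks (entryLE_of_mem hA) entryLE_zero entryLE_zero (entryLE_of_mem hD),
    entryLE_fromBlocks (entryLE_of_mem (inv_mem hA)) entryLE_zero entryLE_zero
      (entryLE_of_mem (inv_mem hD))⟩

lemma xi_eq (j : ℕ) : xi p j = unipOpp !![0, 0; 0, (p : ℚ_[p]) ^ j] := rfl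

lemma xi_mem (j : ℕ) : xi p j ∈ maxCompact p (Fin 2 ⊕ Fin 2) := by
  rw [xi_eq]
  refine unipOpp_mem (entryLE_fin_two (by simp) (by simp) (by simp) ?_)
  rw [norm_pow]
  exact pow_le_one₀ (norm_nonneg _) Padic.norm_p_lt_one.le

lemma neg_mem_maxCompact {A : GL (Fin 2) ℚ_[p]} (hA : A ∈ maxCompact p (Fin 2)) :
    -A ∈ maxCompact p (Fin 2) := by
  rw [mem_maxCompact_iff] at hA ⊢
  exact ⟨hA.1.neg, by rw [inv_neg]; exact hA.2.neg⟩

/-- A permutation matrix, acting on the right by `(g P) i j = g i (π j)`. -/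
def permGL (π : Equiv.Perm (Fin 2 ⊕ Fin 2)) : GL4 p where
  val := (1 : Matrix _ _ ℚ_[p]).submatrix id π
  inv := (1 : Matrix _ _ ℚ_[p]).submatrix id π.symm
  val_inv := by
    ext i j
    simp [Matrix.mul_apply, Matrix.one_apply]
  inv_val := by
    ext i j
    simp [Matrix.mul_apply, Matrix.one_apply]

lemma permGL_mem (π : Equiv.Perm (Fin 2 ⊕ Fin 2)) :
    permGL π ∈ maxCompact p (Fin 2 ⊕ Fin 2) :=
  mem_maxCompact_iff.2 ⟨fun _ _ => entryLE_one _ _, fun _ _ => entryLE_one _ _⟩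

lemma mul_permGL_apply (g : GL4 p) (π : Equiv.Perm (Fin 2 ⊕ Fin 2)) (i j : Fin 2 ⊕ Fin 2) :
    (g * permGL π).val i j = g.val i (π j) := by
  rw [Units.val_mul, Matrix.mul_apply]
  simp [permGL, Matrix.one_apply]

/-- The last two rows of an invertible `4 × 4` matrix have a nonzero `2 × 2` minor. -/
lemma exists_minor_ne_zero (g : GL4 p) : ∃ π : Equiv.Perm (Fin 2 ⊕ Fin 2),
    (g * permGL π).val.toBlocks₂₂.det ≠ 0 := by
  by_contra! h
  have hminor : ∀ a b, g.val (Sum.inr 0) a * g.val (Sum.inr 1) b =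
      g.val (Sum.inr 0) b * g.val (Sum.inr 1) a := by
    intro a b
    rcases eq_or_ne a b with rfl | hab
    · rfl
    obtain ⟨π, h0, h1⟩ : ∃ π : Equiv.Perm (Fin 2 ⊕ Fin 2), π (Sum.inr 0) = a ∧ π (Sum.inr 1) = b := by
      revert a b
      decide
    have := h π
    rw [det_fin_two] at this
    simp only [toBlocks₂₂, of_apply, mul_permGL_apply, h0, h1] at this
    exact sub_eq_zero.1 this
  -- otherwise the last two rows would be proportional
  have hinj : ∀ u : Fin 2 ⊕ Fin 2 → ℚ_[p], u ᵥ* g.val = 0 → u = 0 := by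
    intro u hu
    have := congrArg (· ᵥ* (g⁻¹).val) hu
    simpa [Matrix.vecMul_vecMul, ← Units.val_mul] using this
  obtain ⟨c, hc⟩ : ∃ c, g.val (Sum.inr 0) c ≠ 0 := by
    by_contra! h0
    have := hinj (Pi.single (Sum.inr 0) 1) (by ext j; simp [h0 j])
    simpa using congrFun this (Sum.inr 0)
  have := hinj (Pi.single (Sum.inr 1) (g.val (Sum.inr 0) c) -
    Pi.single (Sum.inr 0) (g.val (Sum.inr 1) c)) (by
      ext j
      rw [Matrix.sub_vecMul]
      simp only [Pi.sub_apply, Matrix.single_vecMul, Pi.zero_apply, Pi.smul_apply, smul_eq_mul,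
        Matrix.row_apply]
      have := hminor c j
      linear_combination this)
  have := congrFun this (Sum.inr 1)
  simp at this
  exact hc this

/-- If the lower blocks of `h` are `(D Z, D)` with `D` invertible, then `h ∈ P (1 0; Z 1)`. -/
lemma exists_eq_levi_mul_unip_mul_unipOpp (h : GL4 p) {C D Z : Matrix (Fin 2) (Fin 2) ℚ_[p]}
    (hC : h.val.toBlocks₂₁ = C) (hD : h.val.toBlocks₂₂ = D) (hdet : D.det ≠ 0) (hZ : C = D * Z) :
    ∃ (A' D' : GL (Fin 2) ℚ_[p]) (X : Matrix (Fin 2) (Fin 2) ℚ_[p]),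
      h = levi A' D' * unip X * unipOpp Z := by
  obtain ⟨q, hq⟩ : ∃ q : GL4 p, q = h * unipOpp (-Z) := ⟨_, rfl⟩
  obtain ⟨A, hA⟩ : ∃ A, A = q.val.toBlocks₁₁ := ⟨_, rfl⟩
  obtain ⟨B, hB⟩ : ∃ B, B = q.val.toBlocks₁₂ := ⟨_, rfl⟩
  have eh : h.val = fromBlocks h.val.toBlocks₁₁ h.val.toBlocks₁₂ C D := by
    rw [← hC, ← hD]; exact (fromBlocks_toBlocks _).symm
  have e : q.val = fromBlocks h.val.toBlocks₁₁ h.val.toBlocks₁₂ C D *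
      fromBlocks 1 0 (-Z) 1 := by rw [← eh, hq]; rfl
  have hqval : q.val = fromBlocks A B 0 D := by
    rw [← fromBlocks_toBlocks q.val, ← hA, ← hB]
    congr 1
    · rw [e, fromBlocks_multiply, toBlocks_fromBlocks₂₁, mul_one, hZ, mul_neg, add_neg_cancel]
    · rw [e, fromBlocks_multiply, toBlocks_fromBlocks₂₂, mul_zero, zero_add, mul_one]
  have hAdet : A.det ≠ 0 := by
    have h1 : q.val.det ≠ 0 := (q.isUnit.map detMonoidHom).ne_zero
    rw [hqval, det_fromBlocks_zero₂₁] at h1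
    exact left_ne_zero_of_mul h1
  obtain ⟨A', hA'⟩ : ∃ A' : GL (Fin 2) ℚ_[p], A'.val = A :=
    ⟨GeneralLinearGroup.mkOfDetNeZero A hAdet, rfl⟩
  obtain ⟨D', hD'⟩ : ∃ D' : GL (Fin 2) ℚ_[p], D'.val = D :=
    ⟨GeneralLinearGroup.mkOfDetNeZero D hdet, rfl⟩
  refine ⟨A', D', A'⁻¹.val * B, ?_⟩
  have e2 : q = levi A' D' * unip (A'⁻¹.val * B) := by
    refine Units.ext ?_
    rw [hqval, Units.val_mul, levi_val, unip_val, fromBlocks_multiply, ← mul_assoc, Units.mul_inv]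
    simp [hA', hD']
  have e3 : unipOpp (-Z) = (unipOpp Z)⁻¹ := Units.ext rfl
  rw [← e2, hq, e3, inv_mul_cancel_right]

/-- Iwasawa decomposition of `GL₄(ℚ_p)` with respect to `P`. The maximal minor of the last two rows
is moved to the lower right corner by a permutation of the columns; by Cramer's rule these rows are
then those of an element of `GL₂(ℚ_p)` times an integral matrix `(Z 1)`. -/
lemma exists_iwasawa (g : GL4 p) : ∃ (A D : GL (Fin 2) ℚ_[p]) (X : Matrix (Fin 2) (Fin 2) ℚ_[p]),
    ∃ κ ∈ maxCompact p (Fin 2 ⊕ Fin 2), g = levi A D * unip X * κ := by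
  obtain ⟨π, hπ⟩ := Finite.exists_max fun π : Equiv.Perm (Fin 2 ⊕ Fin 2) =>
    ‖(g * permGL π).val.toBlocks₂₂.det‖
  obtain ⟨π₀, hπ₀⟩ := exists_minor_ne_zero g
  have hdet := norm_pos_iff.1 ((norm_pos_iff.2 hπ₀).trans_le (hπ π₀))
  obtain ⟨C, hC⟩ : ∃ C, (g * permGL π).val.toBlocks₂₁ = C := ⟨_, rfl⟩
  obtain ⟨D, hD⟩ : ∃ D, (g * permGL π).val.toBlocks₂₂ = D := ⟨_, rfl⟩
  rw [hD] at hdet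
  have hZ1 : EntryLE 1 (D⁻¹ * C) := by
    intro i j
    have h1 : (D⁻¹ * C) i j = (D.updateCol i fun a => C a j).det / D.det := by
      rw [← Matrix.cramer_apply, Matrix.cramer_eq_adjugate_mulVec, Matrix.inv_def,
        Ring.inverse_eq_inv', Matrix.smul_mul, Matrix.smul_apply, smul_eq_mul, div_eq_inv_mul]
      rfl
    have h2 : (D.updateCol i fun a => C a j) =
        (g * permGL (π * Equiv.swap (Sum.inl j) (Sum.inr i))).val.toBlocks₂₂ := by
      ext a b
      rw [Matrix.updateCol_apply, ← hC, ← hD]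
      simp only [toBlocks₂₁, toBlocks₂₂, of_apply, mul_permGL_apply, Equiv.Perm.mul_apply]
      split_ifs with hb
      · rw [hb, Equiv.swap_apply_right]
      · rw [Equiv.swap_apply_of_ne_of_ne (by simp) (by simpa using hb)]
    rw [h1, norm_div, h2, ← hD]
    exact div_le_one_of_le₀ (hπ _) (norm_nonneg _)
  obtain ⟨A', D', X, h⟩ := exists_eq_levi_mul_unip_mul_unipOpp _ hC hD hdet (Z := D⁻¹ * C)
    (by rw [← mul_assoc, Matrix.mul_nonsing_inv _ (isUnit_iff_ne_zero.2 hdet), one_mul])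
  exact ⟨A', D', X, unipOpp (D⁻¹ * C) * (permGL π)⁻¹,
    mul_mem (unipOpp_mem hZ1) (inv_mem (permGL_mem π)), by rw [← mul_assoc, ← h]; group⟩

/-- A primitive row vector is carried to `(0, 1)` by an element of `GL₂(ℤ_p)`. -/
lemma exists_vecMul_eq {x : Fin 2 → ℚ_[p]} (hx : ∀ i, ‖x i‖ ≤ 1) (h : ∃ i, ‖x i‖ = 1) :
    ∃ A ∈ maxCompact p (Fin 2), x ᵥ* A.val = ![0, 1] := by
  obtain ⟨i, hi⟩ := h
  have h0 : x i ≠ 0 := fun h => by simp [h] at hi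
  fin_cases i
  · replace hi : ‖x 0‖ = 1 := hi
    replace h0 : x 0 ≠ 0 := h0
    obtain ⟨A, hA, hA'⟩ := exists_mem_maxCompact
      (A := !![-(x 1 / x 0), 1 / x 0; (1 : ℚ_[p]), 0])
      (entryLE_fin_two (by simp [hi, hx 1]) (by simp [hi]) (by simp) (by simp))
      (by simp [det_fin_two, hi])
    refine ⟨A, hA, ?_⟩
    rw [hA']
    ext j
    fin_cases j <;> simp [Matrix.vecMul, dotProduct, Fin.sum_univ_two] <;> field_simp
    ring
  · replace hi : ‖x 1‖ = 1 := hi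
    replace h0 : x 1 ≠ 0 := h0
    obtain ⟨A, hA, hA'⟩ := exists_mem_maxCompact
      (A := !![(1 : ℚ_[p]), 0; -(x 0 / x 1), 1 / x 1])
      (entryLE_fin_two (by simp) (by simp) (by simp [hi, hx 0]) (by simp [hi]))
      (by simp [det_fin_two, hi])
    refine ⟨A, hA, ?_⟩
    rw [hA']
    ext j
    fin_cases j <;> simp [Matrix.vecMul, dotProduct, Fin.sum_univ_two] <;> field_simp
    ring

/-- The mirahoric subgroup of `GL₄(ℚ_p)`, through the last row. -/
lemma mem_mirahoric_of_row {κ : GL4 p} (hκ : κ ∈ maxCompact p (Fin 2 ⊕ Fin 2))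
    (h0 : ∀ i, ‖κ.val (Sum.inr 1) (Sum.inl i)‖ < 1)
    (h1 : ∀ i, ‖κ.val (Sum.inr 1) (Sum.inr i) - (1 : Matrix (Fin 2) (Fin 2) ℚ_[p]) 1 i‖ < 1) :
    κ ∈ mirahoric p (Sum.inr 1 : Fin 2 ⊕ Fin 2) 1 := by
  refine mem_mirahoric_one.2 ⟨hκ, ?_⟩
  rintro (i | i)
  · simpa using h0 i
  · simpa [Matrix.one_apply] using h1 i

lemma levi_mem_mirahoric {A D : GL (Fin 2) ℚ_[p]} (hA : A ∈ maxCompact p (Fin 2))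
    (hD : D ∈ mirahoric p (1 : Fin 2) 1) : levi A D ∈ mirahoric p (Sum.inr 1 : Fin 2 ⊕ Fin 2) 1 :=
  mem_mirahoric_of_row (levi_mem hA (maxCompact_of_mem_mirahoric hD)) (fun i => by simp [levi_val])
    (fun i => by simpa [levi_val] using (mem_mirahoric_one.1 hD).2 i)

lemma unip_mem_mirahoric {X : Matrix (Fin 2) (Fin 2) ℚ_[p]} (hX : EntryLE 1 X) :
    unip X ∈ mirahoric p (Sum.inr 1 : Fin 2 ⊕ Fin 2) 1 :=
  mem_mirahoric_of_row (unip_mem hX) (fun i => by simp [unip_val]) (fun i => by simp [unip_val])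

lemma xi_one_mem_mirahoric : xi p 1 ∈ mirahoric p (Sum.inr 1 : Fin 2 ⊕ Fin 2) 1 := by
  refine mem_mirahoric_of_row (xi_mem 1) (fun i => ?_) (fun i => by simp [xi_val])
  fin_cases i
  · simp [xi_val]
  · simpa [xi_val] using inv_lt_one_of_one_lt₀ (one_lt_prime_real p)

/-- The cell `P(ℤ_p) K_p` of `GL₄(ℤ_p)`, on which the first two entries of the last row of `κ⁻¹` vanish
modulo `p`. -/
lemma exists_eq_levi_mul {κ : GL4 p} (hκ : κ ∈ maxCompact p (Fin 2 ⊕ Fin 2))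
    (h : ∀ i, ‖κ⁻¹.val (Sum.inr 1) (Sum.inl i)‖ < 1) :
    ∃ D ∈ maxCompact p (Fin 2), ∃ κ' ∈ mirahoric p (Sum.inr 1 : Fin 2 ⊕ Fin 2) 1,
      κ = levi 1 D * κ' := by
  have hi := entryLE_of_mem (inv_mem hκ)
  obtain ⟨D, hD, hxD⟩ := exists_vecMul_eq (x := fun i => κ⁻¹.val (Sum.inr 1) (Sum.inr i))
    (fun i => hi _ _) (by
      -- otherwise the last row of `κ⁻¹` would vanish modulo `p`
      by_contra! hne
      have h1 := norm_vecMul_lt (x := fun j => κ⁻¹.val (Sum.inr 1) j)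
        (fun j => by
          rcases j with j | j
          · exact h j
          · exact lt_of_le_of_ne (hi _ _) (hne j)) (entryLE_of_mem hκ) (Sum.inr 1)
      have h2 : ((fun j => κ⁻¹.val (Sum.inr 1) j) ᵥ* κ.val) (Sum.inr 1) =
          (κ⁻¹.val * κ.val) (Sum.inr 1) (Sum.inr 1) := rfl
      rw [h2, Units.inv_mul] at h1
      simp at h1)
  refine ⟨D, hD, (κ⁻¹ * levi 1 D)⁻¹, inv_mem_mirahoric (mem_mirahoric_of_row
    (mul_mem (inv_mem hκ) (levi_mem (one_mem _) hD)) (fun i => ?_) fun i => ?_), by group⟩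
  · have : (κ⁻¹ * levi 1 D).val (Sum.inr 1) (Sum.inl i) = κ⁻¹.val (Sum.inr 1) (Sum.inl i) := by
      rw [Units.val_mul, Matrix.mul_apply, Fintype.sum_sum_type]
      simp [levi_val, Matrix.one_apply]
    rw [this]; exact h i
  · have : (κ⁻¹ * levi 1 D).val (Sum.inr 1) (Sum.inr i) =
        ((fun i => κ⁻¹.val (Sum.inr 1) (Sum.inr i)) ᵥ* D.val) i := by
      rw [Units.val_mul, Matrix.mul_apply, Fintype.sum_sum_type]
      simp [levi_val, Matrix.vecMul, dotProduct]
    rw [this, hxD]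
    revert i
    simp [Fin.forall_fin_two]

/-- The cell `P(ℤ_p) ξ⁽⁰⁾ K_p` of `GL₄(ℤ_p)`, the complement of `P(ℤ_p) K_p`. The last equation
determines `A` up to the stabilizer of `v` in `GL₂(ℤ_p)`. -/
lemma exists_eq_levi_mul_unip_mul_xi {κ : GL4 p} (hκ : κ ∈ maxCompact p (Fin 2 ⊕ Fin 2))
    (h : ∃ i, ‖κ⁻¹.val (Sum.inr 1) (Sum.inl i)‖ = 1) :
    ∃ A ∈ maxCompact p (Fin 2), ∃ X, EntryLE 1 X ∧
      ∃ κ' ∈ mirahoric p (Sum.inr 1 : Fin 2 ⊕ Fin 2) 1, κ = levi A 1 * unip X * xi p 0 * κ' ∧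
        (fun i => κ⁻¹.val (Sum.inr 1) (Sum.inl i)) ᵥ* A.val = ![0, -1] := by
  have hi := entryLE_of_mem (inv_mem hκ)
  obtain ⟨A₀, hA₀, hxA₀⟩ := exists_vecMul_eq (x := fun i => κ⁻¹.val (Sum.inr 1) (Sum.inl i))
    (fun i => hi _ _) h
  set A := -A₀ with hA'
  have hA : A ∈ maxCompact p (Fin 2) := neg_mem_maxCompact hA₀
  have hxA : (fun i => κ⁻¹.val (Sum.inr 1) (Sum.inl i)) ᵥ* A.val = ![0, -1] := by
    rw [hA', Units.val_neg, Matrix.vecMul_neg, hxA₀]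
    simp
  set y : Fin 2 → ℚ_[p] := fun i => κ⁻¹.val (Sum.inr 1) (Sum.inr i) with hy
  have hX : EntryLE 1 !![0, 0; y 0, y 1 - 1] := entryLE_fin_two (by simp) (by simp) (hi _ _)
    ((padic_norm_sub_le_max _ _).trans (max_le (hi _ _) (by simp)))
  set X := !![0, 0; y 0, y 1 - 1] with hX'
  set κ₁ := κ⁻¹ * levi A 1 * unip X * xi p 0 with hκ₁
  have hrow : ∀ j, κ₁.val (Sum.inr 1) j = (1 : Matrix (Fin 2 ⊕ Fin 2) _ ℚ_[p]) (Sum.inr 1) j := by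
    have h1 : ∀ i, (κ⁻¹ * levi A 1).val (Sum.inr 1) (Sum.inl i) = ![0, -1] i := by
      intro i
      rw [← hxA, Units.val_mul, Matrix.mul_apply, Fintype.sum_sum_type]
      simp [levi_val, Matrix.vecMul, dotProduct]
    have h2 : ∀ i, (κ⁻¹ * levi A 1).val (Sum.inr 1) (Sum.inr i) = y i := by
      intro i
      rw [Units.val_mul, Matrix.mul_apply, Fintype.sum_sum_type]
      simp [levi_val, Matrix.one_apply, hy]
    have h3 : ∀ i, (κ⁻¹ * levi A 1 * unip X).val (Sum.inr 1) (Sum.inl i) = ![0, -1] i := by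
      intro i
      rw [Units.val_mul, Matrix.mul_apply, Fintype.sum_sum_type]
      simp [unip_val, Matrix.one_apply, h1]
    have h4 : ∀ i, (κ⁻¹ * levi A 1 * unip X).val (Sum.inr 1) (Sum.inr i) = ![0, 1] i := by
      intro i
      rw [Units.val_mul, Matrix.mul_apply, Fintype.sum_sum_type]
      simp only [h1, h2, Fin.sum_univ_two, unip_val, fromBlocks_apply₁₂, fromBlocks_apply₂₂, hX']
      revert i
      simp [Fin.forall_fin_two]
    intro j
    rw [hκ₁, Units.val_mul, Matrix.mul_apply, Fintype.sum_sum_type]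
    simp only [h3, h4, Fin.sum_univ_two, xi_val]
    revert j
    simp [Sum.forall, Fin.forall_fin_two]
  have hκ₁m : κ₁ ∈ mirahoric p (Sum.inr 1 : Fin 2 ⊕ Fin 2) 1 :=
    mem_mirahoric_one.2 ⟨mul_mem (mul_mem (mul_mem (inv_mem hκ) (levi_mem hA (one_mem _)))
      (unip_mem hX)) (xi_mem 0), fun j => by rw [hrow]; simp⟩
  refine ⟨A, hA, X, hX, κ₁⁻¹, inv_mem_mirahoric hκ₁m, ?_, hxA⟩
  rw [hκ₁]
  group

end GLFour

/-! ### Reduction to the values at `1` and `ξ⁽⁰⁾` -/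

section InducedVectors

variable {p : ℕ} [hp : Fact p.Prime]
variable {V : Type*} [AddCommGroup V] [Module ℂ V] {σ : Representation ℂ (GL (Fin 2) ℚ_[p]) V}
variable {W : Type*} [AddCommGroup W] [Module ℂ W] {σ' : Representation ℂ (GL (Fin 2) ℚ_[p]) W}

/-- If `V` has no nonzero vector fixed by `GL₂(ℤ_p)`, neither has `V ⊗ W`, `GL₂(ℤ_p)` acting on the
first factor: take the coordinates with respect to a basis of `W`. -/
lemma tmul_eq_zero_of_fixed (h0 : ∀ x, (∀ k ∈ maxCompact p (Fin 2), σ k x = x) → x = 0)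
    {t : V ⊗[ℂ] W} (ht : ∀ k ∈ maxCompact p (Fin 2), TensorProduct.map (σ k) (σ' 1) t = t) :
    t = 0 := by
  classical
  let b := Module.Basis.ofVectorSpace ℂ W
  let E := TensorProduct.equivFinsuppOfBasisRight (M := V) b
  have hE : ∀ (k : GL (Fin 2) ℚ_[p]) (t : V ⊗[ℂ] W) i,
      E (TensorProduct.map (σ k) (σ' 1) t) i = σ k (E t i) := by
    intro k t i
    induction t with
    | zero => simp
    | add x y hx hy => rw [map_add, map_add, Finsupp.add_apply, hx, hy, map_add, Finsupp.add_apply, map_add]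
    | tmul x y => simp [E]
  refine E.map_eq_zero_iff.1 (Finsupp.ext fun i => h0 _ fun k hk => ?_)
  rw [← hE, ht k hk]

variable (σ σ') in
/-- `φ` is the function on `GL₄(ℚ_p)` with values in `σ ⊗ σ'`, smooth and `K_p`-invariant, with value
`v ⊗ v'` at `ξ⁽⁰⁾`, such that `φ(diag(A, D) u g) = (σ(A) ⊗ σ'(D)) φ(g)`; at `s = -2` the modulus of
`P` is cancelled by `|det A / det D|^{s/2}`. -/
structure IsNewInducedVector (v : V) (v' : W) (φ : GL4 p → V ⊗[ℂ] W) : Prop where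
  smooth : IsSmooth φ
  equivariant : ∀ A D X g, φ (levi A D * unip X * g) = TensorProduct.map (σ A) (σ' D) (φ g)
  invariant : ∀ k ∈ mirahoric p (Sum.inr 1 : Fin 2 ⊕ Fin 2) 1, ∀ g, φ (g * k) = φ g
  apply_xi : φ (xi p 0) = v ⊗ₜ v'

lemma IsMirahoricVector.isNewInducedVector {v : V} {v' : W} {φ : parabolicInduction σ σ' (-2)}
    (hφ : IsMirahoricVector 1 0 (v ⊗ₜ[ℂ] v') φ) : IsNewInducedVector σ σ' v v' φ.1 where
  smooth := φ.2.1
  equivariant A D X g := by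
    have h := φ.2.2 A D X g
    rwa [show (1 : ℂ) + (-2) / 2 = 0 by norm_num, Complex.cpow_zero, one_smul] at h
  invariant := hφ.invariant
  apply_xi := hφ.apply_xi

namespace IsNewInducedVector

variable {v : V} {v' : W} {φ : GL4 p → V ⊗[ℂ] W}

lemma levi_mul (hφ : IsNewInducedVector σ σ' v v' φ) (A D : GL (Fin 2) ℚ_[p]) (g : GL4 p) :
    φ (levi A D * g) = TensorProduct.map (σ A) (σ' D) (φ g) := by
  simpa [unip_zero] using hφ.equivariant A D 0 g

/-- The value at `1` is fixed by `GL₂(ℤ_p)` acting through `σ`. -/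
lemma apply_one (hφ : IsNewInducedVector σ σ' v v' φ)
    (h0 : ∀ x, (∀ k ∈ maxCompact p (Fin 2), σ k x = x) → x = 0) : φ 1 = 0 := by
  refine tmul_eq_zero_of_fixed (σ' := σ') h0 fun k hk => ?_
  rw [← hφ.levi_mul, mul_one, ← one_mul (levi k 1), hφ.invariant]
  exact levi_mem_mirahoric hk (mem_mirahoric_one.2 ⟨one_mem _, fun j => by simp⟩)

/-- The values of `φ` on `GL₄(ℤ_p)`: it is supported on `P(ℤ_p) ξ⁽⁰⁾ K_p`. -/
lemma apply_of_mem (hφ : IsNewInducedVector σ σ' v v' φ)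
    (h0 : ∀ x, (∀ k ∈ maxCompact p (Fin 2), σ k x = x) → x = 0) {κ : GL4 p}
    (hκ : κ ∈ maxCompact p (Fin 2 ⊕ Fin 2)) :
    ((∀ i, ‖κ⁻¹.val (Sum.inr 1) (Sum.inl i)‖ < 1) ∧ φ κ = 0) ∨
      ∃ A ∈ maxCompact p (Fin 2), φ κ = σ A v ⊗ₜ v' ∧
        (fun i => κ⁻¹.val (Sum.inr 1) (Sum.inl i)) ᵥ* A.val = ![0, -1] := by
  by_cases h : ∀ i, ‖κ⁻¹.val (Sum.inr 1) (Sum.inl i)‖ < 1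
  · obtain ⟨D, hD, κ', hκ', rfl⟩ := exists_eq_levi_mul hκ h
    refine Or.inl ⟨h, ?_⟩
    rw [hφ.levi_mul, ← one_mul κ', hφ.invariant κ' hκ', hφ.apply_one h0, map_zero]
  · push Not at h
    obtain ⟨i, hi⟩ := h
    obtain ⟨A, hA, X, hX, κ', hκ', h1, h2⟩ := exists_eq_levi_mul_unip_mul_xi hκ
      ⟨i, le_antisymm (entryLE_of_mem (inv_mem hκ) _ _) hi⟩
    refine Or.inr ⟨A, hA, ?_, h2⟩
    rw [h1, hφ.invariant κ' hκ', hφ.equivariant, hφ.apply_xi, TensorProduct.map_tmul, map_one]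
    rfl

end IsNewInducedVector

/-- The stabilizer of `ξ⁽⁰⁾ K_p` in `P` contains elements `diag(1, D) u` with `D ∈ GL₂(ℤ_p)`
arbitrary. -/
lemma conj_xi_mem_mirahoric {D : GL (Fin 2) ℚ_[p]} (hD : D ∈ maxCompact p (Fin 2)) :
    (xi p 0)⁻¹ * (levi 1 D * unip !![0, 0; D.val 1 0, D.val 1 1 - 1] * xi p 0) ∈
      mirahoric p (Sum.inr 1 : Fin 2 ⊕ Fin 2) 1 := by
  have hX : EntryLE 1 !![0, 0; D.val 1 0, D.val 1 1 - 1] :=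
    entryLE_fin_two (by simp) (by simp) (entryLE_of_mem hD _ _)
      ((padic_norm_sub_le_max _ _).trans (max_le (entryLE_of_mem hD _ _) (by simp)))
  refine mem_mirahoric_one.2 ⟨mul_mem (inv_mem (xi_mem 0)) (mul_mem (mul_mem
    (levi_mem (one_mem _) hD) (unip_mem hX)) (xi_mem 0)), fun j => ?_⟩
  have e : (xi p 0)⁻¹.val = fromBlocks 1 0 (-!![0, 0; 0, (p : ℚ_[p]) ^ 0]) 1 := rfl
  have : ((xi p 0)⁻¹ * (levi 1 D * unip !![0, 0; D.val 1 0, D.val 1 1 - 1] * xi p 0)).val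
      (Sum.inr 1) j = (1 : Matrix (Fin 2 ⊕ Fin 2) (Fin 2 ⊕ Fin 2) ℚ_[p]) (Sum.inr 1) j := by
    simp only [Units.val_mul, levi_val, unip_val, xi_val, e, fromBlocks_multiply]
    revert j
    simp [Sum.forall, Fin.forall_fin_two, Matrix.mul_apply, Fin.sum_univ_two,
      Matrix.one_apply, Matrix.vecMul, dotProduct]
    ring
  rw [this]
  simp

/-- In the induction from `σ' ⊗ σ` it is the value at `ξ⁽⁰⁾` that is fixed by `GL₂(ℤ_p)` acting through
`σ`. -/
lemma IsMirahoricVector.apply_xi_zero {s : ℂ} {n : ℕ} {t : W ⊗[ℂ] V}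
    (h0 : ∀ x, (∀ k ∈ maxCompact p (Fin 2), σ k x = x) → x = 0)
    {f : parabolicInduction σ' σ s} (hf : IsMirahoricVector 1 n t f) : f.1 (xi p 0) = 0 := by
  refine (TensorProduct.comm ℂ W V).map_eq_zero_iff.1 (tmul_eq_zero_of_fixed (σ' := σ') h0
    fun D hD => ?_)
  have hmem := conj_xi_mem_mirahoric hD
  have h1 := hf.invariant _ hmem (xi p 0)
  rw [mul_inv_cancel_left, f.2.2, norm_det_of_mem hD] at h1
  simp only [Units.val_one, det_one, norm_one, div_one, Complex.ofReal_one, Complex.one_cpow,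
    one_smul] at h1
  conv_rhs => rw [← h1]
  have h2 : ∀ t : W ⊗[ℂ] V, TensorProduct.map (σ D) (σ' 1) (TensorProduct.comm ℂ W V t) =
      TensorProduct.comm ℂ W V (TensorProduct.map (σ' 1) (σ D) t) := fun t => by
    induction t with
    | zero => simp
    | add x y hx hy => simp only [map_add, hx, hy]
    | tmul x y => simp
  exact h2 _

variable (σ σ') in
/-- The integral defining `T_st φ` at `g` converges to `t`, after pairing with smooth functionals. -/
def HasIntertwiningIntegral (φ : GL4 p → V ⊗[ℂ] W) (g : GL4 p) (t : V ⊗[ℂ] W) : Prop :=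
  ∀ l : V ⊗[ℂ] W →ₗ[ℂ] ℂ, IsSmoothFunctional σ σ' l →
    Integrable (fun x : Fin 2 × Fin 2 → ℚ_[p] =>
      l (φ ((weyl4 p)⁻¹ * unip (Matrix.of fun i j => x (i, j)) * g))) (unipMeasure p) ∧
    ∫ x : Fin 2 × Fin 2 → ℚ_[p],
        l (φ ((weyl4 p)⁻¹ * unip (Matrix.of fun i j => x (i, j)) * g)) ∂(unipMeasure p) = l t

lemma IsSmoothFunctional.comp_map {l : V ⊗[ℂ] W →ₗ[ℂ] ℂ} (hl : IsSmoothFunctional σ σ' l)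
    (A D : GL (Fin 2) ℚ_[p]) :
    IsSmoothFunctional σ σ' (l ∘ₗ TensorProduct.map (σ A) (σ' D)) := by
  obtain ⟨U, hU, h⟩ := hl
  have hopen : ∀ B : GL (Fin 2) ℚ_[p],
      IsOpen ((U.comap (MulAut.conj B).toMonoidHom : Subgroup _) : Set (GL (Fin 2) ℚ_[p])) := by
    intro B
    refine hU.preimage (f := fun u => B * u * B⁻¹) ?_
    fun_prop
  refine ⟨U.comap (MulAut.conj A).toMonoidHom ⊓ U.comap (MulAut.conj D).toMonoidHom, by
    simpa using (hopen A).inter (hopen D), fun A' hA' D' hD' x => ?_⟩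
  have h1 := h _ hA'.1 _ hD'.2 (TensorProduct.map (σ A) (σ' D) x)
  rw [LinearMap.comp_apply, LinearMap.comp_apply, ← h1]
  congr 1
  rw [← LinearMap.comp_apply, ← LinearMap.comp_apply, ← TensorProduct.map_comp,
    ← TensorProduct.map_comp]
  have h2 : ∀ A A' : GL (Fin 2) ℚ_[p], σ A ∘ₗ σ A' =
      σ ((MulAut.conj A).toMonoidHom A') ∘ₗ σ A := fun A A' => by
    simp [← Module.End.mul_eq_comp, ← map_mul]
  have h3 : ∀ A A' : GL (Fin 2) ℚ_[p], σ' A ∘ₗ σ' A' =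
      σ' ((MulAut.conj A).toMonoidHom A') ∘ₗ σ' A := fun A A' => by
    simp [← Module.End.mul_eq_comp, ← map_mul]
  rw [h2, h3]

lemma integrable_comp_mulMulEquiv {F : (Fin 2 × Fin 2 → ℚ_[p]) → ℂ}
    (hF : Integrable F (unipMeasure p)) (A D : GL (Fin 2) ℚ_[p]) :
    Integrable (fun x => F (mulMulEquiv A D x)) (unipMeasure p) ∧
      ∫ x, F (mulMulEquiv A D x) ∂(unipMeasure p) =
        ((mulMulChar A D : ℝ) : ℂ)⁻¹ * ∫ x, F x ∂(unipMeasure p) := by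
  have h1 : mulMulChar A D • (unipMeasure p).map (mulMulEquiv A D) = unipMeasure p :=
    addEquivAddHaarChar_smul_map (unipMeasure p) (mulMulEquiv A D)
  have hne : mulMulChar A D ≠ 0 := by
    intro h
    rw [h, zero_smul] at h1
    exact NeZero.ne (unipMeasure p) h1.symm
  have hmap : (unipMeasure p).map (mulMulEquiv A D) = (mulMulChar A D)⁻¹ • unipMeasure p := by
    conv_rhs => rw [← h1]
    rw [smul_smul, inv_mul_cancel₀ hne, one_smul]
  have hme : MeasurableEmbedding (mulMulEquiv A D) :=
    (mulMulEquiv A D).toHomeomorph.measurableEmbedding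
  constructor
  · refine (hme.integrable_map_iff (g := F)).1 ?_
    rw [hmap]
    exact hF.smul_measure_nnreal
  · rw [← hme.integral_map (g := F), hmap, integral_smul_nnreal_measure, NNReal.smul_def,
      Complex.real_smul]
    push_cast
    rfl

/-- The change of variables `Y ↦ A⁻¹ Y D + X` in the intertwining integral. -/
lemma IsNewInducedVector.integral_levi_mul {v : V} {v' : W} {φ : GL4 p → V ⊗[ℂ] W}
    (hφ : IsNewInducedVector σ σ' v v' φ) {g : GL4 p} (A D : GL (Fin 2) ℚ_[p])
    (X : Matrix (Fin 2) (Fin 2) ℚ_[p]) {l : V ⊗[ℂ] W →ₗ[ℂ] ℂ}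
    (h : Integrable (fun x : Fin 2 × Fin 2 → ℚ_[p] => (l ∘ₗ TensorProduct.map (σ D) (σ' A))
      (φ ((weyl4 p)⁻¹ * unip (Matrix.of fun i j => x (i, j)) * g))) (unipMeasure p)) :
    Integrable (fun x : Fin 2 × Fin 2 → ℚ_[p] =>
      l (φ ((weyl4 p)⁻¹ * unip (Matrix.of fun i j => x (i, j)) * (levi A D * unip X * g))))
        (unipMeasure p) ∧
    ∫ x : Fin 2 × Fin 2 → ℚ_[p],
      l (φ ((weyl4 p)⁻¹ * unip (Matrix.of fun i j => x (i, j)) * (levi A D * unip X * g)))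
        ∂(unipMeasure p) =
      ((‖A.val.det‖ / ‖D.val.det‖ : ℝ) : ℂ) ^ 2 * ∫ x : Fin 2 × Fin 2 → ℚ_[p],
        (l ∘ₗ TensorProduct.map (σ D) (σ' A))
          (φ ((weyl4 p)⁻¹ * unip (Matrix.of fun i j => x (i, j)) * g)) ∂(unipMeasure p) := by
  let F : (Fin 2 × Fin 2 → ℚ_[p]) → ℂ := fun x =>
    (l ∘ₗ TensorProduct.map (σ D) (σ' A)) (φ ((weyl4 p)⁻¹ * unip (Matrix.of fun i j => x (i, j)) * g))
  let x₀ : Fin 2 × Fin 2 → ℚ_[p] := fun a => X a.1 a.2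
  have hF : ∀ x : Fin 2 × Fin 2 → ℚ_[p],
      l (φ ((weyl4 p)⁻¹ * unip (Matrix.of fun i j => x (i, j)) * (levi A D * unip X * g))) =
        (fun y => F (y + x₀)) (mulMulEquiv A⁻¹ D x) := by
    intro x
    have e1 : (weyl4 p)⁻¹ * unip (Matrix.of fun i j => x (i, j)) * (levi A D * unip X * g) =
        levi D A * ((weyl4 p)⁻¹ *
          unip (Matrix.of fun i j => (mulMulEquiv A⁻¹ D x + x₀) (i, j)) * g) := by
      have : (Matrix.of fun i j => (mulMulEquiv A⁻¹ D x + x₀) (i, j)) =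
          A⁻¹.val * (Matrix.of fun i j => x (i, j)) * D.val + X := rfl
      rw [this, ← unip_mul_unip, ← mul_assoc, ← mul_assoc, mul_assoc _ (unip _) (levi A D),
        unip_mul_levi, ← mul_assoc, weyl4_mul_levi]
      simp only [mul_assoc]
    rw [e1, hφ.levi_mul]
    rfl
  simp only [hF]
  obtain ⟨h3, h4⟩ := integrable_comp_mulMulEquiv (h.comp_add_right x₀) A⁻¹ D
  refine ⟨h3, h4.trans ?_⟩
  rw [integral_add_right_eq_self F, mulMulChar_eq]
  congr 1
  have : ‖(A⁻¹.val).det‖ = ‖A.val.det‖⁻¹ := by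
    have h5 : A⁻¹.val.det * A.val.det = 1 := by rw [← det_mul, Units.inv_mul, det_one]
    rw [eq_inv_of_mul_eq_one_left h5, norm_inv]
  simp only [NNReal.coe_mul, NNReal.coe_pow, coe_nnnorm, this]
  push_cast
  rw [div_pow, mul_inv, inv_pow, inv_inv, div_eq_mul_inv]

/-- The integral intertwines the actions of `P`, the modulus of `Y ↦ A⁻¹ Y D` giving the exponent
on the side of the image. -/
lemma HasIntertwiningIntegral.levi_mul {v : V} {v' : W} {φ : GL4 p → V ⊗[ℂ] W}
    (hφ : IsNewInducedVector σ σ' v v' φ) {g : GL4 p} {t : V ⊗[ℂ] W}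
    (h : HasIntertwiningIntegral σ σ' φ g t) (A D : GL (Fin 2) ℚ_[p])
    (X : Matrix (Fin 2) (Fin 2) ℚ_[p]) :
    HasIntertwiningIntegral σ σ' φ (levi A D * unip X * g)
      (((‖A.val.det‖ / ‖D.val.det‖ : ℝ) : ℂ) ^ 2 • TensorProduct.map (σ D) (σ' A) t) := by
  intro l hl
  obtain ⟨h1, h2⟩ := h _ (hl.comp_map D A)
  obtain ⟨h3, h4⟩ := hφ.integral_levi_mul A D X h1
  refine ⟨h3, h4.trans ?_⟩
  rw [h2, map_smul, LinearMap.comp_apply, smul_eq_mul]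

lemma HasIntertwiningIntegral.mul_mirahoric {v : V} {v' : W} {φ : GL4 p → V ⊗[ℂ] W}
    (hφ : IsNewInducedVector σ σ' v v' φ) {g : GL4 p} {t : V ⊗[ℂ] W}
    (h : HasIntertwiningIntegral σ σ' φ g t) {k : GL4 p}
    (hk : k ∈ mirahoric p (Sum.inr 1 : Fin 2 ⊕ Fin 2) 1) :
    HasIntertwiningIntegral σ σ' φ (g * k) t := by
  intro l hl
  simp only [← mul_assoc _ g k, hφ.invariant k hk]
  exact h l hl

/-- By the decomposition of `GL₄(ℚ_p)` into `P K_p` and `P ξ⁽⁰⁾ K_p`, the image of `φ` under the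
intertwining operator is determined by its values at `1` and at `ξ⁽⁰⁾`. -/
lemma isStandardIntertwiningImage_of_values {v : V} {v' : W}
    (h0 : ∀ x, (∀ k ∈ maxCompact p (Fin 2), σ k x = x) → x = 0)
    {φ : parabolicInduction σ σ' (-2)} (hφ : IsMirahoricVector 1 0 (v ⊗ₜ[ℂ] v') φ)
    {φt : parabolicInduction σ' σ (-(-2))} (hφt : IsMirahoricVector 1 1 (v' ⊗ₜ[ℂ] v) φt) {c : ℂ}
    (hone : HasIntertwiningIntegral σ σ' φ.1 1 (c • (v ⊗ₜ v')))
    (hxi : HasIntertwiningIntegral σ σ' φ.1 (xi p 0) 0) :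
    IsStandardIntertwiningImage σ σ' (-2) φ (c • φt) := by
  have hφ' := hφ.isNewInducedVector
  -- the transformation law of the image
  have key : ∀ A D X g, HasIntertwiningIntegral σ σ' φ.1 g (TensorProduct.comm ℂ W V ((c • φt).1 g)) →
      HasIntertwiningIntegral σ σ' φ.1 (levi A D * unip X * g)
        (TensorProduct.comm ℂ W V ((c • φt).1 (levi A D * unip X * g))) := by
    intro A D X g hg
    convert hg.levi_mul hφ' A D X using 1
    rw [(c • φt).2.2, show (1 : ℂ) + -(-2) / 2 = (2 : ℕ) by norm_num, Complex.cpow_natCast, map_smul]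
    congr 1
    have h2 : ∀ t : W ⊗[ℂ] V, TensorProduct.map (σ D) (σ' A) (TensorProduct.comm ℂ W V t) =
        TensorProduct.comm ℂ W V (TensorProduct.map (σ' A) (σ D) t) := fun t => by
      induction t with
      | zero => simp
      | add x y hx hy => simp only [map_add, hx, hy]
      | tmul x y => simp
    rw [h2]
  have keyK : ∀ g, ∀ k ∈ mirahoric p (Sum.inr 1 : Fin 2 ⊕ Fin 2) 1,
      HasIntertwiningIntegral σ σ' φ.1 g (TensorProduct.comm ℂ W V ((c • φt).1 g)) →
      HasIntertwiningIntegral σ σ' φ.1 (g * k) (TensorProduct.comm ℂ W V ((c • φt).1 (g * k))) := by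
    intro g k hk hg
    have : (c • φt).1 (g * k) = (c • φt).1 g := congrArg (c • ·) (hφt.invariant k hk g)
    rw [this]
    exact hg.mul_mirahoric hφ' hk
  have h1 : HasIntertwiningIntegral σ σ' φ.1 1 (TensorProduct.comm ℂ W V ((c • φt).1 1)) := by
    have : φt.1 1 = v' ⊗ₜ v := by
      rw [← hφt.invariant _ xi_one_mem_mirahoric, one_mul, hφt.apply_xi]
    have h2 : (c • φt).1 1 = c • (v' ⊗ₜ[ℂ] v) := congrArg (c • ·) this
    rwa [h2, map_smul, TensorProduct.comm_tmul]
  have h2 : HasIntertwiningIntegral σ σ' φ.1 (xi p 0)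
      (TensorProduct.comm ℂ W V ((c • φt).1 (xi p 0))) := by
    have : (c • φt).1 (xi p 0) = c • (0 : W ⊗[ℂ] V) :=
      congrArg (c • ·) (hφt.apply_xi_zero h0)
    rwa [this, smul_zero, map_zero]
  intro g
  obtain ⟨A, D, X, κ, hκ, rfl⟩ := exists_iwasawa g
  refine key A D X κ ?_
  by_cases h : ∀ i, ‖κ⁻¹.val (Sum.inr 1) (Sum.inl i)‖ < 1
  · obtain ⟨D, -, κ', hκ', rfl⟩ := exists_eq_levi_mul hκ h
    refine keyK _ _ hκ' ?_
    simpa [unip_zero] using key 1 D 0 1 h1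
  · push Not at h
    obtain ⟨i, hi⟩ := h
    obtain ⟨A, hA, X, hX, κ', hκ', rfl, -⟩ := exists_eq_levi_mul_unip_mul_xi hκ
      ⟨i, le_antisymm (entryLE_of_mem (inv_mem hκ) _ _) hi⟩
    exact keyK _ _ hκ' (key A 1 X _ h2)

end InducedVectors

/-! ### Absolute convergence -/

section Convergence

variable {p : ℕ} [hp : Fact p.Prime]
variable {V : Type*} [AddCommGroup V] [Module ℂ V] {σ : Representation ℂ (GL (Fin 2) ℚ_[p]) V}
variable {W : Type*} [AddCommGroup W] [Module ℂ W] {σ' : Representation ℂ (GL (Fin 2) ℚ_[p]) W}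

lemma IsSmooth.isLocallyConstant {G E : Type*} [Group G] [TopologicalSpace G] [IsTopologicalGroup G]
    {f : G → E} (hf : IsSmooth f) : IsLocallyConstant f := by
  obtain ⟨U, hU, h⟩ := hf
  refine (IsLocallyConstant.iff_exists_open f).2 fun g =>
    ⟨(fun x => g⁻¹ * x) ⁻¹' U, hU.preimage (by fun_prop), by simp, fun x hx => ?_⟩
  rw [← h g _ hx, mul_inv_cancel_left]

lemma continuous_unip : Continuous fun x : Fin 2 × Fin 2 → ℚ_[p] =>
    unip (Matrix.of fun i j => x (i, j)) := by
  refine Units.continuous_iff.2 ⟨?_, ?_⟩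
  · refine Continuous.matrix_fromBlocks continuous_const ?_ continuous_const continuous_const
    exact continuous_matrix fun i j => continuous_apply _
  · refine Continuous.matrix_fromBlocks continuous_const ?_ continuous_const continuous_const
    exact continuous_matrix fun i j => (continuous_apply (i, j)).neg

lemma continuous_coefficient {φ : GL4 p → V ⊗[ℂ] W} (hφ : IsSmooth φ) (l : V ⊗[ℂ] W →ₗ[ℂ] ℂ)
    (g : GL4 p) : Continuous fun x : Fin 2 × Fin 2 → ℚ_[p] =>
      l (φ ((weyl4 p)⁻¹ * unip (Matrix.of fun i j => x (i, j)) * g)) :=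
  ((hφ.isLocallyConstant.comp_continuous
    ((continuous_const.mul continuous_unip).mul continuous_const)).comp l).continuous

lemma unip_mul_mul (k₁ k₂ : GL (Fin 2) ℚ_[p]) (Y : Matrix (Fin 2) (Fin 2) ℚ_[p]) :
    unip (k₁.val * Y * k₂.val) = levi k₁ k₂⁻¹ * unip Y * levi k₁⁻¹ k₂ := by
  have h := unip_mul_levi (k₁.val * Y * k₂.val) k₁ k₂⁻¹
  have e : k₁⁻¹.val * (k₁.val * Y * k₂.val) * k₂⁻¹.val = Y := by
    rw [← mul_assoc, ← mul_assoc, Units.inv_mul, one_mul, mul_assoc, Units.mul_inv, mul_one]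
  rw [e] at h
  rw [← h, mul_assoc (unip _), levi_mul_levi, mul_inv_cancel, inv_mul_cancel, levi_one, mul_one]

lemma invDiag_eq (i j : ℕ) :
    (borel2 ((unif p)⁻¹ ^ i) ((unif p)⁻¹ ^ j) 0).val = invDiag p i j := by
  rw [borel2_val, invDiag]
  simp [unif_val, _root_.zpow_neg]

lemma borel2_inv_diag (a d : ℚ_[p]ˣ) : (borel2 a d 0)⁻¹ = borel2 a⁻¹ d⁻¹ 0 := by
  rw [inv_eq_iff_mul_eq_one, borel2_mul]
  simp [borel2_one]

lemma borel2_inv_pow (i j : ℕ) : (borel2 ((unif p)⁻¹ ^ i) ((unif p)⁻¹ ^ j) 0)⁻¹ =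
    borel2 (unif p ^ i) (unif p ^ j) 0 := by
  rw [borel2_inv_diag]
  simp

lemma entryLE_borel2_pow (i j : ℕ) : EntryLE 1 (borel2 (unif p ^ i) (unif p ^ j) 0).val := by
  rw [borel2_val]
  have : ∀ i : ℕ, ‖((unif p ^ i : ℚ_[p]ˣ) : ℚ_[p])‖ ≤ 1 := fun i => by
    rw [Units.val_pow_eq_pow_val, unif_val, norm_pow]
    exact pow_le_one₀ (norm_nonneg _) Padic.norm_p_lt_one.le
  exact entryLE_fin_two (this i) (by simp) (by simp) (this j)

lemma neg_one_mem_maxCompact : (-1 : GL (Fin 2) ℚ_[p]) ∈ maxCompact p (Fin 2) :=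
  neg_mem_maxCompact (one_mem _)

variable {v : V} {v' : W} {φ : GL4 p → V ⊗[ℂ] W}

/-- The value of `φ` at `w₀⁻¹ u(Y) κ`, through the Cartan decomposition of `Y`. -/
lemma IsNewInducedVector.apply_cartan (hφ : IsNewInducedVector σ σ' v v' φ)
    {k₁ k₂ : GL (Fin 2) ℚ_[p]} {κ : GL4 p} (i j : ℕ) (X : Matrix (Fin 2) (Fin 2) ℚ_[p]) :
    φ ((weyl4 p)⁻¹ * unip (k₁.val * invDiag p i j * k₂.val + X) * κ) =
      TensorProduct.map (σ (k₂⁻¹ * -borel2 (unif p ^ i) (unif p ^ j) 0))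
        (σ' (k₁ * borel2 ((unif p)⁻¹ ^ i) ((unif p)⁻¹ ^ j) 0))
        (φ (unipOpp (borel2 (unif p ^ i) (unif p ^ j) 0).val * (levi k₁⁻¹ k₂ * unip X * κ))) := by
  rw [← hφ.equivariant _ _ (-invDiag p i j)]
  congr 1
  rw [← unip_mul_unip, unip_mul_mul, ← mul_assoc, ← mul_assoc, ← mul_assoc, weyl4_mul_levi,
    mul_assoc _ _ (unip (invDiag p i j)), ← invDiag_eq, weyl4_mul_unip, borel2_inv_pow,
    ← levi_mul_levi]
  simp only [mul_assoc]

/-- The growth of `φ` on `w₀⁻¹ U_P`. -/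
lemma IsNewInducedVector.exists_bound (hφ : IsNewInducedVector σ σ' v v' φ)
    (h0 : ∀ x, (∀ k ∈ maxCompact p (Fin 2), σ k x = x) → x = 0) {c ε : ℂ}
    (hv : IsIwahoriEigenvector σ v c ε) (hc : c ≠ 0)
    (hε : ε ≠ 0) {ω τ₁ τ₂ : ℂ} (hv' : IsSphericalEigenvector σ' v' ω τ₁ τ₂) (hω : ω ≠ 0)
    {R : ℝ} (hR : 0 < R) (h₁ : ‖τ₁‖ ≤ R) (h₂ : ‖τ₂‖ ≤ R) {l : V ⊗[ℂ] W →ₗ[ℂ] ℂ}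
    (hl : IsSmoothFunctional σ σ' l) {κ : GL4 p} (hκ : κ ∈ maxCompact p (Fin 2 ⊕ Fin 2)) :
    ∃ C : ℝ, 0 ≤ C ∧ ∀ x : Fin 2 × Fin 2 → ℚ_[p], ∃ n j : ℕ, x ∈ cartanCell p (n + j) j ∧
      ‖l (φ ((weyl4 p)⁻¹ * unip (Matrix.of fun i j => x (i, j)) * κ))‖ ≤
        C * ((n + 1) * (‖c‖ * R / (p ^ 2 * ‖ω‖)) ^ n * (‖c‖ ^ 2 / ‖ω‖) ^ j) := by
  obtain ⟨C, hC, h⟩ := exists_bound_coefficient hv hc hε hv' hω hR h₁ h₂ hl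
  refine ⟨C, hC, fun x => ?_⟩
  obtain ⟨k₁, hk₁, k₂, hk₂, i, j, hij, X, hX, hx⟩ :=
    exists_cartan_add (Matrix.of fun i j => x (i, j))
  obtain ⟨n, rfl⟩ := Nat.exists_eq_add_of_le' hij
  refine ⟨n, j, mem_cartanCell hk₁ hk₂ hij hX hx, ?_⟩
  rw [hx, hφ.apply_cartan]
  rcases hφ.apply_of_mem h0 (κ := unipOpp (borel2 (unif p ^ (n + j)) (unif p ^ j) 0).val *
      (levi k₁⁻¹ k₂ * unip X * κ)) (mul_mem (unipOpp_mem (entryLE_borel2_pow _ _))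
      (mul_mem (mul_mem (levi_mem (inv_mem hk₁) hk₂) (unip_mem hX)) hκ)) with ⟨-, h3⟩ | ⟨A, hA, h3, -⟩
  · rw [h3, map_zero, map_zero, norm_zero]
    positivity
  · rw [h3, TensorProduct.map_tmul, ← rep_mul_apply]
    convert h n j (k₂⁻¹ * -1) (mul_mem (inv_mem hk₂) neg_one_mem_maxCompact) A hA k₁ hk₁ 1
      (one_mem _) using 4
    · simp
    · simp

/-- Absolute convergence of the intertwining integral on `GL₄(ℤ_p)`: the cell of
`k₁ diag(p^{-n-j}, p^{-j}) k₂` contributes at most a constant times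
`(n + 1) (p |c| R / |ω|)ⁿ (p⁴ |c|² / |ω|)ʲ`. -/
lemma IsNewInducedVector.integrable (hφ : IsNewInducedVector σ σ' v v' φ)
    (h0 : ∀ x, (∀ k ∈ maxCompact p (Fin 2), σ k x = x) → x = 0) {c ε : ℂ}
    (hv : IsIwahoriEigenvector σ v c ε) (hc : c ≠ 0)
    (hε : ε ≠ 0) {ω τ₁ τ₂ : ℂ} (hv' : IsSphericalEigenvector σ' v' ω τ₁ τ₂) (hω : ω ≠ 0)
    {R : ℝ} (hR : 0 < R) (h₁ : ‖τ₁‖ ≤ R) (h₂ : ‖τ₂‖ ≤ R)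
    (ha : p * (‖c‖ * R) < ‖ω‖) (hb : p ^ 4 * ‖c‖ ^ 2 < ‖ω‖) {l : V ⊗[ℂ] W →ₗ[ℂ] ℂ}
    (hl : IsSmoothFunctional σ σ' l) {κ : GL4 p} (hκ : κ ∈ maxCompact p (Fin 2 ⊕ Fin 2)) :
    Integrable (fun x : Fin 2 × Fin 2 → ℚ_[p] =>
      l (φ ((weyl4 p)⁻¹ * unip (Matrix.of fun i j => x (i, j)) * κ))) (unipMeasure p) := by
  obtain ⟨C, hC, h⟩ := hφ.exists_bound h0 hv hc hε hv' hω hR h₁ h₂ hl hκ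
  refine ⟨(continuous_coefficient hφ.smooth l κ).aestronglyMeasurable, ?_⟩
  have hp0 := prime_pos_real (p := p)
  have hω' : 0 < ‖ω‖ := norm_pos_iff.2 hω
  let B : ℕ × ℕ → ℝ := fun z =>
    C * ((z.1 + 1) * (‖c‖ * R / (p ^ 2 * ‖ω‖)) ^ z.1 * (‖c‖ ^ 2 / ‖ω‖) ^ z.2)
  have hB : ∀ z, 0 ≤ B z := fun z => by positivity
  have hle : ∀ x : Fin 2 × Fin 2 → ℚ_[p],
      ‖l (φ ((weyl4 p)⁻¹ * unip (Matrix.of fun i j => x (i, j)) * κ))‖ₑ ≤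
        ∑' z : ℕ × ℕ, (cartanCell p (z.1 + z.2) z.2).indicator
          (fun _ => ENNReal.ofReal (B z)) x := by
    intro x
    obtain ⟨n, j, hx, hn⟩ := h x
    refine le_trans ?_ (ENNReal.le_tsum (n, j))
    rw [Set.indicator_of_mem hx, ← ofReal_norm]
    exact ENNReal.ofReal_le_ofReal hn
  refine (lintegral_mono hle).trans_lt ?_
  rw [lintegral_tsum fun z => (measurable_const.indicator (measurableSet_cartanCell _ _)).aemeasurable]
  let S : ℕ × ℕ → ℝ := fun z => ((z.1 + 1) * (p * (‖c‖ * R) / ‖ω‖) ^ z.1) *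
    (4 * C * (p ^ 4 * ‖c‖ ^ 2 / ‖ω‖) ^ z.2)
  have hS : Summable S := by
    have hr1 : p * (‖c‖ * R) / ‖ω‖ < 1 := (div_lt_one hω').2 ha
    have hr2 : p ^ 4 * ‖c‖ ^ 2 / ‖ω‖ < 1 := (div_lt_one hω').2 hb
    have hr0 : 0 ≤ p * (‖c‖ * R) / ‖ω‖ := by positivity
    refine Summable.mul_of_nonneg (f := fun n : ℕ => (n + 1) * (p * (‖c‖ * R) / ‖ω‖) ^ n)
      (g := fun j : ℕ => 4 * C * (p ^ 4 * ‖c‖ ^ 2 / ‖ω‖) ^ j) ?_ ?_ ?_ ?_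
    · have h1 := summable_pow_mul_geometric_of_norm_lt_one 1 (R := ℝ)
        (r := p * (‖c‖ * R) / ‖ω‖) (by rwa [Real.norm_of_nonneg hr0])
      refine (h1.add (summable_geometric_of_lt_one hr0 hr1)).congr fun n => ?_
      ring
    · exact (summable_geometric_of_lt_one (by positivity) hr2).mul_left _
    · intro n; positivity
    · intro j; positivity
  refine lt_of_le_of_lt (ENNReal.tsum_le_tsum (g := fun z => ENNReal.ofReal (S z)) fun z => ?_)
    hS.tsum_ofReal_lt_top
  rw [lintegral_indicator (measurableSet_cartanCell _ _), setLIntegral_const]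
  refine (mul_le_mul_right (unipMeasure_cartanCell_le _ _) _).trans (le_of_eq ?_)
  have e : (4 * (p : ENNReal) ^ (3 * (z.1 + z.2) + z.2)) =
      ENNReal.ofReal (4 * (p : ℝ) ^ (3 * (z.1 + z.2) + z.2)) := by
    rw [ENNReal.ofReal_mul (by norm_num), ENNReal.ofReal_pow hp0.le, ENNReal.ofReal_natCast]
    norm_num
  rw [e, ← ENNReal.ofReal_mul (hB z)]
  congr 1
  simp only [B, S]
  rw [div_pow, div_pow, div_pow, div_pow, mul_pow ((p : ℝ) ^ 2), mul_pow (p : ℝ), mul_pow ((p : ℝ) ^ 4),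
    ← pow_mul, ← pow_mul, pow_add, mul_add, pow_add]
  field_simp
  ring

end Convergence

/-! ### The value at `ξ⁽⁰⁾` -/

section ValueAtXi

variable {p : ℕ} [hp : Fact p.Prime]
variable {V : Type*} [AddCommGroup V] [Module ℂ V] {σ : Representation ℂ (GL (Fin 2) ℚ_[p]) V}
variable {W : Type*} [AddCommGroup W] [Module ℂ W] {σ' : Representation ℂ (GL (Fin 2) ℚ_[p]) W}
variable {v : V} {v' : W} {φ : GL4 p → V ⊗[ℂ] W}

/-- The average of a smooth functional over `GL₂(ℤ_p)`, acting on the first factor, is zero if `σ`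
has no `GL₂(ℤ_p)`-fixed vectors. -/
lemma IsSmoothFunctional.exists_sum_eq_zero (hσ : IsSmoothRep σ)
    (h0 : ∀ x, (∀ k ∈ maxCompact p (Fin 2), σ k x = x) → x = 0)
    {l : V ⊗[ℂ] W →ₗ[ℂ] ℂ} (hl : IsSmoothFunctional σ σ' l) :
    ∃ (ι : Type) (_ : Fintype ι) (_ : Nonempty ι) (k : ι → GL (Fin 2) ℚ_[p]),
      (∀ i, k i ∈ maxCompact p (Fin 2)) ∧
        ∑ i, l ∘ₗ TensorProduct.map (σ (k i)) (σ' 1) = 0 := by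
  obtain ⟨N, hN⟩ := hl.exists_level
  let Q := GL (Fin 2) ℤ_[p] ⧸ (redGL p N).ker
  have : Fintype Q := Fintype.ofFinite _
  let T : GL (Fin 2) ℤ_[p] → V ⊗[ℂ] W →ₗ[ℂ] ℂ := fun k =>
    l ∘ₗ TensorProduct.map (σ (intGL p _ k)) (σ' 1)
  have hT : ∀ a, ∀ u ∈ (redGL p N).ker, T (a * u) = T a := by
    intro a u hu
    have h1 : a * u = (a * u * a⁻¹) * a := by group
    have h2 : a * u * a⁻¹ ∈ (redGL p N).ker := (redGL p N).normal_ker.conj_mem u hu a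
    rw [h1]
    refine TensorProduct.ext' fun x y => ?_
    have h3 := hN _ h2 1 (one_mem _) (σ (intGL p _ a) x ⊗ₜ y)
    simp only [T, LinearMap.comp_apply, TensorProduct.map_tmul] at h3 ⊢
    rw [map_mul (intGL p _) (a * u * a⁻¹), rep_mul_apply]
    rw [map_one (intGL p _), map_one σ', Module.End.one_apply] at h3
    rw [map_one σ', Module.End.one_apply]
    exact h3
  let F : Q → V ⊗[ℂ] W →ₗ[ℂ] ℂ := Quotient.lift T fun a b hab => by
    have h : a⁻¹ * b ∈ (redGL p N).ker := QuotientGroup.leftRel_apply.1 hab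
    rw [← hT a _ h, mul_inv_cancel_left]
  have hF : ∀ (k : GL (Fin 2) ℤ_[p]) (q : Q),
      F q ∘ₗ TensorProduct.map (σ (intGL p _ k)) (σ' 1) = F (q * (k : Q)) := by
    intro k q
    induction q using QuotientGroup.induction_on with
    | H a =>
      change T a ∘ₗ _ = T (a * k)
      refine TensorProduct.ext' fun x y => ?_
      simp only [T, LinearMap.comp_apply, TensorProduct.map_tmul, map_mul, Module.End.mul_apply,
        map_one, Module.End.one_apply]
  refine ⟨Q, this, ⟨1⟩, fun q => intGL p _ q.out, fun q => ⟨_, rfl⟩, ?_⟩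
  have hout : ∀ q : Q, l ∘ₗ TensorProduct.map (σ (intGL p _ q.out)) (σ' 1) = F q := fun q => by
    conv_rhs => rw [← QuotientGroup.out_eq' q]
    rfl
  rw [Finset.sum_congr rfl fun q _ => hout q]
  refine TensorProduct.ext' fun x y => ?_
  have h1 : (∑ q, F q) ∘ₗ (TensorProduct.mk ℂ V W).flip y = 0 := by
    refine functional_eq_zero hσ h0 ?_
    rintro _ ⟨k, rfl⟩ x
    have h2 : ∀ q, F q (σ (intGL p _ k) x ⊗ₜ y) = F (q * (k : Q)) (x ⊗ₜ y) := fun q => by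
      rw [← hF, LinearMap.comp_apply, TensorProduct.map_tmul, map_one, Module.End.one_apply]
    simp only [LinearMap.comp_apply, LinearMap.flip_apply, TensorProduct.mk_apply,
      LinearMap.sum_apply, h2]
    exact Fintype.sum_equiv (Equiv.mulRight (k : Q)) _ _ fun _ => rfl
  simpa using LinearMap.congr_fun h1 x

/-- The image of `φ` under the intertwining operator vanishes at `ξ⁽⁰⁾`, because its value there is
fixed by `GL₂(ℤ_p)` acting through `σ`. -/
lemma IsNewInducedVector.hasIntertwiningIntegral_xi (hφ : IsNewInducedVector σ σ' v v' φ)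
    (hσ : IsSmoothRep σ) (h0 : ∀ x, (∀ k ∈ maxCompact p (Fin 2), σ k x = x) → x = 0)
    (hint : ∀ l, IsSmoothFunctional σ σ' l → Integrable (fun x : Fin 2 × Fin 2 → ℚ_[p] =>
      l (φ ((weyl4 p)⁻¹ * unip (Matrix.of fun i j => x (i, j)) * xi p 0))) (unipMeasure p)) :
    HasIntertwiningIntegral σ σ' φ (xi p 0) 0 := by
  intro l hl
  refine ⟨hint l hl, ?_⟩
  rw [map_zero]
  have hinv : ∀ k ∈ maxCompact p (Fin 2), ∫ x : Fin 2 × Fin 2 → ℚ_[p],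
      (l ∘ₗ TensorProduct.map (σ k) (σ' 1))
        (φ ((weyl4 p)⁻¹ * unip (Matrix.of fun i j => x (i, j)) * xi p 0)) ∂(unipMeasure p) =
      ∫ x : Fin 2 × Fin 2 → ℚ_[p],
        l (φ ((weyl4 p)⁻¹ * unip (Matrix.of fun i j => x (i, j)) * xi p 0)) ∂(unipMeasure p) := by
    intro k hk
    have h1 := (hφ.integral_levi_mul 1 k !![0, 0; k.val 1 0, k.val 1 1 - 1]
      (hint _ (hl.comp_map k 1))).2
    rw [norm_det_of_mem hk, Units.val_one, det_one, norm_one, div_one, Complex.ofReal_one, one_pow,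
      one_mul] at h1
    refine h1.symm.trans (integral_congr_ae (Filter.Eventually.of_forall fun x => ?_))
    have e : (weyl4 p)⁻¹ * unip (Matrix.of fun i j => x (i, j)) *
        (levi 1 k * unip !![0, 0; k.val 1 0, k.val 1 1 - 1] * xi p 0) =
        (weyl4 p)⁻¹ * unip (Matrix.of fun i j => x (i, j)) * xi p 0 *
          ((xi p 0)⁻¹ * (levi 1 k * unip !![0, 0; k.val 1 0, k.val 1 1 - 1] * xi p 0)) := by
      rw [mul_assoc _ (xi p 0), mul_inv_cancel_left]
    change l (φ _) = l (φ _)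
    rw [e, hφ.invariant _ (conj_xi_mem_mirahoric hk)]
  obtain ⟨ι, _, _, k, hk, hsum⟩ := hl.exists_sum_eq_zero hσ h0
  have h2 := integral_finsetSum (μ := unipMeasure p) Finset.univ
    (fun i _ => hint _ (hl.comp_map (k i) 1))
  rw [Finset.sum_congr rfl fun i _ => hinv _ (hk i), Finset.sum_const, Finset.card_univ,
    nsmul_eq_mul] at h2
  have h3 : ∀ y, ∑ i, (l ∘ₗ TensorProduct.map (σ (k i)) (σ' 1)) y = 0 := fun y => by
    rw [← LinearMap.sum_apply, hsum, LinearMap.zero_apply]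
  simp only [h3, integral_zero] at h2
  exact (mul_eq_zero.1 h2.symm).resolve_left (Nat.cast_ne_zero.2 Fintype.card_ne_zero)

end ValueAtXi

/-! ### Integrals of functions invariant under `M₂(ℤ_p)` -/

section Cosets

variable {p : ℕ} [hp : Fact p.Prime]

lemma unipMeasure_coset (a : Fin 2 × Fin 2 → ℚ_[p]) :
    unipMeasure p {x | x - a ∈ intBox p} = 1 := by
  have : {x | x - a ∈ intBox p} = (fun x => x + -a) ⁻¹' intBox p := by
    ext x; simp [sub_eq_add_neg]
  rw [this, measure_preimage_add_right, unipMeasure_intBox]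

lemma measurableSet_coset (a : Fin 2 × Fin 2 → ℚ_[p]) :
    MeasurableSet {x | x - a ∈ intBox p} := by
  have h : MeasurableSet (intBox p) := by
    rw [intBox_eq]
    exact MeasurableSet.univ_pi fun _ => Metric.isClosed_closedBall.measurableSet
  exact h.preimage (measurable_id.sub_const a)

/-- The integral of a function invariant under `M₂(ℤ_p)` over a set in which its support consists of
finitely many cosets. -/
lemma setIntegral_eq_sum_cosets {ι : Type} (T : Finset ι) (a : ι → Fin 2 × Fin 2 → ℚ_[p])
    {S : Set (Fin 2 × Fin 2 → ℚ_[p])} (hSm : MeasurableSet S) {F : (Fin 2 × Fin 2 → ℚ_[p]) → ℂ}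
    (hF : ∀ x y, x - y ∈ intBox p → F x = F y)
    (hinj : ∀ i ∈ T, ∀ j ∈ T, a i - a j ∈ intBox p → i = j)
    (hS : ∀ x ∈ S, F x ≠ 0 → ∃ i ∈ T, x - a i ∈ intBox p)
    (haS : ∀ i ∈ T, ∀ x, x - a i ∈ intBox p → x ∈ S) :
    ∫ x in S, F x ∂(unipMeasure p) = ∑ i ∈ T, F (a i) := by
  have hsub : (⋃ i ∈ T, {x | x - a i ∈ intBox p}) ⊆ S := by
    intro x hx
    simp only [Set.mem_iUnion] at hx
    obtain ⟨i, hi, hx⟩ := hx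
    exact haS i hi x hx
  have hcongr : ∀ i, Set.EqOn F (fun _ => F (a i)) {x | x - a i ∈ intBox p} :=
    fun i x hx => hF x (a i) hx
  rw [setIntegral_eq_of_subset_of_forall_sdiff_eq_zero hSm hsub, integral_biUnion_finset]
  · refine Finset.sum_congr rfl fun i _ => ?_
    rw [setIntegral_congr_fun (measurableSet_coset _) (hcongr i), setIntegral_const,
      Measure.real, unipMeasure_coset]
    simp
  · exact fun i _ => measurableSet_coset _
  · intro i hi j hj hij
    refine Set.disjoint_left.2 fun x hx hx' => hij (hinj i hi j hj fun b => ?_)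
    have : (a i - a j) b = (x - a j) b - (x - a i) b := by simp
    rw [this]
    exact (padic_norm_sub_le_max _ _).trans (max_le (hx' b) (hx b))
  · intro i _
    refine IntegrableOn.congr_fun (f := fun _ => F (a i)) ?_ (fun x hx => (hcongr i hx).symm)
      (measurableSet_coset _)
    exact integrableOn_const (by rw [unipMeasure_coset]; simp)
  · intro x hx
    by_contra h
    obtain ⟨i, hi, hxi⟩ := hS x hx.1 h
    exact hx.2 (Set.mem_biUnion hi hxi)

end Cosets

/-! ### The induced vector on the big cell -/

section BigCell

variable {p : ℕ} [hp : Fact p.Prime]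
variable {V : Type*} [AddCommGroup V] [Module ℂ V] {σ : Representation ℂ (GL (Fin 2) ℚ_[p]) V}
variable {W : Type*} [AddCommGroup W] [Module ℂ W] {σ' : Representation ℂ (GL (Fin 2) ℚ_[p]) W}
variable {v : V} {v' : W} {φ : GL4 p → V ⊗[ℂ] W}

namespace IsNewInducedVector

lemma bigCell_add (hφ : IsNewInducedVector σ σ' v v' φ) (Y : Matrix (Fin 2) (Fin 2) ℚ_[p])
    {X : Matrix (Fin 2) (Fin 2) ℚ_[p]} (hX : EntryLE 1 X) :
    φ ((weyl4 p)⁻¹ * unip (Y + X)) = φ ((weyl4 p)⁻¹ * unip Y) := by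
  rw [← unip_mul_unip, ← mul_assoc, hφ.invariant _ (unip_mem_mirahoric hX)]

/-- The equivariance of `Y ↦ φ(w₀⁻¹ u(Y))`; on the right only mirahoric elements are allowed, as
`w₀⁻¹ u(Y) diag(1, k₂) = diag(k₂, 1) w₀⁻¹ u(Y k₂)`. -/
lemma bigCell_mul_mul (hφ : IsNewInducedVector σ σ' v v' φ) (Y : Matrix (Fin 2) (Fin 2) ℚ_[p])
    {k₁ k₂ : GL (Fin 2) ℚ_[p]} (hk₁ : k₁ ∈ maxCompact p (Fin 2))
    (hk₂ : k₂ ∈ mirahoric p (1 : Fin 2) 1) :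
    φ ((weyl4 p)⁻¹ * unip (k₁.val * Y * k₂.val)) =
      TensorProduct.map (σ k₂⁻¹) (σ' k₁) (φ ((weyl4 p)⁻¹ * unip Y)) := by
  rw [unip_mul_mul, ← mul_assoc, ← mul_assoc, weyl4_mul_levi,
    hφ.invariant _ (levi_mem_mirahoric (inv_mem hk₁) hk₂), mul_assoc, hφ.levi_mul]

lemma bigCell_swap (hφ : IsNewInducedVector σ σ' v v' φ) (Y : Matrix (Fin 2) (Fin 2) ℚ_[p]) :
    φ ((weyl4 p)⁻¹ * unip ((swap2 p).val * Y)) =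
      TensorProduct.map (σ 1) (σ' (swap2 p)) (φ ((weyl4 p)⁻¹ * unip Y)) := by
  have h := hφ.bigCell_mul_mul Y swap2_mem (k₂ := 1)
    (mem_mirahoric_one.2 ⟨one_mem _, fun j => by simp⟩)
  rwa [Units.val_one, mul_one, inv_one] at h

/-- If `φ` does not vanish at `w₀⁻¹ u(Y)`, the second column of `Y` is congruent modulo `ℤ_p²` to an
integral multiple of the first: for the Iwasawa decomposition
`w₀⁻¹ u(Y) = diag(A, D) u κ`, the lower left block of `κ⁻¹` is `A`, its upper left block is `-Y A`,
and the last row of `A` is primitive. -/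
lemma bigCell_support (hφ : IsNewInducedVector σ σ' v v' φ)
    (h0 : ∀ x, (∀ k ∈ maxCompact p (Fin 2), σ k x = x) → x = 0)
    {Y : Matrix (Fin 2) (Fin 2) ℚ_[p]} (hY : φ ((weyl4 p)⁻¹ * unip Y) ≠ 0) :
    ∃ b : ℚ_[p], ‖b‖ ≤ 1 ∧ ∀ i, ‖Y i 1 + b * Y i 0‖ ≤ 1 := by
  obtain ⟨A, D, X, κ, hκ, h⟩ := exists_iwasawa ((weyl4 p)⁻¹ * unip Y)
  have hκ0 : φ κ ≠ 0 := fun h1 => hY (by rw [h, hφ.equivariant, h1, map_zero])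
  have hinv : κ⁻¹ = unip (-Y) * weyl4 p * (levi A D * unip X) := by
    have : unip (-Y) = (unip Y)⁻¹ := Units.ext rfl
    rw [this, eq_comm, ← mul_eq_one_iff_eq_inv, mul_assoc, ← h]
    group
  have hval : κ⁻¹.val = fromBlocks (-Y * A.val) (-Y * (A.val * X) + D.val) A.val (A.val * X) := by
    rw [hinv]
    simp only [Units.val_mul, levi_val, unip_val, weyl4_val, fromBlocks_multiply]
    simp
  have hi := entryLE_of_mem (inv_mem hκ)
  rw [hval] at hi
  have hA : ∀ i j, ‖A.val i j‖ ≤ 1 := fun i j => by simpa using hi (Sum.inr i) (Sum.inl j)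
  have hYA : ∀ i j, ‖(Y * A.val) i j‖ ≤ 1 := fun i j => by
    simpa using hi (Sum.inl i) (Sum.inl j)
  obtain ⟨j, hj⟩ : ∃ j, ‖A.val 1 j‖ = 1 := by
    rcases hφ.apply_of_mem h0 hκ with ⟨-, h1⟩ | ⟨B, hB, -, h1⟩
    · exact absurd h1 hκ0
    · by_contra! hne
      have h2 := norm_vecMul_lt (x := fun i => κ⁻¹.val (Sum.inr 1) (Sum.inl i)) (fun i => by
        rw [hval, fromBlocks_apply₂₁]
        exact lt_of_le_of_ne (hA _ _) (hne i)) (entryLE_of_mem hB) 1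
      rw [h1] at h2
      simp at h2
  have hj0 : A.val 1 j ≠ 0 := fun h => by simp [h] at hj
  refine ⟨A.val 0 j / A.val 1 j, by rw [norm_div, hj, div_one]; exact hA _ _, fun i => ?_⟩
  have e : Y i 1 + A.val 0 j / A.val 1 j * Y i 0 = (Y * A.val) i j / A.val 1 j := by
    rw [Matrix.mul_apply, Fin.sum_univ_two]
    field_simp
    ring
  rw [e, norm_div, hj, div_one]
  exact hYA i j

lemma apply_unipOpp (hφ : IsNewInducedVector σ σ' v v' φ)
    (h0 : ∀ x, (∀ k ∈ maxCompact p (Fin 2), σ k x = x) → x = 0)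
    (hv : ∀ k ∈ mirahoric p (1 : Fin 2) 1, σ k v = v) (n : ℕ) :
    φ (unipOpp (borel2 (unif p ^ n) 1 0).val) = v ⊗ₜ v' := by
  have hval : (unipOpp (borel2 (unif p ^ n) 1 0).val)⁻¹.val =
      fromBlocks 1 0 (-(borel2 (unif p ^ n) 1 0).val) 1 := rfl
  have hmem : unipOpp (borel2 (unif p ^ n) 1 0).val ∈ maxCompact p (Fin 2 ⊕ Fin 2) := by
    have := entryLE_borel2_pow (p := p) n 0
    rw [pow_zero] at this
    exact unipOpp_mem this
  rcases hφ.apply_of_mem h0 hmem with ⟨h1, -⟩ | ⟨A, hA, h1, h2⟩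
  · have := h1 1
    rw [hval] at this
    simp [borel2_val] at this
  · rw [h1, hv]
    rw [hval] at h2
    have e : (fun i : Fin 2 => fromBlocks (1 : Matrix (Fin 2) (Fin 2) ℚ_[p]) 0
        (-(borel2 (unif p ^ n) 1 0).val) (1 : Matrix (Fin 2) (Fin 2) ℚ_[p]) (Sum.inr (1 : Fin 2))
        (Sum.inl i)) = ![(0 : ℚ_[p]), -1] := by
      funext i
      revert i
      simp [borel2_val]
    rw [e] at h2
    have h3 := congrFun h2 0
    have h4 := congrFun h2 1
    simp [Matrix.vecMul, dotProduct, Fin.sum_univ_two] at h3 h4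
    exact mem_mirahoric_fin_two hA (by simp [h3]) (by simp [h4])

/-- Modulo integral matrices, `p^{-n}` in the lower left corner is `swap2 p * diag(p^{-n}, 1)`. -/
lemma bigCell_diag (hφ : IsNewInducedVector σ σ' v v' φ)
    (h0 : ∀ x, (∀ k ∈ maxCompact p (Fin 2), σ k x = x) → x = 0) {c ε : ℂ}
    (hv : IsIwahoriEigenvector σ v c ε) {ω τ₁ τ₂ : ℂ} (hv' : IsSphericalEigenvector σ' v' ω τ₁ τ₂)
    (n : ℕ) : φ ((weyl4 p)⁻¹ * unip !![0, 0; (p : ℚ_[p]) ^ (-(n : ℤ)), 0]) =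
      σ (diagPow p n) v ⊗ₜ σ' (borel2 1 ((unif p)⁻¹ ^ n) 0) v' := by
  have hX : EntryLE 1 !![(0 : ℚ_[p]), -1; 0, 0] :=
    entryLE_fin_two (by simp) (by simp) (by simp) (by simp)
  have e : !![0, 0; (p : ℚ_[p]) ^ (-(n : ℤ)), 0] =
      (swap2 p).val * invDiag p n 0 * (1 : GL (Fin 2) ℚ_[p]).val + !![(0 : ℚ_[p]), -1; 0, 0] := by
    rw [swap2_val, invDiag]
    simp
  have h1 := hφ.apply_cartan (k₁ := swap2 p) (k₂ := 1) (κ := 1) n 0 !![(0 : ℚ_[p]), -1; 0, 0]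
  have hmir : (1 : GL (Fin 2) ℚ_[p]) ∈ mirahoric p (1 : Fin 2) 1 :=
    mem_mirahoric_one.2 ⟨one_mem _, fun j => by simp⟩
  rw [← e, mul_one, mul_one, ← mul_assoc, hφ.invariant _ (unip_mem_mirahoric hX),
    hφ.invariant _ (levi_mem_mirahoric (inv_mem swap2_mem) hmir), pow_zero, pow_zero,
    hφ.apply_unipOpp h0 hv.mirahoric, TensorProduct.map_tmul] at h1
  rw [h1]
  congr 1
  · have e1 : (1 : GL (Fin 2) ℚ_[p])⁻¹ * -borel2 (unif p ^ n) 1 0 =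
        diagPow p n * borel2 (-1) (-1) 0 := by
      refine Units.ext ?_
      rw [diagPow, borel2_mul, inv_one, one_mul, Units.val_neg, borel2_val, borel2_val]
      simp
    rw [e1, rep_mul_apply, hv.unit_scalar _ (by simp)]
  · have e2 : swap2 p * borel2 ((unif p)⁻¹ ^ n) 1 0 =
        borel2 1 ((unif p)⁻¹ ^ n) 0 * swap2 p := by
      refine Units.ext ?_
      rw [Units.val_mul, Units.val_mul, borel2_val, borel2_val, swap2_val]
      simp
    rw [e2, rep_mul_apply, hv'.maxCompact _ swap2_mem]

/-- The values of `φ` at `w₀⁻¹ u(Y)`, where the first column of `Y` is `p^{-n} u (t, 1)` and the second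
is `-x` times the first. -/
lemma bigCell_value (hφ : IsNewInducedVector σ σ' v v' φ)
    (h0 : ∀ x, (∀ k ∈ maxCompact p (Fin 2), σ k x = x) → x = 0) {c ε : ℂ}
    (hv : IsIwahoriEigenvector σ v c ε) {ω τ₁ τ₂ : ℂ} (hv' : IsSphericalEigenvector σ' v' ω τ₁ τ₂)
    (n : ℕ) {u t x : ℚ_[p]} (hu : ‖u‖ = 1) (ht : ‖t‖ ≤ 1) (hx : ‖x‖ ≤ 1) {q : ℚ_[p]}
    (hq : q = (p : ℚ_[p]) ^ (-(n : ℤ)) * u) :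
    φ ((weyl4 p)⁻¹ * unip !![q * t, -(x * (q * t)); q, -(x * q)]) =
      σ (borel2 (unif p ^ n) 1 x) v ⊗ₜ
        σ' (borel2 1 1 t * borel2 1 ((unif p)⁻¹ ^ n) 0) v' := by
  have hu0 : u ≠ 0 := fun h => by simp [h] at hu
  obtain ⟨w, rfl⟩ : ∃ w : ℚ_[p]ˣ, (w : ℚ_[p]) = u := ⟨Units.mk0 u hu0, rfl⟩
  have hmem : borel2 w 1 (-(x * (w : ℚ_[p]))) ∈ mirahoric p (1 : Fin 2) 1 := by
    refine mem_mirahoric_fin_two (borel2_mem_maxCompact hu (by simp) (by simp [hu, hx])) ?_ ?_ <;>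
      simp [borel2_val]
  have ht' : borel2 1 1 t ∈ maxCompact p (Fin 2) := borel2_mem_maxCompact (by simp) (by simp) ht
  have e : !![q * t, -(x * (q * t)); q, -(x * q)] = (borel2 1 1 t).val *
      !![0, 0; (p : ℚ_[p]) ^ (-(n : ℤ)), 0] * (borel2 w 1 (-(x * (w : ℚ_[p])))).val := by
    rw [borel2_val, borel2_val, hq]
    ext i j
    fin_cases i <;> fin_cases j <;> simp [Matrix.mul_apply, Fin.sum_univ_two] <;> ring
  rw [e, hφ.bigCell_mul_mul _ ht' hmem, hφ.bigCell_diag h0 hv hv', TensorProduct.map_tmul,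
    ← rep_mul_apply, ← rep_mul_apply]
  congr 1
  have e1 : (borel2 w 1 (-(x * (w : ℚ_[p]))))⁻¹ * diagPow p n =
      borel2 (unif p ^ n) 1 x * borel2 w⁻¹ 1 0 := by
    rw [inv_mul_eq_iff_eq_mul, diagPow, borel2_mul, borel2_mul]
    congr 1
    · rw [mul_comm (unif p ^ n), mul_inv_cancel_left]
    · simp
    · simp
      ring
  rw [e1, rep_mul_apply, hv.mirahoric]
  refine mem_mirahoric_fin_two (borel2_mem_maxCompact (by simp [hu]) (by simp) (by simp)) ?_ ?_ <;>
    simp [borel2_val]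

end IsNewInducedVector

end BigCell

/-! ### Integration over the first columns of given denominator -/

section ValueAtOne

variable {p : ℕ} [hp : Fact p.Prime]
variable {V : Type*} [AddCommGroup V] [Module ℂ V] {σ : Representation ℂ (GL (Fin 2) ℚ_[p]) V}
variable {W : Type*} [AddCommGroup W] [Module ℂ W] {σ' : Representation ℂ (GL (Fin 2) ℚ_[p]) W}
variable {v : V} {v' : W} {φ : GL4 p → V ⊗[ℂ] W}

variable (p) in
/-- The matrices whose first column is `p^{-n}` times a primitive vector, with `|y₁₁| ≤ p^{-e} |y₂₁|`. -/
def columnShell (e n : ℕ) : Set (Fin 2 × Fin 2 → ℚ_[p]) :=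
  {x | ‖x (1, 0)‖ = (p : ℝ) ^ n ∧ ‖x (0, 0)‖ ≤ (p : ℝ) ^ (n - e)}

lemma measurableSet_columnShell (e n : ℕ) : MeasurableSet (columnShell p e n) := by
  have h1 : MeasurableSet {x : Fin 2 × Fin 2 → ℚ_[p] | ‖x (1, 0)‖ = (p : ℝ) ^ n} :=
    measurableSet_eq_fun (by fun_prop) measurable_const
  have h2 : MeasurableSet {x : Fin 2 × Fin 2 → ℚ_[p] | ‖x (0, 0)‖ ≤ (p : ℝ) ^ (n - e)} :=
    measurableSet_le (by fun_prop) measurable_const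
  exact h1.inter h2

variable (p) in
/-- The matrix with first column `p^{-n} u (pᵉ s, 1)` and second column `-x` times the first, for the
index `(u, s, x)`. -/
def shellPoint (e n : ℕ) (i : ℕ × ℕ × ℕ) : Fin 2 × Fin 2 → ℚ_[p] := fun a =>
  !![(p : ℚ_[p]) ^ (-(n : ℤ)) * i.1 * ((p : ℚ_[p]) ^ e * i.2.1),
      -(i.2.2 * ((p : ℚ_[p]) ^ (-(n : ℤ)) * i.1 * ((p : ℚ_[p]) ^ e * i.2.1)));
    (p : ℚ_[p]) ^ (-(n : ℤ)) * i.1, -(i.2.2 * ((p : ℚ_[p]) ^ (-(n : ℤ)) * i.1))] a.1 a.2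

variable (p) in
/-- The index set of the cosets of `M₂(ℤ_p)` in `columnShell p e n` that meet the support of
`Y ↦ φ(w₀⁻¹ u(Y))`. -/
def shellIndex (e n : ℕ) : Finset (ℕ × ℕ × ℕ) :=
  ((Finset.range (p ^ n)).filter fun u => ¬ p ∣ u) ×ˢ
    (Finset.range (p ^ (n - e)) ×ˢ Finset.range (p ^ n))

lemma norm_natCast_eq_one {u : ℕ} (h : ¬ p ∣ u) : ‖(u : ℚ_[p])‖ = 1 := by
  refine le_antisymm (by simpa using Padic.norm_int_le_one (p := p) (u : ℤ)) (not_lt.1 fun h1 => h ?_)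
  exact Padic.norm_natCast_lt_one_iff.1 h1

lemma norm_natCast_le_one (u : ℕ) : ‖(u : ℚ_[p])‖ ≤ 1 := by
  simpa using Padic.norm_int_le_one (p := p) (u : ℤ)

lemma norm_le_of_mul_prime_pow {n : ℕ} {x : ℚ_[p]} (h : ‖(p : ℚ_[p]) ^ (-(n : ℤ)) * x‖ ≤ 1) :
    ‖x‖ ≤ (p : ℝ) ^ (-(n : ℤ)) := by
  rw [norm_mul, norm_prime_zpow_neg] at h
  rw [_root_.zpow_neg, zpow_natCast]
  have h0 : (0 : ℝ) < (p : ℝ) ^ n := pow_pos (prime_pos_real p) n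
  rwa [← one_div, le_div_iff₀ h0, mul_comm]

lemma norm_mul_prime_pow_le {n : ℕ} {x : ℚ_[p]} (h : ‖x‖ ≤ (p : ℝ) ^ (-(n : ℤ))) :
    ‖(p : ℚ_[p]) ^ (-(n : ℤ)) * x‖ ≤ 1 := by
  rw [norm_mul, norm_prime_zpow_neg]
  rw [_root_.zpow_neg, zpow_natCast] at h
  have h0 : (0 : ℝ) < (p : ℝ) ^ n := pow_pos (prime_pos_real p) n
  calc _ ≤ (p : ℝ) ^ n * ((p : ℝ) ^ n)⁻¹ := by gcongr
    _ = 1 := mul_inv_cancel₀ h0.ne'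

lemma shellPoint_injOn {e n : ℕ} (he : e ≤ n) {i j : ℕ × ℕ × ℕ} (hi : i ∈ shellIndex p e n)
    (hj : j ∈ shellIndex p e n) (h : shellPoint p e n i - shellPoint p e n j ∈ intBox p) : i = j := by
  obtain ⟨u, s, x⟩ := i
  obtain ⟨u', s', x'⟩ := j
  simp only [shellIndex, Finset.mem_product, Finset.mem_filter, Finset.mem_range] at hi hj
  have hp0 := prime_ne_zero_padic (p := p)
  have h10 := h (1, 0)
  have h00 := h (0, 0)
  have h11 := h (1, 1)
  simp only [shellPoint, Pi.sub_apply, of_apply, cons_val', cons_val_zero, cons_val_one,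
    cons_val_fin_one] at h10 h00 h11
  have hu : u = u' := by
    refine eq_of_natCast_sub_norm_le (p := p) hi.1.1 hj.1.1 (norm_le_of_mul_prime_pow ?_)
    rwa [mul_sub]
  subst hu
  have hu1 := norm_natCast_eq_one (p := p) hi.1.2
  have hx : x = x' := by
    refine eq_of_natCast_sub_norm_le (p := p) hi.2.2 hj.2.2 (norm_le_of_mul_prime_pow ?_)
    have e1 : -((x : ℚ_[p]) * ((p : ℚ_[p]) ^ (-(n : ℤ)) * u)) -
        -((x' : ℚ_[p]) * ((p : ℚ_[p]) ^ (-(n : ℤ)) * u)) =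
        -(((p : ℚ_[p]) ^ (-(n : ℤ)) * (x - x')) * u) := by ring
    rw [e1, norm_neg, norm_mul, hu1, mul_one] at h11
    exact h11
  have hs : s = s' := by
    refine eq_of_natCast_sub_norm_le (p := p) hi.2.1 hj.2.1 (norm_le_of_mul_prime_pow ?_)
    have e2 : (p : ℚ_[p]) ^ (-(n : ℤ)) * (p : ℚ_[p]) ^ e = (p : ℚ_[p]) ^ (-((n - e : ℕ) : ℤ)) := by
      rw [← zpow_natCast, ← zpow_add₀ hp0]
      congr 1
      lia
    have e1 : (p : ℚ_[p]) ^ (-(n : ℤ)) * u * ((p : ℚ_[p]) ^ e * s) -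
        (p : ℚ_[p]) ^ (-(n : ℤ)) * u * ((p : ℚ_[p]) ^ e * s') =
        ((p : ℚ_[p]) ^ (-(n : ℤ)) * (p : ℚ_[p]) ^ e * (s - s')) * u := by ring
    rw [e1, norm_mul, hu1, mul_one, e2] at h00
    exact h00
  rw [hx, hs]

lemma shellPoint_mem {e n : ℕ} (he : e ≤ n) (hn : 1 ≤ n) {i : ℕ × ℕ × ℕ}
    (hi : i ∈ shellIndex p e n) {x : Fin 2 × Fin 2 → ℚ_[p]}
    (hx : x - shellPoint p e n i ∈ intBox p) : x ∈ columnShell p e n := by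
  obtain ⟨u, s, b⟩ := i
  simp only [shellIndex, Finset.mem_product, Finset.mem_filter, Finset.mem_range] at hi
  have hu1 := norm_natCast_eq_one (p := p) hi.1.2
  have h10 := hx (1, 0)
  have h00 := hx (0, 0)
  simp only [shellPoint, Pi.sub_apply, of_apply, cons_val', cons_val_zero, cons_val_one,
    cons_val_fin_one] at h10 h00
  have hpn : (1 : ℝ) < (p : ℝ) ^ n := one_lt_pow₀ (one_lt_prime_real p) (by lia)
  have hpe : ‖(p : ℚ_[p]) ^ (-(n : ℤ)) * u * ((p : ℚ_[p]) ^ e * s)‖ ≤ (p : ℝ) ^ (n - e) := by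
    rw [norm_mul, norm_mul, norm_mul, norm_prime_zpow_neg, hu1, norm_prime_pow, mul_one]
    have hp0 := prime_pos_real (p := p)
    calc (p : ℝ) ^ n * (((p : ℝ) ^ e)⁻¹ * ‖(s : ℚ_[p])‖) ≤ (p : ℝ) ^ n * (((p : ℝ) ^ e)⁻¹ * 1) := by
          gcongr
          exact norm_natCast_le_one s
      _ = (p : ℝ) ^ (n - e) := by rw [pow_sub₀ _ hp0.ne' he, mul_one]
  constructor
  · have h1 : ‖(p : ℚ_[p]) ^ (-(n : ℤ)) * u‖ = (p : ℝ) ^ n := by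
      rw [norm_mul, hu1, norm_prime_zpow_neg, mul_one]
    rw [← h1, ← sub_add_cancel (x (1, 0)) ((p : ℚ_[p]) ^ (-(n : ℤ)) * u)]
    have h2 : ‖x (1, 0) - (p : ℚ_[p]) ^ (-(n : ℤ)) * u‖ < ‖(p : ℚ_[p]) ^ (-(n : ℤ)) * u‖ := by
      rw [h1]; exact h10.trans_lt hpn
    rw [Padic.add_eq_max_of_ne h2.ne, max_eq_right h2.le]
  · rw [← sub_add_cancel (x (0, 0)) ((p : ℚ_[p]) ^ (-(n : ℤ)) * u * ((p : ℚ_[p]) ^ e * s))]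
    exact (Padic.nonarchimedean _ _).trans (max_le (h00.trans (one_le_prime_pow _)) hpe)

/-- The points of `columnShell p e n` whose second column is congruent to an integral multiple of the
first are those of the cosets indexed by `shellIndex p e n`. -/
lemma exists_shellPoint {e n : ℕ} (he : e ≤ n) (hn : 1 ≤ n) {x : Fin 2 × Fin 2 → ℚ_[p]}
    (hx : x ∈ columnShell p e n) {b : ℚ_[p]} (hb : ‖b‖ ≤ 1)
    (h : ∀ i, ‖x (i, 1) + b * x (i, 0)‖ ≤ 1) :
    ∃ i ∈ shellIndex p e n, x - shellPoint p e n i ∈ intBox p := by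
  obtain ⟨hx1, hx0⟩ := hx
  have hpp := prime_ne_zero_padic (p := p)
  have hp0 := prime_pos_real (p := p)
  have hpn0 : (0 : ℝ) < (p : ℝ) ^ n := pow_pos hp0 n
  have hxne : x (1, 0) ≠ 0 := fun h => by rw [h, norm_zero] at hx1; exact hpn0.ne hx1
  have hy1 : ‖(p : ℚ_[p]) ^ n * x (1, 0)‖ = 1 := by
    rw [norm_mul, norm_prime_pow, hx1, inv_mul_cancel₀ hpn0.ne']
  obtain ⟨u, hu, huy⟩ := exists_natCast_sub_norm_le n hy1.le
  obtain ⟨c, hc, hcb⟩ := exists_natCast_sub_norm_le n hb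
  have ht : ‖x (0, 0) / x (1, 0) / (p : ℚ_[p]) ^ e‖ ≤ 1 := by
    rw [norm_div, norm_div, hx1, norm_prime_pow]
    calc ‖x (0, 0)‖ / (p : ℝ) ^ n / ((p : ℝ) ^ e)⁻¹ ≤
        (p : ℝ) ^ (n - e) / (p : ℝ) ^ n / ((p : ℝ) ^ e)⁻¹ := by gcongr
      _ = 1 := by rw [pow_sub₀ _ hp0.ne' he]; field_simp
  obtain ⟨s, hs, hst⟩ := exists_natCast_sub_norm_le (n - e) ht
  have hsmall : (p : ℝ) ^ (-(n : ℤ)) < 1 := by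
    rw [_root_.zpow_neg, zpow_natCast]
    exact inv_lt_one_of_one_lt₀ (one_lt_pow₀ (one_lt_prime_real p) (by lia))
  have hu1 : ¬ p ∣ u := by
    intro hdvd
    have h1 : ‖(u : ℚ_[p])‖ < 1 := Padic.norm_natCast_lt_one_iff.2 hdvd
    have h2 := (Padic.nonarchimedean ((p : ℚ_[p]) ^ n * x (1, 0) - (u : ℚ_[p])) (u : ℚ_[p]))
    rw [sub_add_cancel, hy1] at h2
    exact absurd h2 (not_le.2 (max_lt (huy.trans_lt hsmall) h1))
  have hun := norm_natCast_eq_one (p := p) hu1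
  -- the four entries of the difference
  have d10 : ‖x (1, 0) - (p : ℚ_[p]) ^ (-(n : ℤ)) * u‖ ≤ 1 := by
    have e1 : x (1, 0) - (p : ℚ_[p]) ^ (-(n : ℤ)) * u =
        (p : ℚ_[p]) ^ (-(n : ℤ)) * ((p : ℚ_[p]) ^ n * x (1, 0) - u) := by
      rw [mul_sub, ← mul_assoc, _root_.zpow_neg, zpow_natCast, inv_mul_cancel₀ (pow_ne_zero _ hpp),
        one_mul]
    rw [e1]
    exact norm_mul_prime_pow_le huy
  have ht0 : ‖x (0, 0) / x (1, 0)‖ ≤ 1 := by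
    rw [norm_div, hx1]
    exact div_le_one_of_le₀ (hx0.trans (pow_le_pow_right₀ (one_lt_prime_real p).le (by lia))) hpn0.le
  have d00 : ‖x (0, 0) - (p : ℚ_[p]) ^ (-(n : ℤ)) * u * ((p : ℚ_[p]) ^ e * s)‖ ≤ 1 := by
    have e2 : (p : ℚ_[p]) ^ (-(n : ℤ)) * (p : ℚ_[p]) ^ e = (p : ℚ_[p]) ^ (-((n - e : ℕ) : ℤ)) := by
      rw [← zpow_natCast, ← zpow_add₀ hpp]
      congr 1
      lia
    have e1 : x (0, 0) - (p : ℚ_[p]) ^ (-(n : ℤ)) * u * ((p : ℚ_[p]) ^ e * s) =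
        x (0, 0) / x (1, 0) * (x (1, 0) - (p : ℚ_[p]) ^ (-(n : ℤ)) * u) +
        ((p : ℚ_[p]) ^ (-((n - e : ℕ) : ℤ)) * (x (0, 0) / x (1, 0) / (p : ℚ_[p]) ^ e - s)) * u := by
      rw [← e2]
      field_simp
      ring
    rw [e1]
    refine (Padic.nonarchimedean _ _).trans (max_le ?_ ?_)
    · rw [norm_mul]; exact mul_le_one₀ ht0 (norm_nonneg _) d10
    · rw [norm_mul, hun, mul_one]; exact norm_mul_prime_pow_le hst
  have key : ∀ y z w : ℚ_[p], ‖w + b * y‖ ≤ 1 → ‖y - z‖ ≤ 1 → ‖z‖ ≤ (p : ℝ) ^ n →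
      ‖w - -(c * z)‖ ≤ 1 := by
    intro y z w h1 h2 h3
    have e1 : w - -(c * z) = (w + b * y) - (b * (y - z) + (b - c) * z) := by ring
    rw [e1]
    refine (padic_norm_sub_le_max _ _).trans (max_le h1 ((Padic.nonarchimedean _ _).trans
      (max_le ?_ ?_)))
    · rw [norm_mul]; exact mul_le_one₀ hb (norm_nonneg _) h2
    · rw [norm_mul]
      rw [_root_.zpow_neg, zpow_natCast] at hcb
      calc _ ≤ ((p : ℝ) ^ n)⁻¹ * (p : ℝ) ^ n := by gcongr
        _ = 1 := inv_mul_cancel₀ hpn0.ne'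
  have z10 : ‖(p : ℚ_[p]) ^ (-(n : ℤ)) * (u : ℚ_[p])‖ ≤ (p : ℝ) ^ n := by
    rw [norm_mul, hun, norm_prime_zpow_neg, mul_one]
  have z00 : ‖(p : ℚ_[p]) ^ (-(n : ℤ)) * u * ((p : ℚ_[p]) ^ e * s)‖ ≤ (p : ℝ) ^ n := by
    rw [norm_mul]
    refine (mul_le_mul z10 ?_ (norm_nonneg _) hpn0.le).trans_eq (mul_one _)
    rw [norm_mul, norm_pow]
    exact mul_le_one₀ (pow_le_one₀ (norm_nonneg _) Padic.norm_p_lt_one.le) (norm_nonneg _)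
      (norm_natCast_le_one s)
  refine ⟨(u, s, c), ?_, ?_⟩
  · simp only [shellIndex, Finset.mem_product, Finset.mem_filter, Finset.mem_range]
    exact ⟨⟨hu, hu1⟩, hs, hc⟩
  · rintro ⟨i, j⟩
    fin_cases i <;> fin_cases j <;>
      simp only [shellPoint, Pi.sub_apply, of_apply, cons_val', cons_val_zero, cons_val_one,
        cons_val_fin_one, Fin.zero_eta, Fin.mk_one]
    · exact d00
    · exact key _ _ _ (h 0) d00 z00
    · exact d10
    · exact key _ _ _ (h 1) d10 z10

lemma card_filter_not_dvd {n : ℕ} (hn : 1 ≤ n) :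
    (((Finset.range (p ^ n)).filter fun u => ¬ p ∣ u).card : ℂ) = (p : ℂ) ^ n - (p : ℂ) ^ (n - 1) := by
  have h1 : ((Finset.range (p ^ n)).filter fun u => ¬ p ∣ u).card = Nat.totient (p ^ n) := by
    rw [Nat.totient_eq_card_coprime]
    congr 1
    refine Finset.filter_congr fun u _ => ?_
    rw [Nat.coprime_pow_left_iff (by lia), hp.out.coprime_iff_not_dvd]
  rw [h1, Nat.totient_prime_pow hp.out (by lia), Nat.cast_mul, Nat.cast_sub hp.out.one_le]
  push_cast
  obtain ⟨n, rfl⟩ := Nat.exists_eq_add_of_le' hn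
  rw [Nat.add_sub_cancel, pow_succ]
  ring

/-- The contribution of `columnShell p e n` to the integral: the sum over `u` gives the number of units
modulo `pⁿ`, the sum over `x` the operator `U_pⁿ` on `v`, and that over `s` the operator `U_pⁿ⁻ᵉ` on
`v'`. -/
lemma IsNewInducedVector.setIntegral_columnShell (hφ : IsNewInducedVector σ σ' v v' φ)
    (h0 : ∀ x, (∀ k ∈ maxCompact p (Fin 2), σ k x = x) → x = 0) {c ε : ℂ}
    (hv : IsIwahoriEigenvector σ v c ε) {ω τ₁ τ₂ : ℂ} (hv' : IsSphericalEigenvector σ' v' ω τ₁ τ₂)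
    (hω : ω ≠ 0) {e n : ℕ} (he : e ≤ n) (hn : 1 ≤ n) (l : V ⊗[ℂ] W →ₗ[ℂ] ℂ) :
    ∫ x in columnShell p e n, l (φ ((weyl4 p)⁻¹ * unip (Matrix.of fun i j => x (i, j))))
        ∂(unipMeasure p) =
      ((p : ℂ) ^ n - (p : ℂ) ^ (n - 1)) * (c / ω) ^ n *
        l (v ⊗ₜ σ' (diagPow p e) (heckeU σ' (n - e) v')) := by
  rw [setIntegral_eq_sum_cosets (shellIndex p e n) (shellPoint p e n)
    (measurableSet_columnShell e n)]
  rotate_left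
  · intro x y hxy
    have e1 : (Matrix.of fun i j => x (i, j)) = (Matrix.of fun i j => y (i, j)) +
        Matrix.of fun i j => (x - y) (i, j) := by
      ext i j; simp
    rw [e1, hφ.bigCell_add _ (X := Matrix.of fun i j => (x - y) (i, j)) fun i j => hxy (i, j)]
  · exact fun i hi j hj => shellPoint_injOn he hi hj
  · intro x hx hne
    obtain ⟨b, hb, hb'⟩ := hφ.bigCell_support h0 (Y := Matrix.of fun i j => x (i, j))
      fun h => hne (by rw [h, map_zero])
    exact exists_shellPoint he hn hx hb hb'
  · exact fun i hi x => shellPoint_mem he hn hi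
  have hval : ∀ i ∈ shellIndex p e n,
      l (φ ((weyl4 p)⁻¹ * unip (Matrix.of fun a b => shellPoint p e n i (a, b)))) =
      l (σ (borel2 (unif p ^ n) 1 (i.2.2 : ℚ_[p])) v ⊗ₜ
        ((ω ^ n)⁻¹ • σ' (diagPow p e) (σ' (borel2 (unif p ^ (n - e)) 1 (i.2.1 : ℚ_[p])) v'))) := by
    rintro ⟨u, s, x⟩ hi
    simp only [shellIndex, Finset.mem_product, Finset.mem_filter, Finset.mem_range] at hi
    have ht : ‖(p : ℚ_[p]) ^ e * (s : ℚ_[p])‖ ≤ 1 := by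
      rw [norm_mul, norm_pow]
      exact mul_le_one₀ (pow_le_one₀ (norm_nonneg _) Padic.norm_p_lt_one.le) (norm_nonneg _)
        (norm_natCast_le_one s)
    have h1 := hφ.bigCell_value h0 hv hv' n (norm_natCast_eq_one (p := p) hi.1.2) ht
      (norm_natCast_le_one x) rfl
    have h2 : (Matrix.of fun a b => shellPoint p e n (u, s, x) (a, b)) =
      !![(p : ℚ_[p]) ^ (-(n : ℤ)) * u * ((p : ℚ_[p]) ^ e * s),
        -(x * ((p : ℚ_[p]) ^ (-(n : ℤ)) * u * ((p : ℚ_[p]) ^ e * s)));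
        (p : ℚ_[p]) ^ (-(n : ℤ)) * u, -(x * ((p : ℚ_[p]) ^ (-(n : ℤ)) * u))] := rfl
    rw [h2, h1]
    congr 2
    have h3 : borel2 1 1 ((p : ℚ_[p]) ^ e * (s : ℚ_[p])) * borel2 1 ((unif p)⁻¹ ^ n) 0 =
        diagPow p e * borel2 (unif p ^ (n - e)) 1 (s : ℚ_[p]) *
          borel2 ((unif p)⁻¹ ^ n) ((unif p)⁻¹ ^ n) 0 := by
      rw [diagPow, borel2_mul, borel2_mul, borel2_mul]
      congr 1
      · rw [← pow_add, Nat.add_sub_cancel' he]; simp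
      · simp
      · simp [unif_val]
    rw [h3, rep_mul_apply, (scalar_zpow_apply hω hv'.scalar n).2, map_smul, rep_mul_apply]
  rw [Finset.sum_congr rfl hval, shellIndex, Finset.sum_product]
  simp only []
  rw [Finset.sum_const, nsmul_eq_mul, card_filter_not_dvd hn, mul_assoc]
  congr 1
  rw [Finset.sum_product, heckeU_apply, map_sum, TensorProduct.tmul_sum, map_sum, Finset.mul_sum]
  refine Finset.sum_congr rfl fun s _ => ?_
  simp only []
  rw [← map_sum, ← TensorProduct.sum_tmul, ← heckeU_apply, hv.heckeU_eq, ← TensorProduct.smul_tmul',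
    TensorProduct.tmul_smul, map_smul, map_smul, smul_eq_mul, smul_eq_mul, div_pow]
  ring

end ValueAtOne

/-! ### A generating function -/

section GeneratingFunction

/-- The generating function of the complete homogeneous symmetric polynomials. -/
lemma hasSum_hsym {z₁ z₂ : ℂ} (h₁ : ‖z₁‖ < 1) (h₂ : ‖z₂‖ < 1) :
    HasSum (hsym z₁ z₂) ((1 - z₁)⁻¹ * (1 - z₂)⁻¹) := by
  have hs : Summable (hsym z₁ z₂) := by
    refine Summable.of_norm_bounded (g := fun n : ℕ => (n + 1) * (max ‖z₁‖ ‖z₂‖) ^ n) ?_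
      (norm_hsym_le (le_max_left _ _) (le_max_right _ _))
    have hr : max ‖z₁‖ ‖z₂‖ < 1 := max_lt h₁ h₂
    have hr0 : 0 ≤ max ‖z₁‖ ‖z₂‖ := (norm_nonneg _).trans (le_max_left _ _)
    have h1 := summable_pow_mul_geometric_of_norm_lt_one 1 (R := ℝ)
      (r := max ‖z₁‖ ‖z₂‖) (by rwa [Real.norm_of_nonneg hr0])
    refine (h1.add (summable_geometric_of_lt_one hr0 hr)).congr fun n => ?_
    ring
  have hg : Summable fun n : ℕ => z₂ ^ n := summable_geometric_of_norm_lt_one h₂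
  have h3 := hs.tsum_eq_zero_add
  simp only [hsym] at h3
  rw [Summable.tsum_add (hs.mul_left z₁) ((summable_nat_add_iff 1).2 hg), tsum_mul_left] at h3
  have h4 := hg.tsum_eq_zero_add
  rw [tsum_geometric_of_norm_lt_one h₂, pow_zero] at h4
  have h5 : 1 - z₁ ≠ 0 := fun h => by
    rw [← sub_eq_zero.1 h, norm_one] at h₁; exact lt_irrefl _ h₁
  have h6 : ∑' n, hsym z₁ z₂ n = (1 - z₁)⁻¹ * (1 - z₂)⁻¹ := by
    rw [eq_inv_mul_iff_mul_eq₀ h5, h4]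
    linear_combination h3
  rw [← h6]
  exact hs.hasSum

lemma hsym_smul (a τ₁ τ₂ : ℂ) (n : ℕ) : hsym (a * τ₁) (a * τ₂) n = a ^ n * hsym τ₁ τ₂ n := by
  induction n with
  | zero => simp [hsym]
  | succ n ih => rw [hsym, hsym, ih]; ring

/-- The symmetric polynomial `hsym` with its index shifted by one. -/
def hsymPred (τ₁ τ₂ : ℂ) : ℕ → ℂ
  | 0 => 0
  | n + 1 => hsym τ₁ τ₂ n

/-- The sum over the denominators `pⁿ` of the first column, with `P = p`. The identity behind it is
`(1 - qτ₁)(1 - qτ₂) = P⁻¹ (1 - Pqτ₁)(1 - Pqτ₂) + (1 - P⁻¹)(1 - P²q²ω)`, where `τ₁ τ₂ = P ω`. -/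
lemma hasSum_shells {P q ω τ₁ τ₂ : ℂ} (hP : P ≠ 0) (hω : τ₁ * τ₂ = P * ω)
    (h₁ : ‖P * q * τ₁‖ < 1) (h₂ : ‖P * q * τ₂‖ < 1) {J : ℕ → ℂ} (L : ℂ) (hJ0 : J 0 = L)
    (hJ : ∀ n, J (n + 1) = (P ^ (n + 1) - P ^ n) * q ^ (n + 1) *
      ((hsym τ₁ τ₂ (n + 1) - ω * hsymPred τ₁ τ₂ n) * L)) :
    HasSum J ((1 - q * τ₁) * (1 - q * τ₂) / ((1 - P * q * τ₁) * (1 - P * q * τ₂)) * L) := by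
  have hs := hasSum_hsym h₁ h₂
  have hs1 := (hasSum_nat_add_iff' 1).2 hs
  have hs2 : HasSum (hsymPred (P * q * τ₁) (P * q * τ₂))
      ((1 - P * q * τ₁)⁻¹ * (1 - P * q * τ₂)⁻¹) := by
    rw [← hasSum_nat_add_iff' 1]
    simpa [hsymPred] using hs
  have hne : ∀ z : ℂ, ‖z‖ < 1 → 1 - z ≠ 0 := fun z hz h => by
    rw [← sub_eq_zero.1 h, norm_one] at hz; exact lt_irrefl _ hz
  rw [← hasSum_nat_add_iff' 1]
  have h3 := ((hs1.sub (hs2.mul_left (P ^ 2 * q ^ 2 * ω))).mul_left ((1 - P⁻¹) * L))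
  have e1 := hne _ h₁
  have e2 := hne _ h₂
  have e3 : ω = τ₁ * τ₂ / P := by rw [hω]; field_simp
  have e4 : (fun n => J (n + 1)) = fun n => (1 - P⁻¹) * L *
      (hsym (P * q * τ₁) (P * q * τ₂) (n + 1) -
        P ^ 2 * q ^ 2 * ω * hsymPred (P * q * τ₁) (P * q * τ₂) n) := by
    funext n
    rw [hJ, hsym_smul]
    cases n with
    | zero =>
      simp only [hsymPred]
      field_simp
      ring
    | succ n =>
      simp only [hsymPred]
      rw [hsym_smul]
      field_simp
      ring
  have e5 : (1 - q * τ₁) * (1 - q * τ₂) / ((1 - P * q * τ₁) * (1 - P * q * τ₂)) * L -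
      ∑ i ∈ Finset.range 1, J i = (1 - P⁻¹) * L * ((1 - P * q * τ₁)⁻¹ * (1 - P * q * τ₂)⁻¹ -
        ∑ i ∈ Finset.range 1, hsym (P * q * τ₁) (P * q * τ₂) i -
          P ^ 2 * q ^ 2 * ω * ((1 - P * q * τ₁)⁻¹ * (1 - P * q * τ₂)⁻¹)) := by
    have e6 : (1 - q * τ₁) * (1 - q * τ₂) = P⁻¹ * ((1 - P * q * τ₁) * (1 - P * q * τ₂)) +
        (1 - P⁻¹) * (1 - P ^ 2 * q ^ 2 * ω) := by
      rw [e3]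
      field_simp
      ring
    have e7 := mul_inv_cancel₀ (mul_ne_zero e1 e2)
    rw [Finset.sum_range_one, Finset.sum_range_one, hJ0, hsym, e6, ← mul_inv, div_eq_mul_inv]
    linear_combination P⁻¹ * L * e7
  rw [e4, e5]
  exact h3

end GeneratingFunction

/-! ### The value at `1` -/

section ValueAtOne

variable {p : ℕ} [hp : Fact p.Prime]
variable {V : Type*} [AddCommGroup V] [Module ℂ V] {σ : Representation ℂ (GL (Fin 2) ℚ_[p]) V}
variable {W : Type*} [AddCommGroup W] [Module ℂ W] {σ' : Representation ℂ (GL (Fin 2) ℚ_[p]) W}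
variable {v : V} {v' : W} {φ : GL4 p → V ⊗[ℂ] W}

/-- The sum of the translates of `v'` over the projective line modulo `pⁿ⁺¹`: the first term comes from
the points `(t, 1)`, the second from the points `(1, s)` with `p ∣ s`. -/
lemma IsSphericalEigenvector.heckeU_add_swap {ω τ₁ τ₂ : ℂ}
    (hv' : IsSphericalEigenvector σ' v' ω τ₁ τ₂) (n : ℕ) :
    heckeU σ' (n + 1) v' + σ' (swap2 p) (σ' (diagPow p 1) (heckeU σ' n v')) =
      (hsym τ₁ τ₂ (n + 1) - ω * hsymPred τ₁ τ₂ n) • v' := by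
  have h1 : σ' (swap2 p) (σ' (diagPow p 1) v') = σ' (borel2 1 (unif p) 0) v' := by
    rw [← rep_mul_apply, ← hv'.maxCompact _ swap2_mem, ← rep_mul_apply, diagPow, pow_one,
      swap2_mul_diag_mul_swap2, hv'.maxCompact _ swap2_mem]
  have h2 : σ' (swap2 p) (σ' (diagPow p 1) (σ' (borel2 1 (unif p) 0) v')) = ω • v' := by
    rw [← rep_mul_apply (g := diagPow p 1), diagPow, borel2_mul]
    simp only [pow_one, mul_one, one_mul, mul_zero, zero_mul, add_zero]
    rw [hv'.scalar, map_smul, hv'.maxCompact _ swap2_mem]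
  cases n with
  | zero =>
    rw [heckeU_zero, h1, hv'.heckeU_succ]
    simp [hsym, hsymPred]
  | succ n =>
    rw [hv'.heckeU_succ, hv'.heckeU_succ, map_sub, map_sub, map_smul, map_smul, map_smul, map_smul,
      h1, h2, hsymPred]
    module

variable (p) in
/-- The matrices whose first column has denominator `pⁿ`. -/
def columnDenom (n : ℕ) : Set (Fin 2 × Fin 2 → ℚ_[p]) :=
  {x | max 1 (max ‖x (0, 0)‖ ‖x (1, 0)‖) = (p : ℝ) ^ n}

lemma measurableSet_columnDenom (n : ℕ) : MeasurableSet (columnDenom p n) :=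
  measurableSet_eq_fun (f := fun x : Fin 2 × Fin 2 → ℚ_[p] => max 1 (max ‖x (0, 0)‖ ‖x (1, 0)‖))
    (by fun_prop) measurable_const

lemma iUnion_columnDenom : ⋃ n, columnDenom p n = Set.univ := by
  refine Set.eq_univ_of_forall fun x => Set.mem_iUnion.2 ?_
  obtain ⟨i, -, -, -, -, -, hi⟩ := exists_eq_zpow_mul_add (x (0, 0))
  obtain ⟨j, -, -, -, -, -, hj⟩ := exists_eq_zpow_mul_add (x (1, 0))
  refine ⟨max i j, ?_⟩
  have h1 : max 1 (max ‖x (0, 0)‖ ‖x (1, 0)‖) = max ((p : ℝ) ^ i) ((p : ℝ) ^ j) := by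
    rw [hi, hj, max_max_max_comm, max_self]
  change _ = _
  rw [h1]
  exact ((pow_right_mono₀ (one_lt_prime_real p).le).map_max).symm

lemma pairwise_disjoint_columnDenom : Pairwise (Function.onFun Disjoint (columnDenom p)) := by
  intro i j hij
  refine Set.disjoint_left.2 fun x hi hj => hij ?_
  have h : (p : ℝ) ^ i = (p : ℝ) ^ j := hi.symm.trans hj
  exact pow_right_injective₀ (prime_pos_real p) (one_lt_prime_real p).ne' h

lemma norm_lt_pow_succ_iff {x : ℚ_[p]} {n : ℕ} : ‖x‖ < (p : ℝ) ^ (n + 1) ↔ ‖x‖ ≤ (p : ℝ) ^ n := by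
  have := Padic.norm_le_pow_iff_norm_lt_pow_add_one x n
  rw [zpow_natCast] at this
  rw [this]
  norm_cast

lemma mulMulEquiv_swap (x : Fin 2 × Fin 2 → ℚ_[p]) :
    mulMulEquiv (swap2 p) 1 x (0, 0) = x (1, 0) ∧ mulMulEquiv (swap2 p) 1 x (1, 0) = x (0, 0) := by
  have h := mulMulEquiv_apply (swap2 p) 1 x
  have h0 := congrFun (congrFun h 0) 0
  have h1 := congrFun (congrFun h 1) 0
  rw [Units.val_one, mul_one, swap2_val] at h0 h1
  simp only [of_apply, Matrix.mul_apply, Fin.sum_univ_two] at h0 h1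
  simp at h0 h1
  exact ⟨h0, h1⟩

lemma columnDenom_succ (n : ℕ) : columnDenom p (n + 1) =
    columnShell p 0 (n + 1) ∪ mulMulEquiv (swap2 p) 1 ⁻¹' columnShell p 1 (n + 1) := by
  ext x
  obtain ⟨h00, h10⟩ := mulMulEquiv_swap x
  have hpn : (1 : ℝ) < (p : ℝ) ^ (n + 1) := one_lt_pow₀ (one_lt_prime_real p) (by lia)
  have hx : x ∈ columnDenom p (n + 1) ↔
      max 1 (max ‖x (0, 0)‖ ‖x (1, 0)‖) = (p : ℝ) ^ (n + 1) := Iff.rfl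
  have hx0 : x ∈ columnShell p 0 (n + 1) ↔
      ‖x (1, 0)‖ = (p : ℝ) ^ (n + 1) ∧ ‖x (0, 0)‖ ≤ (p : ℝ) ^ (n + 1) := Iff.rfl
  have hx1 : x ∈ mulMulEquiv (swap2 p) 1 ⁻¹' columnShell p 1 (n + 1) ↔
      ‖x (0, 0)‖ = (p : ℝ) ^ (n + 1) ∧ ‖x (1, 0)‖ < (p : ℝ) ^ (n + 1) := by
    change (‖mulMulEquiv (swap2 p) 1 x (1, 0)‖ = _ ∧ ‖mulMulEquiv (swap2 p) 1 x (0, 0)‖ ≤ _) ↔ _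
    rw [h10, h00, Nat.add_sub_cancel, norm_lt_pow_succ_iff]
  rw [Set.mem_union, hx, hx0, hx1]
  constructor
  · intro h
    have h1 : ‖x (0, 0)‖ ≤ (p : ℝ) ^ (n + 1) := by
      rw [← h]; exact (le_max_left _ _).trans (le_max_right _ _)
    have h2 : ‖x (1, 0)‖ ≤ (p : ℝ) ^ (n + 1) := by
      rw [← h]; exact (le_max_right _ _).trans (le_max_right _ _)
    rcases h2.eq_or_lt with h3 | h3
    · exact Or.inl ⟨h3, h1⟩
    · refine Or.inr ⟨?_, h3⟩
      by_contra h4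
      exact absurd h (max_lt hpn (max_lt (lt_of_le_of_ne h1 h4) h3)).ne
  · rintro (⟨h1, h2⟩ | ⟨h1, h2⟩)
    · rw [h1, max_eq_right h2, max_eq_right hpn.le]
    · rw [h1, max_eq_left h2.le, max_eq_right hpn.le]

lemma disjoint_columnShell (n : ℕ) :
    Disjoint (columnShell p 0 (n + 1)) (mulMulEquiv (swap2 p) 1 ⁻¹' columnShell p 1 (n + 1)) := by
  refine Set.disjoint_left.2 fun x h1 h2 => ?_
  have h00 := (mulMulEquiv_swap x).1
  have h3 : ‖x (1, 0)‖ ≤ (p : ℝ) ^ n := by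
    have := h2.2
    rwa [h00, Nat.add_sub_cancel] at this
  exact absurd h1.1 (norm_lt_pow_succ_iff.2 h3).ne

lemma measurePreserving_swap :
    MeasurePreserving (mulMulEquiv (swap2 p) 1) (unipMeasure p) (unipMeasure p) := by
  refine ⟨(mulMulEquiv (swap2 p) 1).toHomeomorph.measurable, ?_⟩
  have h := addEquivAddHaarChar_smul_map (unipMeasure p) (mulMulEquiv (swap2 p) 1)
  have h1 : addEquivAddHaarChar (mulMulEquiv (swap2 p) 1) = 1 :=
    mulMulChar_of_mem swap2_mem (one_mem _)
  rwa [h1, one_smul] at h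

lemma setIntegral_preimage_swap {F G : (Fin 2 × Fin 2 → ℚ_[p]) → ℂ}
    (h : ∀ x, F x = G (mulMulEquiv (swap2 p) 1 x)) (S : Set (Fin 2 × Fin 2 → ℚ_[p])) :
    ∫ x in mulMulEquiv (swap2 p) 1 ⁻¹' S, F x ∂(unipMeasure p) = ∫ x in S, G x ∂(unipMeasure p) := by
  have hme : MeasurableEmbedding (mulMulEquiv (swap2 p) 1) :=
    (mulMulEquiv (swap2 p) 1).toHomeomorph.measurableEmbedding
  rw [← measurePreserving_swap.setIntegral_preimage_emb hme G S, funext h]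

/-- The contribution to the integral of the matrices whose first column has denominator `pⁿ⁺¹`: it
is the sum of those where the second entry of the column is maximal and those where it is not, the
latter reduced to the former by exchanging the rows. -/
lemma IsNewInducedVector.setIntegral_columnDenom_succ (hφ : IsNewInducedVector σ σ' v v' φ)
    (h0 : ∀ x, (∀ k ∈ maxCompact p (Fin 2), σ k x = x) → x = 0) {c ε : ℂ}
    (hv : IsIwahoriEigenvector σ v c ε) {ω τ₁ τ₂ : ℂ} (hv' : IsSphericalEigenvector σ' v' ω τ₁ τ₂)
    (hω : ω ≠ 0) (n : ℕ) (l : V ⊗[ℂ] W →ₗ[ℂ] ℂ)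
    (hint : Integrable (fun x : Fin 2 × Fin 2 → ℚ_[p] =>
      l (φ ((weyl4 p)⁻¹ * unip (Matrix.of fun i j => x (i, j))))) (unipMeasure p)) :
    ∫ x in columnDenom p (n + 1), l (φ ((weyl4 p)⁻¹ * unip (Matrix.of fun i j => x (i, j))))
        ∂(unipMeasure p) =
      ((p : ℂ) ^ (n + 1) - (p : ℂ) ^ n) * (c / ω) ^ (n + 1) *
        ((hsym τ₁ τ₂ (n + 1) - ω * hsymPred τ₁ τ₂ n) * l (v ⊗ₜ v')) := by
  have hme : MeasurableEmbedding (mulMulEquiv (swap2 p) 1) :=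
    (mulMulEquiv (swap2 p) 1).toHomeomorph.measurableEmbedding
  have hswap : ∀ x : Fin 2 × Fin 2 → ℚ_[p],
      l (φ ((weyl4 p)⁻¹ * unip (Matrix.of fun i j => x (i, j)))) =
        (l ∘ₗ TensorProduct.map (σ 1) (σ' (swap2 p))) (φ ((weyl4 p)⁻¹ *
          unip (Matrix.of fun i j => mulMulEquiv (swap2 p) 1 x (i, j)))) := by
    intro x
    rw [LinearMap.comp_apply, ← hφ.bigCell_swap]
    congr 4
    have e : (swap2 p).val * (swap2 p).val = 1 := by
      rw [swap2_val]; ext i j; fin_cases i <;> fin_cases j <;> simp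
    rw [mulMulEquiv_apply, Units.val_one, mul_one, ← mul_assoc, e, one_mul]
  rw [columnDenom_succ, setIntegral_union (disjoint_columnShell n)
    ((measurableSet_columnShell _ _).preimage hme.measurable) hint.integrableOn hint.integrableOn,
    hφ.setIntegral_columnShell h0 hv hv' hω (by lia) (by lia)]
  rw [setIntegral_preimage_swap (G := fun x => (l ∘ₗ TensorProduct.map (σ 1) (σ' (swap2 p)))
    (φ ((weyl4 p)⁻¹ * unip (Matrix.of fun i j => x (i, j))))) hswap,
    hφ.setIntegral_columnShell h0 hv hv' hω (by lia) (by lia), ← mul_add,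
    LinearMap.comp_apply, TensorProduct.map_tmul, ← map_add, map_one, Module.End.one_apply,
    ← TensorProduct.tmul_add, Nat.add_sub_cancel, Nat.sub_zero, diagPow, pow_zero, borel2_one,
    map_one, Module.End.one_apply, hv'.heckeU_add_swap, TensorProduct.tmul_smul, map_smul,
    smul_eq_mul]

/-- On the matrices with integral first column the support of the integrand is `M₂(ℤ_p)`. -/
lemma IsNewInducedVector.setIntegral_columnDenom_zero (hφ : IsNewInducedVector σ σ' v v' φ)
    (h0 : ∀ x, (∀ k ∈ maxCompact p (Fin 2), σ k x = x) → x = 0) {c ε : ℂ}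
    (hv : IsIwahoriEigenvector σ v c ε) {ω τ₁ τ₂ : ℂ} (hv' : IsSphericalEigenvector σ' v' ω τ₁ τ₂)
    (l : V ⊗[ℂ] W →ₗ[ℂ] ℂ) :
    ∫ x in columnDenom p 0, l (φ ((weyl4 p)⁻¹ * unip (Matrix.of fun i j => x (i, j))))
        ∂(unipMeasure p) = l (v ⊗ₜ v') := by
  have hmem : ∀ x : Fin 2 × Fin 2 → ℚ_[p], x ∈ columnDenom p 0 ↔ ∀ i, ‖x (i, 0)‖ ≤ 1 := by
    intro x
    change max 1 (max ‖x (0, 0)‖ ‖x (1, 0)‖) = (p : ℝ) ^ 0 ↔ _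
    rw [pow_zero, max_eq_left_iff, max_le_iff, Fin.forall_fin_two]
  rw [setIntegral_eq_sum_cosets {()} (fun _ => 0) (measurableSet_columnDenom 0)]
  · rw [Finset.sum_singleton]
    have h1 := hφ.bigCell_diag h0 hv hv' 0
    have h2 : !![(0 : ℚ_[p]), 0; (p : ℚ_[p]) ^ (-((0 : ℕ) : ℤ)), 0] =
        (Matrix.of fun i j => (0 : Fin 2 × Fin 2 → ℚ_[p]) (i, j)) + !![(0 : ℚ_[p]), 0; 1, 0] := by
      ext i j
      fin_cases i <;> fin_cases j <;> simp
    rw [h2, hφ.bigCell_add _ (entryLE_fin_two (by simp) (by simp) (by simp) (by simp)), diagPow,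
      pow_zero, pow_zero, borel2_one, map_one, map_one] at h1
    rw [h1]
    rfl
  · intro x y hxy
    have e1 : (Matrix.of fun i j => x (i, j)) = (Matrix.of fun i j => y (i, j)) +
        Matrix.of fun i j => (x - y) (i, j) := by
      ext i j; simp
    rw [e1, hφ.bigCell_add _ (X := Matrix.of fun i j => (x - y) (i, j)) fun i j => hxy (i, j)]
  · simp
  · intro x hx hne
    rw [hmem] at hx
    obtain ⟨b, hb, hb'⟩ := hφ.bigCell_support h0 (Y := Matrix.of fun i j => x (i, j))
      fun h => hne (by rw [h, map_zero])
    refine ⟨(), Finset.mem_singleton_self _, ?_⟩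
    rintro ⟨i, j⟩
    rw [sub_zero]
    revert j
    rw [Fin.forall_fin_two]
    refine ⟨hx i, ?_⟩
    have e : x (i, 1) = (x (i, 1) + b * x (i, 0)) - b * x (i, 0) := by ring
    rw [e]
    refine (padic_norm_sub_le_max _ _).trans (max_le (hb' i) ?_)
    rw [norm_mul]
    exact mul_le_one₀ hb (norm_nonneg _) (hx i)
  · intro i _ x hx
    rw [hmem]
    intro a
    simpa using hx (a, 0)

/-- The image of `φ` under the intertwining operator at `1`. -/
lemma IsNewInducedVector.hasIntertwiningIntegral_one (hφ : IsNewInducedVector σ σ' v v' φ)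
    (h0 : ∀ x, (∀ k ∈ maxCompact p (Fin 2), σ k x = x) → x = 0) {c ε : ℂ}
    (hv : IsIwahoriEigenvector σ v c ε) {ω τ₁ τ₂ : ℂ} (hv' : IsSphericalEigenvector σ' v' ω τ₁ τ₂)
    (hω : ω ≠ 0) (h₁ : ‖p * (c / ω) * τ₁‖ < 1) (h₂ : ‖p * (c / ω) * τ₂‖ < 1)
    (hint : ∀ l, IsSmoothFunctional σ σ' l → Integrable (fun x : Fin 2 × Fin 2 → ℚ_[p] =>
      l (φ ((weyl4 p)⁻¹ * unip (Matrix.of fun i j => x (i, j)) * 1))) (unipMeasure p)) :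
    HasIntertwiningIntegral σ σ' φ 1 (((1 - c / ω * τ₁) * (1 - c / ω * τ₂) /
      ((1 - p * (c / ω) * τ₁) * (1 - p * (c / ω) * τ₂))) • (v ⊗ₜ v')) := by
  intro l hl
  refine ⟨hint l hl, ?_⟩
  have hI := hint l hl
  simp only [mul_one] at hI ⊢
  have h3 := hasSum_integral_iUnion (measurableSet_columnDenom (p := p))
    pairwise_disjoint_columnDenom hI.integrableOn
  rw [iUnion_columnDenom, setIntegral_univ] at h3
  have h4 := hasSum_shells (Nat.cast_ne_zero.2 hp.out.ne_zero) hv'.prod_eq h₁ h₂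
    (J := fun n => ∫ x in columnDenom p n,
      l (φ ((weyl4 p)⁻¹ * unip (Matrix.of fun i j => x (i, j)))) ∂(unipMeasure p)) (l (v ⊗ₜ v'))
    (hφ.setIntegral_columnDenom_zero h0 hv hv' l)
    fun n => hφ.setIntegral_columnDenom_succ h0 hv hv' hω n l hI
  rw [h3.unique h4, map_smul, smul_eq_mul]

end ValueAtOne

/-! ### Decompositions of `GL₂(ℚ_p)` by the second row -/

section Decomposition

variable {p : ℕ} [hp : Fact p.Prime]

lemma weyl2_val : (weyl2 p).val = !![0, -1; 1, 0] := rfl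

lemma det_ne_zero_of_row (g : GL (Fin 2) ℚ_[p]) : g.val 1 0 ≠ 0 ∨ g.val 1 1 ≠ 0 := by
  by_contra! h
  have h1 : (GeneralLinearGroup.det g : ℚ_[p]) = 0 := by
    rw [GeneralLinearGroup.val_det_apply, det_fin_two, h.1, h.2]; ring
  exact (GeneralLinearGroup.det g).ne_zero h1

/-- The form used for elements whose second row has its maximum at the last entry only. -/
lemma exists_eq_borel2_mul_lower (g : GL (Fin 2) ℚ_[p]) (d : ℚ_[p]ˣ) (hd : g.val 1 1 = d) :
    ∃ (b : ℚ_[p]) (k : GL (Fin 2) ℚ_[p]), k.val = !![1, 0; g.val 1 0 / g.val 1 1, 1] ∧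
      g = borel2 (GeneralLinearGroup.det g / d) d b * k := by
  obtain ⟨k, hk⟩ : ∃ k : GL (Fin 2) ℚ_[p], k.val = !![1, 0; g.val 1 0 / g.val 1 1, 1] :=
    ⟨GeneralLinearGroup.mkOfDetNeZero _ (by simp [det_fin_two]), rfl⟩
  refine ⟨g.val 0 1, k, hk, Units.ext ?_⟩
  have hd0 := d.ne_zero
  rw [Units.val_mul, borel2_val, hk]
  ext i j
  fin_cases i <;> fin_cases j <;>
    simp [Matrix.mul_apply, Fin.sum_univ_two, hd, GeneralLinearGroup.val_det_apply, det_fin_two,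
      Units.val_div_eq_div_val]
  · field_simp
    ring
  · field_simp

/-- The form used for elements whose second row has its maximum at the first entry. -/
lemma exists_eq_borel2_mul_weyl2 (g : GL (Fin 2) ℚ_[p]) (c : ℚ_[p]ˣ) (hc : g.val 1 0 = c) :
    ∃ b : ℚ_[p], g = borel2 (GeneralLinearGroup.det g / c) c b *
      (weyl2 p * borel2 1 1 (g.val 1 1 / g.val 1 0)) := by
  refine ⟨g.val 0 0, Units.ext ?_⟩
  have hc0 := c.ne_zero
  rw [Units.val_mul, Units.val_mul, borel2_val, borel2_val, weyl2_val]
  ext i j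
  fin_cases i <;> fin_cases j <;>
    simp [Matrix.mul_apply, Fin.sum_univ_two, hc, GeneralLinearGroup.val_det_apply, det_fin_two,
      Units.val_div_eq_div_val]
  · field_simp
    ring
  · field_simp

lemma lower_mem_mirahoric {k : GL (Fin 2) ℚ_[p]} {y : ℚ_[p]} (hk : k.val = !![1, 0; y, 1])
    (hy : ‖y‖ < 1) : k ∈ mirahoric p (1 : Fin 2) 1 := by
  refine mem_mirahoric_fin_two (mem_maxCompact_fin_two ?_ ?_) ?_ ?_
  · rw [hk]; exact entryLE_fin_two (by simp) (by simp) hy.le (by simp)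
  · simp [hk, det_fin_two]
  · simpa [hk] using hy
  · simp [hk]

lemma borel2_one_one_mem_mirahoric {y : ℚ_[p]} (hy : ‖y‖ ≤ 1) :
    borel2 1 1 y ∈ mirahoric p (1 : Fin 2) 1 :=
  mem_mirahoric_fin_two (borel2_mem_maxCompact (by simp) (by simp) hy) (by simp [borel2_val])
    (by simp [borel2_val])

lemma weyl2_mem : weyl2 p ∈ maxCompact p (Fin 2) :=
  mem_maxCompact_fin_two (entryLE_fin_two (by simp) (by simp) (by simp) (by simp))
    (by simp [weyl2_val, det_fin_two])

lemma borel2_scalar_mul (z : ℚ_[p]ˣ) (g : GL (Fin 2) ℚ_[p]) :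
    g * borel2 z z 0 = borel2 z z 0 * g := by
  refine Units.ext ?_
  rw [Units.val_mul, Units.val_mul, borel2_val]
  ext i j
  fin_cases i <;> fin_cases j <;> simp [Matrix.mul_apply, Fin.sum_univ_two, mul_comm]

/-- Among the translates `x + y`, `0 ≤ x < p`, of a `p`-adic integer `y` exactly one is not a
unit. -/
lemma sum_range_translate {M : Type*} [AddCommGroup M] [Module ℂ M] {y : ℚ_[p]} (hy : ‖y‖ ≤ 1)
    (F : ℕ → M) (a b : M) (ha : ∀ x : ℕ, ‖(x : ℚ_[p]) + y‖ = 1 → F x = a)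
    (hb : ∀ x : ℕ, ‖(x : ℚ_[p]) + y‖ ≤ (p : ℝ)⁻¹ → F x = b) :
    ∑ x ∈ Finset.range p, F x = ((p : ℂ) - 1) • a + b := by
  have hinv : (p : ℝ) ^ (-((1 : ℕ) : ℤ)) = (p : ℝ)⁻¹ := by simp
  obtain ⟨x₀, hx₀, h₀⟩ := exists_natCast_sub_norm_le 1 (x := -y) (by simpa using hy)
  rw [pow_one] at hx₀
  rw [hinv] at h₀
  have h₀' : ‖(x₀ : ℚ_[p]) + y‖ ≤ (p : ℝ)⁻¹ := by
    have e : -y - (x₀ : ℚ_[p]) = -((x₀ : ℚ_[p]) + y) := by ring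
    rwa [e, norm_neg] at h₀
  have hle : ∀ x : ℕ, ‖(x : ℚ_[p]) + y‖ ≤ 1 := fun x =>
    (Padic.nonarchimedean _ _).trans (max_le (norm_natCast_le_one x) hy)
  have hother : ∀ x ∈ (Finset.range p).erase x₀, F x = a := by
    intro x hx
    rw [Finset.mem_erase, Finset.mem_range] at hx
    refine ha x ((hle x).antisymm (not_lt.1 fun hlt => hx.1 ?_))
    have h1 : ‖(x : ℚ_[p]) + y‖ ≤ (p : ℝ)⁻¹ := by
      have := Padic.norm_le_pow_iff_norm_lt_pow_add_one ((x : ℚ_[p]) + y) (-1)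
      simpa using this.2 (by simpa using hlt)
    refine eq_of_natCast_sub_norm_le (p := p) (n := 1) (by simpa using hx.2) (by simpa using hx₀) ?_
    rw [hinv]
    have e : (x : ℚ_[p]) - x₀ = (x + y) - (x₀ + y) := by ring
    rw [e]
    exact (padic_norm_sub_le_max _ _).trans (max_le h1 h₀')
  rw [← Finset.add_sum_erase _ _ (Finset.mem_range.2 hx₀), hb x₀ h₀', Finset.sum_congr rfl hother,
    Finset.sum_const, Finset.card_erase_of_mem (Finset.mem_range.2 hx₀), Finset.card_range,
    ← Nat.cast_smul_eq_nsmul ℂ, Nat.cast_sub hp.out.one_le, Nat.cast_one, add_comm]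

end Decomposition

/-! ### The Steinberg representation -/

section Steinberg

variable {p : ℕ} [hp : Fact p.Prime] {χ : ℚ_[p]ˣ →* ℂˣ}

lemma IsSmoothRep.of_steinberg : IsSmoothRep (steinberg χ).toRepresentation := by
  intro f
  obtain ⟨U, hU, h⟩ := f.2.1.1
  exact ⟨U, hU, fun u hu => Subtype.ext (funext fun g => h g u hu)⟩

lemma steinberg_borel2_mul (f : (steinberg χ).toSubmodule) (a d : ℚ_[p]ˣ) (b : ℚ_[p])
    (g : GL (Fin 2) ℚ_[p]) :
    f.1 (borel2 a d b * g) = ((‖(a : ℚ_[p])‖ / ‖(d : ℚ_[p])‖ : ℝ) : ℂ) * χ (a * d) * f.1 g := by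
  rw [f.2.1.2 a d b g]
  have ha : 0 < ‖(a : ℚ_[p])‖ := norm_pos_iff.2 a.ne_zero
  have hd : 0 < ‖(d : ℚ_[p])‖ := norm_pos_iff.2 d.ne_zero
  have h : (‖(a : ℚ_[p])‖ / ‖(d : ℚ_[p])‖) ^ (1 / 2 : ℝ) * ‖(a : ℚ_[p])‖ ^ (1 / 2 : ℝ) *
      ‖(d : ℚ_[p])‖ ^ (-(1 / 2) : ℝ) = ‖(a : ℚ_[p])‖ / ‖(d : ℚ_[p])‖ := by
    rw [Real.div_rpow ha.le hd.le, Real.rpow_neg hd.le, ← Real.sqrt_eq_rpow, ← Real.sqrt_eq_rpow,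
      ← div_eq_mul_inv, div_mul_eq_mul_div, div_div, Real.mul_self_sqrt ha.le,
      Real.mul_self_sqrt hd.le]
  rw [← h]
  simp only [normPow, MonoidHom.coe_mk, OneHom.coe_mk, Units.val_mk0, MonoidHom.mul_apply,
    Units.val_mul, map_mul, Units.val_div_eq_div_val, norm_div]
  push_cast
  ring

lemma steinberg_scalar (f : (steinberg χ).toSubmodule) (z : ℚ_[p]ˣ) :
    (steinberg χ).toRepresentation (borel2 z z 0) f = (χ z : ℂ) ^ 2 • f := by
  refine Subtype.ext (funext fun g => ?_)
  change f.1 (g * borel2 z z 0) = (χ z : ℂ) ^ 2 * f.1 g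
  rw [borel2_scalar_mul, steinberg_borel2_mul, div_self (norm_ne_zero_iff.2 z.ne_zero), map_mul,
    Units.val_mul]
  simp [sq]

/-- `St ⊗ χ` has no nonzero vector `f` fixed by `GL₂(ℤ_p)`: the intertwining integral of such an `f`
at `1` is `f(1)` times the integral of the positive function `max(1, |x|)⁻²`. -/
lemma steinberg_eq_zero_of_fixed (f : (steinberg χ).toSubmodule)
    (hf : ∀ k ∈ maxCompact p (Fin 2), (steinberg χ).toRepresentation k f = f) : f = 0 := by
  have hfk : ∀ g, ∀ k ∈ maxCompact p (Fin 2), f.1 (g * k) = f.1 g := fun g k hk =>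
    congrFun (congrArg Subtype.val (hf k hk)) g
  have hfk1 : ∀ k ∈ maxCompact p (Fin 2), f.1 k = f.1 1 := fun k hk => by
    rw [← hfk 1 k hk, one_mul]
  let G : ℚ_[p] → ℝ := fun x => (max 1 ‖x‖ ^ 2)⁻¹
  have hG0 : ∀ x, 0 < G x := fun x => by positivity
  have hval : ∀ x, f.1 (weyl2 p * borel2 1 1 x * 1) = f.1 1 * G x := by
    intro x
    rw [mul_one]
    by_cases hx : ‖x‖ ≤ 1
    · rw [hfk1 _ (mul_mem weyl2_mem (borel2_mem_maxCompact (by simp) (by simp) hx))]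
      simp [G, max_eq_left hx]
    · rw [not_le] at hx
      have hx0 : x ≠ 0 := fun h => by simp [h] at hx; linarith
      obtain ⟨u, rfl⟩ : ∃ u : ℚ_[p]ˣ, (u : ℚ_[p]) = x := ⟨Units.mk0 x hx0, rfl⟩
      have hv1 : (weyl2 p * borel2 1 1 (u : ℚ_[p])).val = !![0, -1; 1, (u : ℚ_[p])] := by
        rw [Units.val_mul, weyl2_val, borel2_val]
        ext i j
        fin_cases i <;> fin_cases j <;> simp
      obtain ⟨b, k, hk, h⟩ := exists_eq_borel2_mul_lower (weyl2 p * borel2 1 1 (u : ℚ_[p])) u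
        (by rw [hv1]; simp)
      have hdet : GeneralLinearGroup.det (weyl2 p * borel2 1 1 (u : ℚ_[p])) = 1 := by
        refine Units.ext ?_
        rw [GeneralLinearGroup.val_det_apply, hv1]
        simp [det_fin_two]
      have hkm : k ∈ maxCompact p (Fin 2) := maxCompact_of_mem_mirahoric
        (lower_mem_mirahoric hk (by
          rw [hv1]
          simpa using inv_lt_one_of_one_lt₀ hx))
      rw [h, steinberg_borel2_mul, hfk1 _ hkm, hdet]
      simp only [G, max_eq_right hx.le]
      simp
      ring
  by_cases h1 : f.1 1 = 0
  · refine Subtype.ext (funext fun g => ?_)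
    change f.1 g = 0
    by_cases hlt : ‖g.val 1 0‖ < ‖g.val 1 1‖
    · have h0 : g.val 1 1 ≠ 0 := fun h => by
        rw [h, norm_zero] at hlt; exact absurd hlt (norm_nonneg _).not_gt
      obtain ⟨b, k, hk, h⟩ := exists_eq_borel2_mul_lower g (Units.mk0 _ h0) rfl
      have hkm := lower_mem_mirahoric hk (by
        rw [norm_div]; exact (div_lt_one (norm_pos_iff.2 h0)).2 hlt)
      rw [h, steinberg_borel2_mul, hfk1 _ (maxCompact_of_mem_mirahoric hkm), h1, mul_zero]
    · rw [not_lt] at hlt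
      have h0 : g.val 1 0 ≠ 0 := fun h => by
        rcases det_ne_zero_of_row g with h2 | h2
        · exact h2 h
        · rw [h, norm_zero] at hlt; exact h2 (norm_le_zero_iff.1 hlt)
      obtain ⟨b, h⟩ := exists_eq_borel2_mul_weyl2 g (Units.mk0 _ h0) rfl
      have hkm : weyl2 p * borel2 1 1 (g.val 1 1 / g.val 1 0) ∈ maxCompact p (Fin 2) :=
        mul_mem weyl2_mem (borel2_mem_maxCompact (by simp) (by simp) (by
          rw [norm_div]; exact div_le_one_of_le₀ hlt (norm_nonneg _)))
      rw [h, steinberg_borel2_mul, hfk1 _ hkm, h1, mul_zero]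
  · exfalso
    obtain ⟨hint, hzero⟩ := f.2.2 1
    simp only [hval] at hint hzero
    have hGint : Integrable G (padicHaar p) := by
      have h2 := (hint.const_mul (f.1 1)⁻¹).re
      refine h2.congr (Filter.Eventually.of_forall fun x => ?_)
      simp only [← mul_assoc, inv_mul_cancel₀ h1, one_mul]
      exact Complex.ofReal_re _
    have hpos : 0 < ∫ x, G x ∂(padicHaar p) := by
      rw [integral_pos_iff_support_of_nonneg (fun x => (hG0 x).le) hGint]
      have : Function.support G = Set.univ := Set.eq_univ_of_forall fun x => (hG0 x).ne'
      rw [this]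
      exact NeZero.pos _
    rw [integral_const_mul, integral_complex_ofReal, mul_eq_zero] at hzero
    rcases hzero with h2 | h2
    · exact h1 h2
    · exact hpos.ne' (by exact_mod_cast h2)

end Steinberg

/-! ### The new vector and the spherical vector -/

section NewVectors

variable {p : ℕ} [hp : Fact p.Prime]

lemma val_mul_atkinLehner (g : GL (Fin 2) ℚ_[p]) :
    (g * atkinLehner p).val 1 0 = p * g.val 1 1 ∧ (g * atkinLehner p).val 1 1 = g.val 1 0 := by
  rw [Units.val_mul, atkinLehner_val]
  simp [Matrix.mul_apply, Fin.sum_univ_two, mul_comm]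

lemma val_mul_borel2 (g : GL (Fin 2) ℚ_[p]) (a d : ℚ_[p]ˣ) (b : ℚ_[p]) :
    (g * borel2 a d b).val 1 0 = a * g.val 1 0 ∧
      (g * borel2 a d b).val 1 1 = b * g.val 1 0 + d * g.val 1 1 := by
  rw [Units.val_mul, borel2_val]
  simp [Matrix.mul_apply, Fin.sum_univ_two, mul_comm]

lemma det_borel2 (a d : ℚ_[p]ˣ) (b : ℚ_[p]) : GeneralLinearGroup.det (borel2 a d b) = a * d := by
  refine Units.ext ?_
  rw [GeneralLinearGroup.val_det_apply, borel2_val]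
  simp [det_fin_two]

lemma det_atkinLehner : GeneralLinearGroup.det (atkinLehner p) = -unif p := by
  refine Units.ext ?_
  rw [GeneralLinearGroup.val_det_apply, atkinLehner_val]
  simp [det_fin_two, unif_val]

lemma IsUnramified.map_neg {χ : ℚ_[p]ˣ →* ℂˣ} (hχ : IsUnramified χ) (u : ℚ_[p]ˣ) :
    χ (-u) = χ u := by
  rw [← neg_one_mul, map_mul, hχ (-1) (by simp), one_mul]

variable (p) in
/-- The dependence of the new vector of `St ⊗ χ` on the second row of its argument. -/
def steinbergRow (c d : ℚ_[p]) : ℝ :=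
  if ‖c‖ < ‖d‖ then (‖d‖ ^ 2)⁻¹ else -(p * ‖c‖ ^ 2)⁻¹

/-- Explicit formula for the new vector of `St ⊗ χ`. -/
lemma IsSteinbergNewVector.apply_eq {χ : ℚ_[p]ˣ →* ℂˣ} {v : (steinberg χ).toSubmodule}
    (hv : IsSteinbergNewVector v) (g : GL (Fin 2) ℚ_[p]) :
    v.1 g = χ (GeneralLinearGroup.det g) *
      ((‖(GeneralLinearGroup.det g : ℚ_[p])‖ * steinbergRow p (g.val 1 0) (g.val 1 1) : ℝ) : ℂ) := by
  have hvk : ∀ g, ∀ k ∈ mirahoric p (1 : Fin 2) 1, v.1 (g * k) = v.1 g := fun g k hk =>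
    congrFun (congrArg Subtype.val (hv.invariant k hk)) g
  by_cases hlt : ‖g.val 1 0‖ < ‖g.val 1 1‖
  · have h0 : g.val 1 1 ≠ 0 := fun h => by
      rw [h, norm_zero] at hlt; exact absurd hlt (norm_nonneg _).not_gt
    obtain ⟨b, k, hk, h⟩ := exists_eq_borel2_mul_lower g (Units.mk0 _ h0) rfl
    have hkm := lower_mem_mirahoric hk (by
      rw [norm_div]; exact (div_lt_one (norm_pos_iff.2 h0)).2 hlt)
    have h1 : v.1 k = 1 := by rw [← one_mul k, hvk _ _ hkm, hv.apply_one]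
    conv_lhs => rw [h]
    rw [steinberg_borel2_mul, h1, div_mul_cancel, steinbergRow, if_pos hlt,
      Units.val_div_eq_div_val, norm_div, Units.val_mk0, mul_one, div_div, ← sq, mul_comm,
      div_eq_mul_inv]
  · rw [not_lt] at hlt
    have h0 : g.val 1 0 ≠ 0 := fun h => by
      rcases det_ne_zero_of_row g with h2 | h2
      · exact h2 h
      · rw [h, norm_zero] at hlt; exact h2 (norm_le_zero_iff.1 hlt)
    obtain ⟨b, h⟩ := exists_eq_borel2_mul_weyl2 g (Units.mk0 _ h0) rfl
    have h1 : v.1 (weyl2 p * borel2 1 1 (g.val 1 1 / g.val 1 0)) = -1 / p := by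
      rw [hvk _ _ (borel2_one_one_mem_mirahoric (by
        rw [norm_div]; exact div_le_one_of_le₀ hlt (norm_nonneg _))), hv.apply_weyl]
    conv_lhs => rw [h]
    rw [steinberg_borel2_mul, h1, div_mul_cancel, steinbergRow, if_neg hlt.not_gt,
      Units.val_div_eq_div_val, norm_div, Units.val_mk0]
    push_cast
    field_simp

lemma norm_le_inv_mul_of_lt {c d : ℚ_[p]} (h : ‖c‖ < ‖d‖) : ‖c‖ ≤ (p : ℝ)⁻¹ * ‖d‖ := by
  have hd0 : 0 < ‖d‖ := (norm_nonneg _).trans_lt h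
  have h1 : ‖c / d‖ < 1 := by rwa [norm_div, div_lt_one hd0]
  have h2 := (Padic.norm_le_pow_iff_norm_lt_pow_add_one (c / d) (-1)).2 (by simpa using h1)
  rw [norm_div, div_le_iff₀ hd0] at h2
  simpa using h2

lemma steinbergRow_atkinLehner (c d : ℚ_[p]) :
    steinbergRow p (p * d) c = -(p * steinbergRow p c d) := by
  have hp0 := prime_pos_real p
  have h1 : ‖(p : ℚ_[p]) * d‖ = (p : ℝ)⁻¹ * ‖d‖ := by rw [norm_mul, Padic.norm_p]
  rw [steinbergRow, steinbergRow, h1]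
  by_cases h : ‖c‖ < ‖d‖
  · have h2 : ¬ (p : ℝ)⁻¹ * ‖d‖ < ‖c‖ := by
      rw [not_lt, le_inv_mul_iff₀ hp0]
      calc (p : ℝ) * ‖c‖ ≤ p * ((p : ℝ)⁻¹ * ‖d‖) := by gcongr; exact norm_le_inv_mul_of_lt h
        _ = ‖d‖ := mul_inv_cancel_left₀ hp0.ne' _
    rw [if_neg h2, if_pos h]
    have : 0 < ‖d‖ := (norm_nonneg _).trans_lt h
    field_simp
  · rw [not_lt] at h
    rcases (norm_nonneg c).eq_or_lt with h0 | h0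
    · rw [← h0] at h ⊢
      have hd : ‖d‖ = 0 := le_antisymm h (norm_nonneg _)
      simp [hd]
    · have h2 : (p : ℝ)⁻¹ * ‖d‖ < ‖c‖ := by
        calc (p : ℝ)⁻¹ * ‖d‖ ≤ (p : ℝ)⁻¹ * ‖c‖ := by gcongr
          _ < 1 * ‖c‖ := by
            gcongr
            exact inv_lt_one_of_one_lt₀ (one_lt_prime_real p)
          _ = ‖c‖ := one_mul _
      rw [if_pos h2, if_neg h.not_gt]
      field_simp

lemma sum_steinbergRow {c d : ℚ_[p]} (h : c ≠ 0 ∨ d ≠ 0) :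
    ∑ x ∈ Finset.range p, (steinbergRow p (p * c) (x * c + d) : ℂ) = p * steinbergRow p c d := by
  have hp0 := prime_pos_real p
  have hp1 : (p : ℝ)⁻¹ < 1 := inv_lt_one_of_one_lt₀ (one_lt_prime_real p)
  have h1 : ‖(p : ℚ_[p]) * c‖ = (p : ℝ)⁻¹ * ‖c‖ := by rw [norm_mul, Padic.norm_p]
  by_cases hlt : ‖c‖ < ‖d‖
  · rw [Finset.sum_congr rfl (g := fun _ => (steinbergRow p c d : ℂ)), Finset.sum_const,
      Finset.card_range, nsmul_eq_mul]
    intro x _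
    have h2 : ‖(x : ℚ_[p]) * c‖ < ‖d‖ := by
      rw [norm_mul]
      exact (mul_le_of_le_one_left (norm_nonneg _) (norm_natCast_le_one x)).trans_lt hlt
    have h3 : ‖(x : ℚ_[p]) * c + d‖ = ‖d‖ := by
      rw [Padic.add_eq_max_of_ne h2.ne, max_eq_right h2.le]
    have h4 : ‖(p : ℚ_[p]) * c‖ < ‖d‖ := by
      rw [h1]
      exact (mul_le_of_le_one_left (norm_nonneg _) hp1.le).trans_lt hlt
    rw [steinbergRow, steinbergRow, h3, if_pos h4, if_pos hlt]
  · have hle := not_lt.1 hlt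
    have hc : c ≠ 0 := fun h0 => by
      rcases h with h | h
      · exact h h0
      · rw [h0, norm_zero] at hle; exact h (norm_le_zero_iff.1 hle)
    have hc0 : 0 < ‖c‖ := norm_pos_iff.2 hc
    have hy : ‖d / c‖ ≤ 1 := by rw [norm_div]; exact div_le_one_of_le₀ hle hc0.le
    have e : ∀ x : ℕ, (x : ℚ_[p]) * c + d = (x + d / c) * c := fun x => by field_simp
    have key : ∀ x : ℕ, ‖(p : ℚ_[p]) * c‖ < ‖(x : ℚ_[p]) * c + d‖ ↔
        (p : ℝ)⁻¹ < ‖(x : ℚ_[p]) + d / c‖ := fun x => by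
      rw [h1, e, norm_mul]
      exact mul_lt_mul_iff_left₀ hc0
    rw [sum_range_translate hy _ (((‖c‖ ^ 2)⁻¹ : ℝ) : ℂ) ((-(p * ((p : ℝ)⁻¹ * ‖c‖) ^ 2)⁻¹ : ℝ) : ℂ)]
    · rw [steinbergRow, if_neg hlt, smul_eq_mul]
      push_cast
      have hpc : (p : ℂ) ≠ 0 := Nat.cast_ne_zero.2 hp.out.ne_zero
      have hcc : (‖c‖ : ℂ) ≠ 0 := by exact_mod_cast hc0.ne'
      field_simp
      ring
    · intro x hx
      rw [steinbergRow, if_pos ((key x).2 (by rw [hx]; exact hp1)), e, norm_mul, hx, one_mul]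
    · intro x hx
      rw [steinbergRow, if_neg (fun h => absurd ((key x).1 h) hx.not_gt), h1]

lemma IsSteinbergNewVector.isIwahoriEigenvector {χ : ℚ_[p]ˣ →* ℂˣ} (hχ : IsUnramified χ)
    {v : (steinberg χ).toSubmodule} (hv : IsSteinbergNewVector v) :
    IsIwahoriEigenvector (steinberg χ).toRepresentation v (χ (unif p)) (-χ (unif p)) where
  mirahoric := hv.invariant
  unit_scalar u hu := by rw [steinberg_scalar, hχ u hu]; simp
  scalar := steinberg_scalar v (unif p)
  hecke := by
    refine Subtype.ext (funext fun g => ?_)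
    have h1 : (heckeU (steinberg χ).toRepresentation 1 v).1 g =
        ∑ x ∈ Finset.range p, v.1 (g * borel2 (unif p) 1 (x : ℚ_[p])) := by
      rw [heckeU_apply, pow_one, pow_one, AddSubmonoidClass.coe_finsetSum, Finset.sum_apply]
      rfl
    have h2 : ∀ x : ℕ, v.1 (g * borel2 (unif p) 1 (x : ℚ_[p])) =
        χ (unif p) * χ (GeneralLinearGroup.det g) *
          ((‖(GeneralLinearGroup.det g : ℚ_[p])‖ * (p : ℝ)⁻¹ : ℝ) : ℂ) *
          (steinbergRow p (p * g.val 1 0) (x * g.val 1 0 + g.val 1 1) : ℂ) := by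
      intro x
      rw [hv.apply_eq, (val_mul_borel2 g _ _ _).1, (val_mul_borel2 g _ _ _).2, map_mul, det_borel2,
        mul_one, map_mul, unif_val, Units.val_one, one_mul, Units.val_mul, Units.val_mul, unif_val,
        norm_mul, Padic.norm_p]
      push_cast
      ring
    rw [h1, Finset.sum_congr rfl fun x _ => h2 x, ← Finset.mul_sum,
      sum_steinbergRow (det_ne_zero_of_row g)]
    change _ = (χ (unif p) : ℂ) * v.1 g
    rw [hv.apply_eq]
    have hpc : (p : ℂ) ≠ 0 := Nat.cast_ne_zero.2 hp.out.ne_zero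
    push_cast
    field_simp
  atkinLehner := by
    refine Subtype.ext (funext fun g => ?_)
    change v.1 (g * atkinLehner p) = -(χ (unif p) : ℂ) * v.1 g
    rw [hv.apply_eq, hv.apply_eq, (val_mul_atkinLehner g).1, (val_mul_atkinLehner g).2, map_mul,
      det_atkinLehner, map_mul, hχ.map_neg, steinbergRow_atkinLehner, Units.val_mul, Units.val_mul,
      Units.val_neg, unif_val, norm_mul, norm_neg, Padic.norm_p]
    have hpc : (p : ℂ) ≠ 0 := Nat.cast_ne_zero.2 hp.out.ne_zero
    push_cast
    field_simp

lemma neg_unif_ne_zero {χ : ℚ_[p]ˣ →* ℂˣ} : (-(χ (unif p) : ℂ)) ≠ 0 :=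
  neg_ne_zero.2 (χ (unif p)).ne_zero

/-- The value at an element of determinant `δ` of the spherical vector of `I(μ₁, μ₂)`, where `d` is
an entry of the second row of maximal norm. -/
def sphericalValue (μ₁ μ₂ : ℚ_[p]ˣ →* ℂˣ) (δ d : ℚ_[p]ˣ) : ℂ :=
  normPow p (1 / 2) (δ / d / d) * μ₁ (δ / d) * μ₂ d

lemma sphericalValue_mul {μ₁ μ₂ : ℚ_[p]ˣ →* ℂˣ} (h₁ : IsUnramified μ₁) (h₂ : IsUnramified μ₂)
    {δ d u : ℚ_[p]ˣ} (hu : ‖(u : ℚ_[p])‖ = 1) :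
    sphericalValue μ₁ μ₂ δ (u * d) = sphericalValue μ₁ μ₂ δ d := by
  have h3 : μ₁ (δ / (u * d)) = μ₁ (δ / d) := by
    rw [map_div, map_mul, h₁ u hu, one_mul, map_div]
  have h4 : normPow p (1 / 2) (δ / (u * d) / (u * d)) = normPow p (1 / 2) (δ / d / d) := by
    refine Units.ext ?_
    simp [normPow, Units.val_div_eq_div_val, hu]
  rw [sphericalValue, sphericalValue, h3, h4, map_mul, h₂ u hu, one_mul]

/-- Explicit formula for the spherical vector of `I(μ₁, μ₂)`. -/
lemma IsSphericalVector.apply_eq {μ₁ μ₂ : ℚ_[p]ˣ →* ℂˣ} (h₁ : IsUnramified μ₁) (h₂ : IsUnramified μ₂)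
    {v : (principalSeries μ₁ μ₂).toSubmodule}
    (hv : IsSphericalVector v) (g : GL (Fin 2) ℚ_[p]) (d : ℚ_[p]ˣ)
    (hd : max ‖g.val 1 0‖ ‖g.val 1 1‖ = ‖(d : ℚ_[p])‖) :
    v.1 g = sphericalValue μ₁ μ₂ (GeneralLinearGroup.det g) d := by
  have hvk : ∀ k ∈ maxCompact p (Fin 2), v.1 k = 1 := fun k hk => by
    rw [← hv.apply_one, ← one_mul k]
    exact congrFun (congrArg Subtype.val (hv.invariant k (mem_mirahoric_zero.2 hk))) 1
  have hd0 : 0 < ‖(d : ℚ_[p])‖ := norm_pos_iff.2 d.ne_zero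
  have hunit : ∀ x : ℚ_[p], ‖x‖ = ‖(d : ℚ_[p])‖ → ∃ u : ℚ_[p]ˣ, ‖(u : ℚ_[p])‖ = 1 ∧
      x = ((u * d : ℚ_[p]ˣ) : ℚ_[p]) := by
    intro x hx
    have hx0 : x ≠ 0 := fun h => by rw [h, norm_zero] at hx; exact hd0.ne hx
    refine ⟨Units.mk0 (x / d) (div_ne_zero hx0 d.ne_zero), ?_, ?_⟩
    · rw [Units.val_mk0, norm_div, hx, div_self hd0.ne']
    · rw [Units.val_mul, Units.val_mk0, div_mul_cancel₀ _ d.ne_zero]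
  by_cases hlt : ‖g.val 1 0‖ < ‖g.val 1 1‖
  · rw [max_eq_right hlt.le] at hd
    obtain ⟨u, hu, hud⟩ := hunit _ hd
    obtain ⟨b, k, hk, h⟩ := exists_eq_borel2_mul_lower g (u * d) hud
    have hkm := lower_mem_mirahoric hk (by
      rw [norm_div]; exact (div_lt_one ((norm_nonneg _).trans_lt hlt)).2 hlt)
    conv_lhs => rw [h]
    rw [v.2.2, hvk _ (maxCompact_of_mem_mirahoric hkm), mul_one, ← sphericalValue_mul h₁ h₂ hu]
    rfl
  · rw [not_lt] at hlt
    rw [max_eq_left hlt] at hd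
    obtain ⟨u, hu, hud⟩ := hunit _ hd
    obtain ⟨b, h⟩ := exists_eq_borel2_mul_weyl2 g (u * d) hud
    conv_lhs => rw [h]
    rw [v.2.2, hvk _ (mul_mem weyl2_mem (borel2_mem_maxCompact (by simp) (by simp) (by
      rw [norm_div]; exact div_le_one_of_le₀ hlt (norm_nonneg _)))), mul_one,
      ← sphericalValue_mul h₁ h₂ hu]
    rfl

variable (p) in
/-- The positive square root of `p`, as a complex number. -/
def sqrtPrime : ℂ := ((p : ℝ) ^ (1 / 2 : ℝ) : ℝ)

lemma sqrtPrime_sq : sqrtPrime p ^ 2 = p := by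
  rw [sqrtPrime, ← Real.sqrt_eq_rpow, ← Complex.ofReal_pow, Real.sq_sqrt (prime_pos_real p).le,
    Complex.ofReal_natCast]

lemma sqrtPrime_ne_zero : sqrtPrime p ≠ 0 := fun h => by
  have := sqrtPrime_sq (p := p)
  rw [h] at this
  exact hp.out.ne_zero (by simpa using this.symm)

lemma normPow_unif : (normPow p (1 / 2) (unif p) : ℂ) = (sqrtPrime p)⁻¹ := by
  simp [normPow, unif_val, sqrtPrime, Real.inv_rpow (prime_pos_real p).le]

lemma sphericalValue_unif (μ₁ μ₂ : ℚ_[p]ˣ →* ℂˣ) (δ d : ℚ_[p]ˣ) :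
    sphericalValue μ₁ μ₂ (δ * unif p) d =
        (sqrtPrime p)⁻¹ * μ₁ (unif p) * sphericalValue μ₁ μ₂ δ d ∧
      sphericalValue μ₁ μ₂ (δ * unif p) (unif p * d) =
        sqrtPrime p * μ₂ (unif p) * sphericalValue μ₁ μ₂ δ d := by
  constructor
  · have e1 : δ * unif p / d / d = unif p * (δ / d / d) := by
      rw [mul_comm, mul_div_assoc, mul_div_assoc]
    have e2 : δ * unif p / d = unif p * (δ / d) := by rw [mul_comm, mul_div_assoc]
    rw [sphericalValue, e1, e2, map_mul, map_mul, Units.val_mul, Units.val_mul, normPow_unif,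
      sphericalValue]
    ring
  · have e2 : δ * unif p / (unif p * d) = δ / d := by
      rw [mul_comm, mul_div_mul_left_eq_div]
    have e1 : δ * unif p / (unif p * d) / (unif p * d) = (unif p)⁻¹ * (δ / d / d) := by
      rw [e2, mul_comm (unif p) d, ← div_div, div_eq_inv_mul _ (unif p)]
    rw [sphericalValue, e1, e2, map_mul, map_mul, map_inv, Units.val_mul, Units.val_mul,
      Units.val_inv_eq_inv_val, normPow_unif, inv_inv, sphericalValue]
    ring

lemma IsSphericalVector.hecke {μ₁ μ₂ : ℚ_[p]ˣ →* ℂˣ} (h₁ : IsUnramified μ₁) (h₂ : IsUnramified μ₂)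
    {v : (principalSeries μ₁ μ₂).toSubmodule} (hv : IsSphericalVector v) (g : GL (Fin 2) ℚ_[p]) :
    ∑ x ∈ Finset.range p, v.1 (g * borel2 (unif p) 1 (x : ℚ_[p])) + v.1 (g * borel2 1 (unif p) 0) =
      (sqrtPrime p * μ₁ (unif p) + sqrtPrime p * μ₂ (unif p)) * v.1 g := by
  have hp1 : (p : ℝ)⁻¹ < 1 := inv_lt_one_of_one_lt₀ (one_lt_prime_real p)
  have hs := sqrtPrime_sq (p := p)
  have hs0 := sqrtPrime_ne_zero (p := p)
  have hpc : (p : ℂ) ≠ 0 := Nat.cast_ne_zero.2 hp.out.ne_zero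
  have hdet : ∀ x : ℚ_[p], GeneralLinearGroup.det (g * borel2 (unif p) 1 x) =
      GeneralLinearGroup.det g * unif p := fun x => by rw [map_mul, det_borel2, mul_one]
  have hdet' : GeneralLinearGroup.det (g * borel2 1 (unif p) 0) =
      GeneralLinearGroup.det g * unif p := by rw [map_mul, det_borel2, one_mul]
  have hr0 : ∀ x : ℚ_[p], (g * borel2 (unif p) 1 x).val 1 0 = p * g.val 1 0 := fun x => by
    rw [(val_mul_borel2 g _ _ _).1, unif_val]
  have hr1 : ∀ x : ℚ_[p], (g * borel2 (unif p) 1 x).val 1 1 = x * g.val 1 0 + g.val 1 1 := fun x => by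
    rw [(val_mul_borel2 g _ _ _).2, Units.val_one, one_mul]
  have hr0' : (g * borel2 1 (unif p) 0).val 1 0 = g.val 1 0 := by
    rw [(val_mul_borel2 g _ _ _).1, Units.val_one, one_mul]
  have hr1' : (g * borel2 1 (unif p) 0).val 1 1 = p * g.val 1 1 := by
    rw [(val_mul_borel2 g _ _ _).2, unif_val, zero_mul, zero_add]
  have hp0 := prime_pos_real p
  have hpn : ∀ x : ℚ_[p], ‖(p : ℚ_[p]) * x‖ = (p : ℝ)⁻¹ * ‖x‖ := fun x => by
    rw [norm_mul, Padic.norm_p]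
  have hple : ∀ x : ℚ_[p], (p : ℝ)⁻¹ * ‖x‖ ≤ ‖x‖ := fun x =>
    mul_le_of_le_one_left (norm_nonneg _) hp1.le
  have hA : ∀ (x : ℕ) (d : ℚ_[p]ˣ), max ‖(p : ℚ_[p]) * g.val 1 0‖ ‖(x : ℚ_[p]) * g.val 1 0 + g.val 1 1‖ =
      ‖(d : ℚ_[p])‖ → v.1 (g * borel2 (unif p) 1 (x : ℚ_[p])) =
        sphericalValue μ₁ μ₂ (GeneralLinearGroup.det g * unif p) d := fun x d h => by
    rw [hv.apply_eq h₁ h₂ _ d (by rw [hr0, hr1, h]), hdet]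
  have hB : ∀ d : ℚ_[p]ˣ, max ‖g.val 1 0‖ ‖(p : ℚ_[p]) * g.val 1 1‖ = ‖(d : ℚ_[p])‖ →
      v.1 (g * borel2 1 (unif p) 0) =
        sphericalValue μ₁ μ₂ (GeneralLinearGroup.det g * unif p) d := fun d h => by
    rw [hv.apply_eq h₁ h₂ _ d (by rw [hr0', hr1', h]), hdet']
  have hpd : ∀ d : ℚ_[p]ˣ, ‖((unif p * d : ℚ_[p]ˣ) : ℚ_[p])‖ = (p : ℝ)⁻¹ * ‖(d : ℚ_[p])‖ :=
    fun d => by rw [Units.val_mul, unif_val, hpn]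
  by_cases hlt : ‖g.val 1 0‖ < ‖g.val 1 1‖
  · obtain ⟨d, hd⟩ : ∃ d : ℚ_[p]ˣ, g.val 1 1 = d :=
      ⟨Units.mk0 _ (norm_pos_iff.1 ((norm_nonneg _).trans_lt hlt)), rfl⟩
    rw [hd] at hlt
    have hA' : ∀ x : ℕ, v.1 (g * borel2 (unif p) 1 (x : ℚ_[p])) =
        sphericalValue μ₁ μ₂ (GeneralLinearGroup.det g * unif p) d := by
      refine fun x => hA x d ?_
      have h2 : ‖(x : ℚ_[p]) * g.val 1 0‖ < ‖(d : ℚ_[p])‖ := by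
        rw [norm_mul]
        exact (mul_le_of_le_one_left (norm_nonneg _) (norm_natCast_le_one x)).trans_lt hlt
      rw [hd, Padic.add_eq_max_of_ne h2.ne, max_eq_right h2.le, hpn]
      exact max_eq_right ((hple _).trans hlt.le)
    have hB' := hB (unif p * d) (by
      rw [hd, hpn, hpd]; exact max_eq_right (norm_le_inv_mul_of_lt hlt))
    rw [Finset.sum_congr rfl fun x _ => hA' x, Finset.sum_const, Finset.card_range, nsmul_eq_mul, hB',
      hv.apply_eq h₁ h₂ g d (by rw [hd]; exact max_eq_right hlt.le), (sphericalValue_unif μ₁ μ₂ _ d).1,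
      (sphericalValue_unif μ₁ μ₂ _ d).2, ← hs]
    field_simp
  · have hle := not_lt.1 hlt
    have h0 : g.val 1 0 ≠ 0 := fun h => by
      rcases det_ne_zero_of_row g with h2 | h2
      · exact h2 h
      · rw [h, norm_zero] at hle; exact h2 (norm_le_zero_iff.1 hle)
    obtain ⟨c, hc⟩ : ∃ c : ℚ_[p]ˣ, g.val 1 0 = c := ⟨Units.mk0 _ h0, rfl⟩
    rw [hc] at hle
    have hc0 : 0 < ‖(c : ℚ_[p])‖ := norm_pos_iff.2 c.ne_zero
    have hy : ‖g.val 1 1 / c‖ ≤ 1 := by rw [norm_div]; exact div_le_one_of_le₀ hle hc0.le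
    have e : ∀ x : ℕ, ‖(x : ℚ_[p]) * c + g.val 1 1‖ =
        ‖(x : ℚ_[p]) + g.val 1 1 / c‖ * ‖(c : ℚ_[p])‖ := fun x => by
      rw [← norm_mul]
      congr 1
      have := c.ne_zero
      field_simp
    have hB' := hB c (by rw [hc, hpn]; exact max_eq_left ((hple _).trans hle))
    rw [sum_range_translate hy _ (sphericalValue μ₁ μ₂ (GeneralLinearGroup.det g * unif p) c)
      (sphericalValue μ₁ μ₂ (GeneralLinearGroup.det g * unif p) (unif p * c)), hB',
      hv.apply_eq h₁ h₂ g c (by rw [hc]; exact max_eq_left hle), (sphericalValue_unif μ₁ μ₂ _ c).1,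
      (sphericalValue_unif μ₁ μ₂ _ c).2, ← hs, smul_eq_mul]
    · field_simp
      ring
    · intro x hx
      refine hA x c ?_
      rw [hc, hpn, e, hx, one_mul]
      exact max_eq_right (hple _)
    · intro x hx
      refine hA x (unif p * c) ?_
      rw [hc, hpn, hpd, e]
      exact max_eq_left (by gcongr)

lemma IsSphericalVector.isSphericalEigenvector {μ₁ μ₂ : ℚ_[p]ˣ →* ℂˣ} (h₁ : IsUnramified μ₁)
    (h₂ : IsUnramified μ₂) {v : (principalSeries μ₁ μ₂).toSubmodule} (hv : IsSphericalVector v) :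
    IsSphericalEigenvector (principalSeries μ₁ μ₂).toRepresentation v
      (μ₁ (unif p) * μ₂ (unif p)) (sqrtPrime p * μ₁ (unif p)) (sqrtPrime p * μ₂ (unif p)) where
  maxCompact k hk := hv.invariant k (mem_mirahoric_zero.2 hk)
  scalar := by
    refine Subtype.ext (funext fun g => ?_)
    change v.1 (g * borel2 (unif p) (unif p) 0) = (μ₁ (unif p) * μ₂ (unif p) : ℂ) * v.1 g
    rw [borel2_scalar_mul, v.2.2, div_self', map_one, Units.val_one, one_mul]
  hecke := by
    refine Subtype.ext (funext fun g => ?_)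
    have h1 : (heckeU (principalSeries μ₁ μ₂).toRepresentation 1 v).1 g =
        ∑ x ∈ Finset.range p, v.1 (g * borel2 (unif p) 1 (x : ℚ_[p])) := by
      rw [heckeU_apply, pow_one, pow_one, AddSubmonoidClass.coe_finsetSum, Finset.sum_apply]
      rfl
    have h2 := hv.hecke h₁ h₂ g
    rw [← h1] at h2
    exact h2
  prod_eq := by
    rw [← sqrtPrime_sq (p := p)]
    ring

end NewVectors

/-! ### The intertwining operator on the new vector -/

section Combination

variable {p : ℕ} [hp : Fact p.Prime]
variable {V : Type*} [AddCommGroup V] [Module ℂ V] {σ : Representation ℂ (GL (Fin 2) ℚ_[p]) V}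
variable {W : Type*} [AddCommGroup W] [Module ℂ W] {σ' : Representation ℂ (GL (Fin 2) ℚ_[p]) W}

/-- The intertwining operator on the new vector, for abstract representations `σ` and `σ'`: the
hypotheses on `σ` and `v` are those satisfied by a Steinberg representation, and the last two
inequalities give absolute convergence. -/
lemma isStandardIntertwiningImage_of_norm_lt {v : V} {v' : W} (hσ : IsSmoothRep σ)
    (h0 : ∀ x, (∀ k ∈ maxCompact p (Fin 2), σ k x = x) → x = 0)
    {c ε : ℂ} (hv : IsIwahoriEigenvector σ v c ε) (hc : c ≠ 0) (hε : ε ≠ 0)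
    {ω τ₁ τ₂ : ℂ} (hv' : IsSphericalEigenvector σ' v' ω τ₁ τ₂) (hω : ω ≠ 0)
    {φ : parabolicInduction σ σ' (-2)} (hφ : IsMirahoricVector 1 0 (v ⊗ₜ[ℂ] v') φ)
    {φt : parabolicInduction σ' σ (-(-2))} (hφt : IsMirahoricVector 1 1 (v' ⊗ₜ[ℂ] v) φt)
    {R : ℝ} (hR : 0 < R) (h₁ : ‖τ₁‖ ≤ R) (h₂ : ‖τ₂‖ ≤ R)
    (ha : p * (‖c‖ * R) < ‖ω‖) (hb : p ^ 4 * ‖c‖ ^ 2 < ‖ω‖) :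
    IsStandardIntertwiningImage σ σ' (-2) φ (((1 - c / ω * τ₁) * (1 - c / ω * τ₂) /
      ((1 - p * (c / ω) * τ₁) * (1 - p * (c / ω) * τ₂))) • φt) := by
  have hφ' := hφ.isNewInducedVector
  have hω' : 0 < ‖ω‖ := norm_pos_iff.2 hω
  have hlt : ∀ τ : ℂ, ‖τ‖ ≤ R → ‖p * (c / ω) * τ‖ < 1 := fun τ hτ => by
    rw [norm_mul, norm_mul, norm_div, Complex.norm_natCast]
    calc p * (‖c‖ / ‖ω‖) * ‖τ‖ ≤ p * (‖c‖ / ‖ω‖) * R := by gcongr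
      _ = p * (‖c‖ * R) / ‖ω‖ := by ring
      _ < 1 := (div_lt_one hω').2 ha
  exact isStandardIntertwiningImage_of_values h0 hφ hφt
    (hφ'.hasIntertwiningIntegral_one h0 hv hv' hω (hlt _ h₁) (hlt _ h₂) fun l hl =>
      hφ'.integrable h0 hv hc hε hv' hω hR h₁ h₂ ha hb hl (one_mem _))
    (hφ'.hasIntertwiningIntegral_xi hσ h0 fun l hl =>
      hφ'.integrable h0 hv hc hε hv' hω hR h₁ h₂ ha hb hl (xi_mem 0))

end Combination

/-! ### The Hecke bound -/

section HeckeBound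

open Asymptotics Filter

lemma hsym_comm (x y : ℂ) : ∀ n, hsym x y n = hsym y x n
  | 0 => rfl
  | 1 => by simp only [hsym]; ring
  | n + 2 => by
    rw [hsym_add_two, hsym_add_two, hsym_comm x y n, hsym_comm x y (n + 1)]
    ring

/-- A bound for the complete homogeneous symmetric polynomials bounds the variables. -/
lemma norm_le_of_hsym_isBigO {x y : ℂ} {R : ℝ} (hR : 0 ≤ R)
    (h : (fun n => hsym x y n) =O[atTop] fun n => R ^ n) : ‖y‖ ≤ R := by
  by_contra! hlt
  -- powers of `y` are differences of two terms of size `O(Rⁿ)`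
  have h1 : (fun n => y ^ (n + 1)) =O[atTop] fun n => R ^ n := by
    have h2 : (fun n => hsym x y (n + 1)) =O[atTop] fun n => R ^ n := by
      refine (h.comp_tendsto (tendsto_add_atTop_nat 1)).trans ?_
      refine IsBigO.of_bound R (Eventually.of_forall fun n => ?_)
      simp [pow_succ', abs_of_nonneg hR]
    refine (h2.sub (h.const_mul_left x)).congr_left fun n => ?_
    simp only [hsym]; ring
  have h2 : (fun n => y ^ (n + 1)) =o[atTop] fun n => y ^ (n + 1) := by
    refine h1.trans_isLittleO ?_
    refine ((isLittleO_pow_pow_of_lt_left hR hlt).trans_isBigO ?_).of_norm_right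
    refine IsBigO.of_bound ‖y‖⁻¹ (Eventually.of_forall fun n => ?_)
    have : 0 < ‖y‖ := hR.trans_lt hlt
    simp [pow_succ']
    field_simp
    exact le_rfl
  refine isLittleO_irrefl (Frequently.of_forall fun n => ?_) h2
  exact pow_ne_zero _ (norm_pos_iff.1 (hR.trans_lt hlt))

lemma fourierCoeff_isBigO {N : ℕ} [NeZero N] {k : ℤ} (h : CuspForm (Gamma1R N) k) :
    fourierCoeff h =O[atTop] fun n => (n : ℝ) ^ ((k : ℝ) / 2) := by
  have := CuspFormClass.qExpansion_isBigO h
  rwa [CongruenceSubgroup.strictWidthInfty_Gamma1] at this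

variable {N : ℕ} {k : ℤ} {χ : DirichletCharacter ℂ N} {h : CuspForm (Gamma1R N) k} {p : ℕ}

lemma IsNormalizedEigenform.fourierCoeff_pow (hh : IsNormalizedEigenform χ h) (hp : p.Prime)
    {x y : ℂ} (hadd : x + y = fourierCoeff h p) (hmul : x * y = χ p * (p : ℂ) ^ (k - 1)) :
    ∀ n, fourierCoeff h (p ^ n) = hsym x y n
  | 0 => by rw [pow_zero, hh.coeff_one]; rfl
  | 1 => by rw [pow_one, ← hadd]; simp [hsym]
  | n + 2 => by
    have h1 := hh.hecke p hp (p ^ (n + 1))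
    rw [if_pos (dvd_pow_self p n.succ_ne_zero), pow_succ' p n, Nat.mul_div_cancel_left _ hp.pos,
      ← pow_succ', ← pow_succ', hh.fourierCoeff_pow hp hadd hmul n,
      hh.fourierCoeff_pow hp hadd hmul (n + 1), ← hmul, ← hadd] at h1
    rw [hsym_add_two, ← h1, add_sub_cancel_right]

/-- The Hecke bound `|α| ≤ p^{k/2}` for the Satake parameters of a cuspidal eigenform. It follows
from the bound `a(n, h) = O(n^{k/2})` along the powers of `p`. -/
lemma IsNormalizedEigenform.norm_le (hh : IsNormalizedEigenform χ h) [NeZero N] (hp : p.Prime)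
    {x y : ℂ} (hadd : x + y = fourierCoeff h p) (hmul : x * y = χ p * (p : ℂ) ^ (k - 1)) :
    ‖x‖ ≤ (p : ℝ) ^ ((k : ℝ) / 2) ∧ ‖y‖ ≤ (p : ℝ) ^ ((k : ℝ) / 2) := by
  have h1 : (fun n => hsym x y n) =O[atTop] fun n : ℕ => ((p : ℝ) ^ ((k : ℝ) / 2)) ^ n := by
    refine ((fourierCoeff_isBigO h).comp_tendsto
      (tendsto_pow_atTop_atTop_of_one_lt hp.one_lt)).congr (fun n => ?_) fun n => ?_
    · exact hh.fourierCoeff_pow hp hadd hmul n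
    · simp only [Function.comp_apply, Nat.cast_pow]
      rw [← Real.rpow_natCast, ← Real.rpow_natCast, ← Real.rpow_mul p.cast_nonneg,
        ← Real.rpow_mul p.cast_nonneg, mul_comm]
  have hR : 0 ≤ (p : ℝ) ^ ((k : ℝ) / 2) := Real.rpow_nonneg p.cast_nonneg _
  exact ⟨norm_le_of_hsym_isBigO hR (h1.congr_left fun n => hsym_comm x y n),
    norm_le_of_hsym_isBigO hR h1⟩

end HeckeBound

/-! ### The Rankin-Selberg Euler factor -/

section EulerFactor

variable {N N' : ℕ} {k k' : ℤ} {χ : DirichletCharacter ℂ N} {h : CuspForm (Gamma1R N) k}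
  {χ' : DirichletCharacter ℂ N'} {h' : CuspForm (Gamma1R N') k'} {p : ℕ}

lemma satakeRoots_eq {x y : ℂ} (hadd : x + y = fourierCoeff h p)
    (hmul : x * y = χ p * (p : ℂ) ^ (k - 1)) : satakeRoots p χ h = {x, y} := by
  have h1 : Polynomial.X ^ 2 - Polynomial.C (fourierCoeff h p) * Polynomial.X +
      Polynomial.C (χ (p : ZMod N) * (p : ℂ) ^ (k - 1)) =
      (Polynomial.X - Polynomial.C x) * (Polynomial.X - Polynomial.C y) := by
    rw [← hadd, ← hmul, map_add, map_mul]
    ring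
  rw [satakeRoots, h1, Polynomial.roots_mul (mul_ne_zero (Polynomial.X_sub_C_ne_zero x)
    (Polynomial.X_sub_C_ne_zero y)), Polynomial.roots_X_sub_C, Polynomial.roots_X_sub_C]
  rfl

lemma rankinSelbergFactor_eq (hχ : χ p = 0) {x y : ℂ} (hadd : x + y = fourierCoeff h' p)
    (hmul : x * y = χ' p * (p : ℂ) ^ (k' - 1)) (s : ℂ) :
    rankinSelbergFactor p χ h χ' h' s =
      ((1 - fourierCoeff h p * x * (p : ℂ) ^ (-s)) *
        (1 - fourierCoeff h p * y * (p : ℂ) ^ (-s)))⁻¹ := by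
  rw [rankinSelbergFactor, satakeRoots_eq (x := 0) (y := fourierCoeff h p) (zero_add _)
    (by rw [hχ, zero_mul, zero_mul]), satakeRoots_eq hadd hmul]
  simp [Multiset.insert_eq_cons, mul_comm]

lemma norm_character_prime (hp : p.Prime) (hN : ¬ p ∣ N) (χ : DirichletCharacter ℂ N) :
    ‖χ p‖ = 1 := by
  have h1 : IsUnit (p : ZMod N) :=
    (ZMod.isUnit_iff_coprime p N).2 ((Nat.Prime.coprime_iff_not_dvd hp).2 hN)
  rw [← h1.unit_spec]
  exact χ.unit_norm_eq_one _

/-- The character `χ` of level prime to `p` vanishes at `p` when it is viewed modulo `p M`, so that one of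
the Satake parameters of `h` is zero. -/
lemma changeLevel_prime (hp : p.Prime) {M : ℕ} (χ : DirichletCharacter ℂ M) (hM : M ∣ p * M) :
    DirichletCharacter.changeLevel hM χ p = 0 := by
  refine MulChar.map_nonunit _ fun h1 => ?_
  have h2 := (ZMod.isUnit_iff_coprime p (p * M)).1 h1
  exact hp.one_lt.ne' (Nat.Coprime.eq_one_of_dvd h2 (dvd_mul_right p M))

lemma ratio_rankinSelbergFactor (hχ : χ p = 0) {x y : ℂ} (hp : p.Prime)
    (hadd : x + y = fourierCoeff h' p) (hmul : x * y = χ' p * (p : ℂ) ^ (k' - 1)) (m : ℤ) :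
    rankinSelbergFactor p χ h χ' h' ((k' : ℂ) - 3 - (m : ℂ)) /
        rankinSelbergFactor p χ h χ' h' ((k' : ℂ) - 2 - (m : ℂ)) =
      (1 - fourierCoeff h p * x * (p : ℂ) ^ (m + 2 - k')) *
          (1 - fourierCoeff h p * y * (p : ℂ) ^ (m + 2 - k')) /
        ((1 - p * (fourierCoeff h p * x * (p : ℂ) ^ (m + 2 - k'))) *
          (1 - p * (fourierCoeff h p * y * (p : ℂ) ^ (m + 2 - k')))) := by
  have hpc : (p : ℂ) ≠ 0 := Nat.cast_ne_zero.2 hp.ne_zero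
  have e2 : (p : ℂ) ^ (-((k' : ℂ) - 2 - (m : ℂ))) = (p : ℂ) ^ (m + 2 - k') := by
    rw [← Complex.cpow_intCast]
    congr 1
    push_cast
    ring
  have e3 : (p : ℂ) ^ (-((k' : ℂ) - 3 - (m : ℂ))) = p * (p : ℂ) ^ (m + 2 - k') := by
    rw [← zpow_one_add₀ hpc, ← Complex.cpow_intCast]
    congr 1
    push_cast
    ring
  rw [rankinSelbergFactor_eq hχ hadd hmul, rankinSelbergFactor_eq hχ hadd hmul, e2, e3,
    inv_div_inv]
  congr 2 <;> ring

end EulerFactor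

/-! ### Local parameters -/

section Parameters

variable {p : ℕ} [hp : Fact p.Prime]

lemma prime_cpow_neg_half : (p : ℂ) ^ (-(1 / 2) : ℂ) = (sqrtPrime p)⁻¹ := by
  rw [sqrtPrime, Complex.cpow_neg, Complex.ofReal_cpow (prime_pos_real p).le]
  norm_num

variable {N' : ℕ} {k' : ℤ} {χ' : DirichletCharacter ℂ N'} {h' : CuspForm (Gamma1R N') k'}
  {μ₁ μ₂ : ℚ_[p]ˣ →* ℂˣ}

/-- The Satake parameters of `h'` are `χ'(p) p^{1/2} μᵢ(p)`. -/
lemma IsDualUnramifiedComponent.satake (hμ : IsDualUnramifiedComponent χ' h' μ₁ μ₂)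
    (hχ : χ' p ≠ 0) :
    χ' p * (sqrtPrime p * μ₁ (unif p)) + χ' p * (sqrtPrime p * μ₂ (unif p)) = fourierCoeff h' p ∧
      χ' p * (sqrtPrime p * μ₁ (unif p)) * (χ' p * (sqrtPrime p * μ₂ (unif p))) =
        χ' p * (p : ℂ) ^ (k' - 1) := by
  have hs := sqrtPrime_ne_zero (p := p)
  have hpc : (p : ℂ) ≠ 0 := Nat.cast_ne_zero.2 hp.out.ne_zero
  constructor
  · have h1 := hμ.trace
    rw [prime_cpow_neg_half] at h1
    rw [← mul_add, ← mul_add, h1, mul_inv_cancel_left₀ hs, mul_inv_cancel_left₀ hχ]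
  · calc _ = χ' p ^ 2 * sqrtPrime p ^ 2 * (μ₁ (unif p) * μ₂ (unif p)) := by ring
      _ = χ' p * (p * (p : ℂ) ^ (k' - 2)) := by
        rw [hμ.central, sqrtPrime_sq]
        field_simp
      _ = χ' p * (p : ℂ) ^ (k' - 1) := by
        rw [← zpow_one_add₀ hpc]
        congr 2
        ring

/-- The two inequalities of absolute convergence both amount to `2m + 4 < k' - k`. -/
lemma convergence_inequalities {k k' m : ℤ} (hm : 2 * m + 4 < k' - k) {c ω : ℂ}
    (hc : ‖c‖ ^ 2 = (p : ℝ) ^ (k - 2 + 2 * m)) (hω : ‖ω‖ = (p : ℝ) ^ (k' - 2)) :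
    p * (‖c‖ * (p : ℝ) ^ ((k' : ℝ) / 2)) < ‖ω‖ ∧ p ^ 4 * ‖c‖ ^ 2 < ‖ω‖ := by
  have hp0 := prime_pos_real p
  have hp1 := one_lt_prime_real p
  constructor
  · refine lt_of_pow_lt_pow_left₀ 2 (norm_nonneg _) ?_
    have h1 : ((p : ℝ) ^ ((k' : ℝ) / 2)) ^ 2 = (p : ℝ) ^ k' := by
      rw [← Real.rpow_natCast, ← Real.rpow_mul hp0.le, ← Real.rpow_intCast]
      congr 1
      push_cast
      ring
    rw [mul_pow, mul_pow, hc, hω, h1, ← zpow_natCast, ← zpow_natCast, ← _root_.zpow_mul, ← zpow_add₀ hp0.ne',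
      ← zpow_add₀ hp0.ne']
    refine zpow_lt_zpow_right₀ hp1 ?_
    push_cast
    linarith
  · rw [hc, hω, ← zpow_natCast, ← zpow_add₀ hp0.ne']
    refine zpow_lt_zpow_right₀ hp1 ?_
    push_cast
    linarith

end Parameters

end LocalCalc

end

theorem mainTheorem7 (p : ℕ) [Fact p.Prime] (N₀ N' : ℕ) (hN₀ : ¬ p ∣ N₀) (hN' : ¬ p ∣ N')
    (k k' m : ℤ) (hm : 2 * m + 4 < k' - k)
    (χ : DirichletCharacter ℂ N₀) (χ' : DirichletCharacter ℂ N')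
    (h : CuspForm (LocalCalc.Gamma1R (p * N₀)) k) (h' : CuspForm (LocalCalc.Gamma1R N') k')
    (hh : LocalCalc.IsNormalizedEigenform
      (DirichletCharacter.changeLevel (Dvd.intro_left p rfl) χ) h)
    (hh' : LocalCalc.IsNormalizedEigenform χ' h')
    (χp χ₁' χ₂' : ℚ_[p]ˣ →* ℂˣ)
    (hσ : LocalCalc.IsSteinbergComponent χ h m χp)
    (hσ' : LocalCalc.IsDualUnramifiedComponent χ' h' χ₁' χ₂')
    (v : (LocalCalc.steinberg χp).toSubmodule) (hv : LocalCalc.IsSteinbergNewVector v)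
    (v' : (LocalCalc.principalSeries χ₁' χ₂').toSubmodule) (hv' : LocalCalc.IsSphericalVector v')
    (φ : LocalCalc.parabolicInduction (LocalCalc.steinberg χp).toRepresentation
      (LocalCalc.principalSeries χ₁' χ₂').toRepresentation (-2))
    (hφ : LocalCalc.IsMirahoricVector 1 0 (v ⊗ₜ[ℂ] v') φ)
    (φt : LocalCalc.parabolicInduction (LocalCalc.principalSeries χ₁' χ₂').toRepresentation
      (LocalCalc.steinberg χp).toRepresentation (-(-2)))
    (hφt : LocalCalc.IsMirahoricVector 1 1 (v' ⊗ₜ[ℂ] v) φt) :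
    LocalCalc.IsStandardIntertwiningImage (LocalCalc.steinberg χp).toRepresentation
      (LocalCalc.principalSeries χ₁' χ₂').toRepresentation (-2) φ
      ((LocalCalc.rankinSelbergFactor p
            (DirichletCharacter.changeLevel (Dvd.intro_left p rfl) χ) h χ' h'
            ((k' : ℂ) - 3 - (m : ℂ)) /
          LocalCalc.rankinSelbergFactor p
            (DirichletCharacter.changeLevel (Dvd.intro_left p rfl) χ) h χ' h'
            ((k' : ℂ) - 2 - (m : ℂ))) • φt) := by
  open LocalCalc in
  have hp : p.Prime := Fact.out
  have : NeZero N' := ⟨fun h0 => hN' (h0 ▸ dvd_zero p)⟩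
  have hp0 := prime_pos_real p
  have hpc : (p : ℂ) ≠ 0 := Nat.cast_ne_zero.2 hp.ne_zero
  have hχ1 := norm_character_prime hp hN₀ χ
  have hχ1' := norm_character_prime hp hN' χ'
  have hχ0' : χ' p ≠ 0 := norm_pos_iff.1 (hχ1' ▸ one_pos)
  obtain ⟨hadd, hmul⟩ := hσ'.satake hχ0'
  obtain ⟨h₁, h₂⟩ := hh'.norm_le hp hadd hmul
  rw [norm_mul, hχ1', one_mul] at h₁ h₂
  have hω : (χ₁' (unif p) * χ₂' (unif p) : ℂ) ≠ 0 :=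
    mul_ne_zero (χ₁' (unif p)).ne_zero (χ₂' (unif p)).ne_zero
  obtain ⟨ha, hb⟩ := convergence_inequalities (p := p) hm (c := χp (unif p))
    (ω := χ₁' (unif p) * χ₂' (unif p))
    (by rw [← norm_pow, hσ.central, norm_mul, hχ1, mul_one, norm_zpow, Complex.norm_natCast])
    (by rw [hσ'.central, norm_mul, norm_inv, hχ1', inv_one, mul_one, norm_zpow,
      Complex.norm_natCast])
  have key := isStandardIntertwiningImage_of_norm_lt IsSmoothRep.of_steinberg
    steinberg_eq_zero_of_fixed (hv.isIwahoriEigenvector hσ.unramified) (χp (unif p)).ne_zero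
    neg_unif_ne_zero (hv'.isSphericalEigenvector hσ'.unramified₁ hσ'.unramified₂) hω hφ hφt
    (Real.rpow_pos_of_pos hp0 _) h₁ h₂ ha hb
  -- `(c / ω) τᵢ` is the product of a Satake parameter of `h` and one of `h'`, times `p^{-(k'-2-m)}`
  have e : ∀ τ : ℂ, (χp (unif p) : ℂ) / (χ₁' (unif p) * χ₂' (unif p)) * τ =
      fourierCoeff h p * (χ' p * τ) * (p : ℂ) ^ (m + 2 - k') := fun τ => by
    rw [hσ.lFactor, hσ'.central, show m + 2 - k' = m - (k' - 2) by ring, zpow_sub₀ hpc m (k' - 2)]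
    have hz := zpow_ne_zero (k' - 2) hpc
    generalize (p : ℂ) ^ (k' - 2) = z at hz ⊢
    field_simp
  rw [ratio_rankinSelbergFactor (changeLevel_prime hp χ _) hp hadd hmul m]
  simpa only [mul_assoc (p : ℂ), e] using key
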